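/- Let $\Omega>0$, let $p,q\in L^1_{\rm loc}(\mathbb R)$ be complex-valued and $\Omega$-periodic, $q\not\equiv 0$, and let $$L=J\frac{d}{dx}+Q,\qquad J=\begin{pmatrix}i&0\\0&-i\end{pmatrix},\qquad Q=\begin{pmatrix}0&-iq\\ ip&0\end{pmatrix}.$$ A $2\times2$ matrix-valued differential expression $P=\sum_{k=0}^{m}A_k(x)\frac{d^k}{dx^k}$ is said to commute with $L$ if for every $y\in C^\infty(\mathbb R,\mathbb C^2)$ both $PLy$ and $LPy$ are defined (that is, $Ly,(Ly)',\dots,(Ly)^{(m-1)}$ and $Py$ are locally absolutely continuous) and $PLy=LPy$ almost everywhere. For $E\in\mathbb C$ let $\phi(E,\cdot,x_0,I)$ be the solution of $JY'+QY=EY$, $Y(x_0)=I$, and let $\operatorname{tr}T(E)=\operatorname{tr}\phi(E,x_0+\Omega,x_0,I)$ (which does not depend on $x_0$). Let $\delta(E,x)$ be the algebraic multiplicity of $E$ as an eigenvalue of the Dirichlet operator $H_{D,x}y=Ly$ in $L^2([x,x+\Omega])^2$ with domain $\{y\in AC([x,x+\Omega])^2 : y_1(x)=y_1(x+\Omega)=0,\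 Ly\in L^2([x,x+\Omega])^2\}$ (and $\delta(E,x)=0$ if $E$ is not an eigenvalue). Put $\delta_i(E)=\min_{x\in\mathbb R}\delta(E,x)$ and $\delta_m(E,x)=\delta(E,x)-\delta_i(E)$. The number of movable Dirichlet eigenvalues at $x$ is $\sum_{E\in\mathbb C}\delta_m(E,x)$. For $d_0\in\mathbb C$ let $$D(E)=e^{d_0E}E^{\delta_i(0)}\prod_{\lambda\in\mathbb C\setminus\{0\}}\bigl((1-E/\lambda)e^{E/\lambda}\bigr)^{\delta_i(\lambda)},\qquad U(E)=\frac{(\operatorname{tr}T(E))^2-4}{D(E)^2}.$$ **Theorem.** Let $n\ge0$. Suppose that a differential expression $P_{n+1}$ of order $n+1$ with leading coefficient $J^{n+2}$ commutes with $L$, and that for no $m$ with $0\le m<n+1$ does a differential expression of order $m$ with leading coefficient $J^{m+1}$ commute with $L$. Then: 1. For every $x\in\mathbb R$ with $q(x)\ne0$, all multiplicities $\delta(E,x)$, $E\in\mathbb C$, are finite, and the number of movable Dirichlet eigenvalues at $x$, counted with algebraic multiplicity, is exactly $n$. 2. The infinite product in $D(E)$ converges unconditionally for every $E\in\mathbb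 C$, and for a suitable normalization constant $d_0$ the function $U$ is (after removal of its removable singularities) a polynomial of degree $2n+2$; that is, there is a polynomial $U$ of degree $2n+2$ with $(\operatorname{tr}T(E))^2-4=U(E)D(E)^2$ for all $E\in\mathbb C$. -/

import Mathlib

open MeasureTheory Filter
open scoped ContDiff Matrix

namespace AKNS

/-! ### Matrix differential expressions -/

/-- The constant matrix `J = diag(i, -i)`. -/
noncomputable def J : Matrix (Fin 2) (Fin 2) ℂ := !![Complex.I, 0; 0, -Complex.I]

/-- The potential matrix `Q`, with zero diagonal and off-diagonal entries `-iq` and `ip`. -/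
noncomputable def Q (p q : ℝ → ℂ) (x : ℝ) : Matrix (Fin 2) (Fin 2) ℂ :=
  !![0, -Complex.I * q x; Complex.I * p x, 0]

/-- Local absolute continuity on `ℝ`. -/
def LocAC (y : ℝ → Fin 2 → ℂ) : Prop := ∀ a b : ℝ, AbsolutelyContinuousOnInterval y a b

/-- A `2 × 2` matrix-valued differential expression `∑_{k ≤ m} A_k(x) (d/dx)^k`, given by its
coefficients `A_0, …, A_m`. -/
abbrev DiffExpr (m : ℕ) : Type := Fin (m + 1) → ℝ → Matrix (Fin 2) (Fin 2) ℂ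

/-- The differential expression applied to a function. -/
noncomputable def DiffExpr.apply {m : ℕ} (A : DiffExpr m) (y : ℝ → Fin 2 → ℂ) : ℝ → Fin 2 → ℂ :=
  fun x => ∑ k : Fin (m + 1), A k x *ᵥ iteratedDeriv k y x

/-- The functions to which an expression of order `m` can be applied: `y, y', …, y^(m-1)` are
locally absolutely continuous (so that `y^(m)` exists almost everywhere). -/
def InDomain (m : ℕ) (y : ℝ → Fin 2 → ℂ) : Prop := ∀ j < m, LocAC (iteratedDeriv j y)

/-- The leading coefficient is the constant matrix `M`. In particular, if `M ≠ 0`, the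
expression has order exactly `m`. -/
def DiffExpr.HasLeadingCoeff {m : ℕ} (A : DiffExpr m) (M : Matrix (Fin 2) (Fin 2) ℂ) : Prop :=
  ∀ x, A (Fin.last m) x = M

/-- Two differential expressions commute: both compositions are defined on smooth functions,
and they agree there. -/
def DiffExpr.Commutes {m r : ℕ} (A : DiffExpr m) (B : DiffExpr r) : Prop :=
  ∀ y : ℝ → Fin 2 → ℂ, ContDiff ℝ ∞ y →
    InDomain m (B.apply y) ∧ InDomain r (A.apply y) ∧
      A.apply (B.apply y) =ᵐ[volume] B.apply (A.apply y)

/-- The Dirac-type expression `L = J d/dx + Q`. -/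
noncomputable def L (p q : ℝ → ℂ) : DiffExpr 1 := ![Q p q, fun _ => J]

/-! ### Solutions and the monodromy matrix -/

/-- `y` is a solution of `L y = E y` on `ℝ`. -/
def IsSolution (p q : ℝ → ℂ) (E : ℂ) (y : ℝ → Fin 2 → ℂ) : Prop :=
  LocAC y ∧ ∀ᵐ x, (L p q).apply y x = E • y x

/-- The unique solution `y` of `L y = E y` with `y(x₀) = v`. -/
noncomputable def sol (p q : ℝ → ℂ) (E : ℂ) (x₀ : ℝ) (v : Fin 2 → ℂ) : ℝ → Fin 2 → ℂ :=
  Classical.epsilon fun y => IsSolution p q E y ∧ y x₀ = v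

/-- The fundamental matrix `φ(E, x, x₀, I)`: the solution of `J Y' + Q Y = E Y`, `Y(x₀) = I`. -/
noncomputable def phi (p q : ℝ → ℂ) (E : ℂ) (x x₀ : ℝ) : Matrix (Fin 2) (Fin 2) ℂ :=
  Matrix.of fun i j => sol p q E x₀ (Pi.single j 1) x i

/-- The matrix `φ(E, x₀ + Ω, x₀, I)`, which represents the translation `y ↦ y(· + Ω)` on the space
of solutions of `L y = E y` in the basis formed by the columns of `φ(E, ·, x₀, I)`. -/
noncomputable def monodromy (p q : ℝ → ℂ) (Ω : ℝ) (E : ℂ) (x₀ : ℝ) :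
    Matrix (Fin 2) (Fin 2) ℂ :=
  phi p q E (x₀ + Ω) x₀

/-! ### Dirichlet eigenvalues -/

/-- The space `L²([x₀, x₀ + Ω])²` (only its vector space structure is used below). -/
abbrev L2 (Ω x₀ : ℝ) : Type :=
  Lp (Fin 2 → ℂ) 2 (volume.restrict (Set.Icc x₀ (x₀ + Ω)))

/-- The graph of the Dirichlet operator: `DirichletGraph p q Ω x₀ f h` says that `f` lies in the
domain of `H_{D,x₀}` and `H_{D,x₀} f = h`. Here `y` is the absolutely continuous representative
of `f`; its values outside `[x₀, x₀ + Ω]` are irrelevant. -/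
def DirichletGraph (p q : ℝ → ℂ) (Ω x₀ : ℝ) (f h : L2 Ω x₀) : Prop :=
  ∃ y : ℝ → Fin 2 → ℂ, AbsolutelyContinuousOnInterval y x₀ (x₀ + Ω) ∧
    y x₀ 0 = 0 ∧ y (x₀ + Ω) 0 = 0 ∧
    f =ᵐ[volume.restrict (Set.Icc x₀ (x₀ + Ω))] y ∧
    h =ᵐ[volume.restrict (Set.Icc x₀ (x₀ + Ω))] (L p q).apply y

/-- The kernel of `(H_{D,x₀} - E)^k`. -/
def rootKernel (p q : ℝ → ℂ) (Ω x₀ : ℝ) (E : ℂ) : ℕ → Set (L2 Ω x₀)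
  | 0 => {0}
  | k + 1 => {f | ∃ h, DirichletGraph p q Ω x₀ f h ∧ h - E • f ∈ rootKernel p q Ω x₀ E k}

/-- The algebraic multiplicity `δ(E, x)` of `E` as an eigenvalue of `H_{D,x}`: the dimension of
the union of the kernels of `(H_{D,x} - E)^k`, `k ∈ ℕ` (zero if `E` is not an eigenvalue). This
union is a linear space, so it equals its span. -/
noncomputable def delta (p q : ℝ → ℂ) (Ω : ℝ) (E : ℂ) (x : ℝ) : ℕ∞ :=
  Cardinal.toENat (Module.rank ℂ (Submodule.span ℂ (⋃ k, rootKernel p q Ω x E k)))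

/-- The immovable part `δ_i(E) = min_x δ(E, x)`. -/
noncomputable def deltaI (p q : ℝ → ℂ) (Ω : ℝ) (E : ℂ) : ℕ∞ := ⨅ x : ℝ, delta p q Ω E x

/-- The movable part `δ_m(E, x) = δ(E, x) - δ_i(E)`. -/
noncomputable def deltaM (p q : ℝ → ℂ) (Ω : ℝ) (E : ℂ) (x : ℝ) : ℕ∞ :=
  delta p q Ω E x - deltaI p q Ω E

/-! ### The canonical product of the immovable Dirichlet eigenvalues -/

/-- The factor `((1 - E/μ) e^{E/μ})^{δ_i(μ)}`, `μ ≠ 0`. -/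
noncomputable def factor (p q : ℝ → ℂ) (Ω : ℝ) (E : ℂ) (μ : {μ : ℂ // μ ≠ 0}) : ℂ :=
  ((1 - E / (μ : ℂ)) * Complex.exp (E / (μ : ℂ))) ^ (deltaI p q Ω μ).toNat

/-- `D(E) = e^{d₀ E} E^{δ_i(0)} ∏_{μ ≠ 0} ((1 - E/μ) e^{E/μ})^{δ_i(μ)}`. -/
noncomputable def D (p q : ℝ → ℂ) (Ω : ℝ) (d₀ E : ℂ) : ℂ :=
  Complex.exp (d₀ * E) * E ^ (deltaI p q Ω 0).toNat *
    ∏' μ : {μ : ℂ // μ ≠ 0}, factor p q Ω E μ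

end AKNS

/-! A commuting expression of order `n + 1` acts on the two-dimensional solution space of `L y = E
y`. Eliminating derivatives by means of `y' = U y`, this action is multiplication by a matrix `V(E,
x)`, polynomial of degree `n + 1` in `E` with leading coefficient `J`, and it obeys the
zero-curvature equation `V' = [U, V]` (`exists_zeroCurvature`); its trace can be removed
(`exists_isZeroCurvature`). Equivalently `V` intertwines the values of solutions at different points
(`IsZeroCurvature.mul_phi`). Hence `det V` depends on `E` only. By degree count `-det V` has degree
`2n + 2`, and the entry `V₁₂` has `E ^ n`-coefficient `-q(x)`.

Minimality of the order enters twice, both times through the converse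
`exists_commutes_of_recursion`: coefficients `b_k` that satisfy the zero-curvature recursion yield a
commuting expression `∑ b_k L ^ k`. If `V₁₂(E, ·)` vanished identically for some `E`, so would `V(E,
·)`; dividing `V` by the corresponding linear factor would lower the order. If `V` were not
periodic, its increment over a period, suitably normalized, would give a commuting expression of
lower order.

So the monodromy matrix `T` commutes with the periodic `V` and is of the form `t + c(E) V` with `c`
independent of `x`. The function `c` is entire, of exponential type and not identically zero. The
multiplicity `δ(E, x)` is the order of the zero of `T₁₂ = c V₁₂` whenever that order is finite
(`delta_eq_order`), because the Taylor coefficients in `E` of the Dirichlet solution form the Jordan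
chains. Orders add, and `V₁₂(E, ·)` is nonzero somewhere, so the immovable part is the order of `c`
and the movable part counts the roots of `V₁₂(·, x)`: there are `n` when `q(x) ≠ 0`.

Finally `det T = 1` gives `(tr T)² - 4 = -4 c² det V`, and Hadamard's factorization
(`exists_hadamard_factorization`) gives `c = a D`, so the polynomial sought is `-4 a² det V`. -/

namespace AKNS

/-! ### Linear differential equations: existence by Picard iteration, uniqueness by Gronwall. -/

section LinearODE

variable {X : Type*} [NormedAddCommGroup X] [NormedSpace ℝ X]

/-- The Picard iterates of a linear differential equation. -/
noncomputable def picardTerm (A : ℝ → X →L[ℝ] X) (t₀ : ℝ) (u₀ : ℝ → X) : ℕ → ℝ → X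
  | 0 => u₀
  | k + 1 => fun t => ∫ s in t₀..t, A s (picardTerm A t₀ u₀ k s)

theorem continuous_picardTerm {A : ℝ → X →L[ℝ] X} (hA : Continuous A) (t₀ : ℝ) {u₀ : ℝ → X}
    (hu₀ : Continuous u₀) (k : ℕ) : Continuous (picardTerm A t₀ u₀ k) := by
  induction k with
  | zero => exact hu₀
  | succ k ih =>
    exact intervalIntegral.continuous_primitive
      (fun a b => (hA.clm_apply ih).intervalIntegrable a b) t₀

/-- Each iteration costs a factor `M` and integrates `|s - t₀| ^ k`, which supplies the next factor
of the factorial. The resulting exponential series converges on every bounded interval, so the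
solution is global. -/
theorem norm_picardTerm_le {A : ℝ → X →L[ℝ] X} (t₀ : ℝ) {u₀ : ℝ → X} (hA : Continuous A)
    (hu₀ : Continuous u₀) {R M C : ℝ}
    (hM : ∀ t, |t - t₀| ≤ R → ‖A t‖ ≤ M) (hu : ∀ t, |t - t₀| ≤ R → ‖u₀ t‖ ≤ C) (k : ℕ) :
    ∀ t, |t - t₀| ≤ R → ‖picardTerm A t₀ u₀ k t‖ ≤ C * ((M * |t - t₀|) ^ k / k.factorial) := by
  induction k with
  | zero => intro t ht; simpa [picardTerm] using hu t ht
  | succ k ih =>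
    intro t ht
    have hMn : 0 ≤ M := (norm_nonneg _).trans (hM t ht)
    have hsub : ∀ s ∈ Set.uIoc t₀ t, |s - t₀| ≤ R := by
      intro s hs
      refine (Set.abs_sub_left_of_mem_uIcc (Set.uIoc_subset_uIcc hs)).trans ht
    calc ‖picardTerm A t₀ u₀ (k + 1) t‖
        ≤ ∫ s in Set.uIoc t₀ t, ‖A s (picardTerm A t₀ u₀ k s)‖ :=
          intervalIntegral.norm_integral_le_integral_norm_uIoc
      _ ≤ ∫ s in Set.uIoc t₀ t, C * M ^ (k + 1) / k.factorial * |s - t₀| ^ k := by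
          refine setIntegral_mono_on ?_ ?_ measurableSet_uIoc ?_
          · exact (((hA.clm_apply (continuous_picardTerm hA t₀ hu₀ k)).norm).integrableOn_uIoc)
          · exact (by fun_prop : Continuous fun s : ℝ =>
              C * M ^ (k + 1) / k.factorial * |s - t₀| ^ k).integrableOn_uIoc
          · intro s hs
            calc ‖A s (picardTerm A t₀ u₀ k s)‖
                ≤ M * (C * ((M * |s - t₀|) ^ k / k.factorial)) :=
                  ((A s).le_opNorm _).trans (mul_le_mul (hM s (hsub s hs)) (ih s (hsub s hs))
                    (norm_nonneg _) hMn)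
              _ = C * M ^ (k + 1) / k.factorial * |s - t₀| ^ k := by rw [mul_pow]; ring
      _ = C * ((M * |t - t₀|) ^ (k + 1) / (k + 1).factorial) := by
          rw [integral_const_mul, integral_pow_abs_sub_uIoc, mul_pow, Nat.factorial_succ]
          have := Nat.factorial_ne_zero k
          push_cast
          field_simp

/-- Global existence for linear differential equations with continuous coefficients. -/
theorem exists_linear_ode [CompleteSpace X] {A : ℝ → X →L[ℝ] X} {b : ℝ → X} (hA : Continuous A)
    (hb : Continuous b) (t₀ : ℝ) (v : X) :
    ∃ y : ℝ → X, y t₀ = v ∧ ∀ t, HasDerivAt y (A t (y t) + b t) t := by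
  set u₀ : ℝ → X := fun t => v + ∫ s in t₀..t, b s with hu₀
  have hu₀c : Continuous u₀ := continuous_const.add
    (intervalIntegral.continuous_primitive (fun a c => hb.intervalIntegrable a c) t₀)
  set u := picardTerm A t₀ u₀ with hu
  have huc := continuous_picardTerm hA t₀ hu₀c
  refine ⟨fun t => ∑' k, u k t, ?_, fun t => ?_⟩
  · change ∑' k, u k t₀ = v
    rw [tsum_eq_single 0]
    · simp [hu, picardTerm, hu₀]
    · intro k hk
      obtain ⟨k, rfl⟩ := Nat.exists_eq_succ_of_ne_zero hk
      simp [hu, picardTerm]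
  · set R : ℝ := |t - t₀| + 1
    have hcomp : IsCompact (Metric.closedBall t₀ R) := isCompact_closedBall _ _
    obtain ⟨M, hM⟩ := hcomp.exists_bound_of_continuousOn hA.continuousOn
    obtain ⟨C, hC⟩ := hcomp.exists_bound_of_continuousOn hu₀c.continuousOn
    obtain ⟨B, hB⟩ := hcomp.exists_bound_of_continuousOn hb.continuousOn
    have hR : 0 < R := by positivity
    have hmem : t₀ ∈ Metric.closedBall t₀ R := Metric.mem_closedBall_self hR.le
    have hM0 : 0 ≤ M := (norm_nonneg _).trans (hM t₀ hmem)
    have hC0 : 0 ≤ C := (norm_nonneg _).trans (hC t₀ hmem)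
    have hbd := norm_picardTerm_le t₀ hA hu₀c (R := R) (M := M)
      (fun s hs => hM s (by simpa [Real.dist_eq] using hs))
      (fun s hs => hC s (by simpa [Real.dist_eq] using hs))
    set w : ℕ → ℝ := fun k => C * ((M * R) ^ k / k.factorial) with hw
    have hws : Summable w := (Real.summable_pow_div_factorial (M * R)).mul_left C
    have hbd' : ∀ k s, |s - t₀| ≤ R → ‖u k s‖ ≤ w k := fun k s hs =>
      (hbd k s hs).trans (by simp only [hw]; gcongr)
    have hsum : ∀ s, |s - t₀| ≤ R → Summable fun k => u k s := fun s hs =>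
      Summable.of_norm_bounded hws fun k => hbd' k s hs
    -- The derivatives of the iterates: the zeroth contributes the forcing `b`, each later one `A`
    -- applied to its predecessor, so their sum is `A y + b`.
    set u' : ℕ → ℝ → X := fun k s => match k with
      | 0 => b s
      | k + 1 => A s (u k s) with hu'
    set w' : ℕ → ℝ := fun k => match k with
      | 0 => B
      | k + 1 => M * w k with hw'
    have hw's : Summable w' := by
      rw [← summable_nat_add_iff 1]
      exact hws.mul_left M
    have hder := hasDerivAt_tsum_of_isPreconnected (g := u) (g' := u') hw's
      (Metric.isOpen_ball (x := t₀) (ε := R)) (convex_ball t₀ R).isPreconnected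
      (fun k s _ => by
        cases k with
        | zero =>
          exact ((hb.integral_hasStrictDerivAt t₀ s).hasDerivAt).const_add v
        | succ k =>
          exact ((hA.clm_apply (huc k)).integral_hasStrictDerivAt t₀ s).hasDerivAt)
      (fun k s hs => by
        have hs' : |s - t₀| ≤ R := by simpa [Real.dist_eq] using (Metric.mem_ball.1 hs).le
        cases k with
        | zero => exact hB s (Metric.ball_subset_closedBall hs)
        | succ k =>
          exact ((A s).le_opNorm _).trans (mul_le_mul (hM s (Metric.ball_subset_closedBall hs))
            (hbd' k s hs') (norm_nonneg _) hM0))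
      (Metric.mem_ball_self hR) (hsum t₀ (by simpa using hR.le))
      (y := t) (by rw [Metric.mem_ball, Real.dist_eq]; simp [R])
    have htR : |t - t₀| ≤ R := by simp [R]
    have heq : ∑' k, u' k t = A t (∑' k, u k t) + b t := by
      have hs' : Summable fun k => u' k t := by
        rw [← summable_nat_add_iff 1]
        exact (hsum t htR).mapL (A t)
      rw [hs'.tsum_eq_zero_add, (A t).map_tsum (hsum t htR), add_comm]
    rwa [heq] at hder

/-- Gronwall's inequality. The one-sided local form is needed for Dirichlet eigenfunctions, for
which the equation is known on one period interval only. -/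
theorem eq_zero_of_linear_ode_right {A : ℝ → X →L[ℝ] X} (hA : Continuous A) {y : ℝ → X} {a b : ℝ}
    (hy : ContinuousOn y (Set.Icc a b))
    (hy' : ∀ t ∈ Set.Ico a b, HasDerivWithinAt y (A t (y t)) (Set.Ici t) t) (h0 : y a = 0) :
    ∀ t ∈ Set.Icc a b, y t = 0 := by
  obtain ⟨M, hM⟩ := (isCompact_Icc (a := a) (b := b)).exists_bound_of_continuousOn hA.continuousOn
  exact eq_zero_of_abs_deriv_le_mul_abs_self_of_eq_zero_right hy hy' h0 fun t ht =>
    ((A t).le_opNorm _).trans (mul_le_mul_of_nonneg_right (hM t (Set.Ico_subset_Icc_self ht))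
      (norm_nonneg _))

theorem eq_zero_of_linear_ode {A : ℝ → X →L[ℝ] X} (hA : Continuous A) {y : ℝ → X} {t₀ : ℝ}
    (hy : ∀ t, HasDerivAt y (A t (y t)) t) (h0 : y t₀ = 0) : y = 0 := by
  have hc : Continuous y := continuous_iff_continuousAt.2 fun t => (hy t).continuousAt
  funext t
  rcases le_total t₀ t with h | h
  · exact eq_zero_of_linear_ode_right hA hc.continuousOn
      (fun s _ => (hy s).hasDerivWithinAt) h0 t ⟨h, le_rfl⟩
  · have hz : ∀ s, HasDerivAt (fun s => y (-s)) ((-A (-s)) (y (-s))) s := fun s => by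
      simpa [Function.comp_def] using (hy (-s)).scomp s (hasDerivAt_neg s)
    have := eq_zero_of_linear_ode_right (A := fun s => -A (-s)) (y := fun s => y (-s))
      (a := -t₀) (b := -t) (by fun_prop) (by fun_prop)
      (fun s _ => (hz s).hasDerivWithinAt) (by simpa using h0) (-t) ⟨by linarith, le_rfl⟩
    simpa using this

end LinearODE

/-! ### From almost everywhere derivatives to classical ones. -/

section AbsolutelyContinuous

variable {X : Type*} [NormedAddCommGroup X] [NormedSpace ℝ X] [FiniteDimensional ℝ X]

/-- An absolutely continuous function whose derivative agrees almost everywhere with a continuous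
function is the integral of that function. -/
theorem eq_integral_of_absolutelyContinuous {f g : ℝ → X} {a b : ℝ}
    (hf : AbsolutelyContinuousOnInterval f a b) (hg : Continuous g)
    (h : ∀ᵐ x, x ∈ Set.uIcc a b → deriv f x = g x) :
    ∀ x ∈ Set.uIcc a b, f x = f a + ∫ t in a..x, g t := by
  have : CompleteSpace X := FiniteDimensional.complete ℝ X
  set G : ℝ → X := fun x => ∫ t in a..x, g t with hG
  have hGd : ∀ x, HasDerivAt G (g x) x := fun x => (hg.integral_hasStrictDerivAt a x).hasDerivAt
  have hGac : AbsolutelyContinuousOnInterval G a b := by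
    refine ContDiffOn.absolutelyContinuousOnInterval (ContDiff.contDiffOn ?_)
    exact contDiff_one_iff_deriv.2 ⟨fun x => (hGd x).differentiableAt,
      by rwa [show deriv G = g from funext fun x => (hGd x).deriv]⟩
  obtain ⟨C, hC⟩ := (hf.sub hGac).const_of_ae_hasDerivAt_zero (by
    filter_upwards [h, hf.boundedVariationOn.ae_differentiableAt_of_mem_uIcc] with x h1 h2 h3
    have := (h2 h3).hasDerivAt.sub (hGd x)
    rwa [h1 h3, sub_self] at this)
  intro x hx
  have h1 := hC x hx
  have h2 := hC a Set.left_mem_uIcc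
  have h3 : G a = 0 := by simp [hG]
  simp only [Pi.sub_apply, h3, sub_zero] at h1 h2
  rw [h2, ← h1]; abel

theorem hasDerivAt_of_absolutelyContinuous {f g : ℝ → X}
    (hf : ∀ a b, AbsolutelyContinuousOnInterval f a b) (hg : Continuous g)
    (h : ∀ᵐ x, deriv f x = g x) (x : ℝ) : HasDerivAt f (g x) x := by
  have : CompleteSpace X := FiniteDimensional.complete ℝ X
  have h1 : ∀ y ∈ Set.Ioo (x - 1) (x + 1), f y = f (x - 1) + ∫ t in (x - 1)..y, g t := by
    intro y hy
    refine eq_integral_of_absolutelyContinuous (hf (x - 1) (x + 1)) hg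
      (h.mono fun y hy _ => hy) y ?_
    rw [Set.uIcc_of_le (by linarith)]
    exact Set.Ioo_subset_Icc_self hy
  exact (((hg.integral_hasStrictDerivAt (x - 1) x).hasDerivAt).const_add _).congr_of_eventuallyEq
    (Filter.eventually_of_mem (Ioo_mem_nhds (by linarith) (by linarith)) h1)

end AbsolutelyContinuous

/-! ### Zeros and Hadamard factorization of entire functions of exponential type. -/

section Entire

open Metric Topology

/-- Dividing an entire function by the power of `z - w` given by its order at `w`. -/
theorem exists_entire_eq_pow_mul {f : ℂ → ℂ} (hf : Differentiable ℂ f) {w : ℂ}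
    (hw : analyticOrderAt f w ≠ ⊤) :
    ∃ g : ℂ → ℂ, Differentiable ℂ g ∧ g w ≠ 0 ∧
      ∀ z, f z = (z - w) ^ analyticOrderNatAt f w * g z := by
  classical
  obtain ⟨g₀, hg₀, hg₀w, hfg⟩ := (hf.analyticAt w).analyticOrderAt_ne_top.1 hw
  set m := analyticOrderNatAt f w
  set g : ℂ → ℂ := fun z => if z = w then g₀ w else f z / (z - w) ^ m with hg
  have hgw : g =ᶠ[𝓝 w] g₀ := by
    filter_upwards [hfg] with z hz
    by_cases h : z = w
    · simp [hg, h]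
    · have : (z - w) ^ m ≠ 0 := pow_ne_zero _ (sub_ne_zero.2 h)
      simp [hg, h, hz, this]
  refine ⟨g, fun z => ?_, by simpa [hg] using hg₀w, fun z => ?_⟩
  · by_cases h : z = w
    · rw [h]; exact (hg₀.differentiableAt).congr_of_eventuallyEq hgw
    · have h1 : g =ᶠ[𝓝 z] fun z => f z / (z - w) ^ m := by
        filter_upwards [isOpen_ne.mem_nhds h] with y hy
        have hy' : y ≠ w := hy
        simp [hg, hy']
      refine DifferentiableAt.congr_of_eventuallyEq ?_ h1
      exact (hf z).div (by fun_prop) (pow_ne_zero _ (sub_ne_zero.2 h))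
  · by_cases h : z = w
    · subst h
      have := hfg.self_of_nhds
      simp only [smul_eq_mul] at this
      simpa [hg] using this
    · have : (z - w) ^ m ≠ 0 := pow_ne_zero _ (sub_ne_zero.2 h)
      simp only [hg, h, if_false]
      field_simp

theorem analyticOrderAt_ne_top_of_entire {f : ℂ → ℂ} (hf : Differentiable ℂ f) {z₀ : ℂ}
    (h : f z₀ ≠ 0) (w : ℂ) : analyticOrderAt f w ≠ ⊤ := by
  intro htop
  have h1 := AnalyticOnNhd.eqOn_zero_of_preconnected_of_eventuallyEq_zero
    (fun z _ => hf.analyticAt z) isPreconnected_univ (Set.mem_univ w) (analyticOrderAt_eq_top.1 htop)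
  exact h (h1 (Set.mem_univ z₀))

/-- Dividing out finitely many zeros of an entire function. -/
theorem exists_entire_eq_prod_mul {f : ℂ → ℂ} (hf : Differentiable ℂ f) (h0 : f 0 ≠ 0)
    (S : Finset ℂ) (hS : ∀ w ∈ S, w ≠ 0) :
    ∃ g : ℂ → ℂ, Differentiable ℂ g ∧ (∀ w ∈ S, g w ≠ 0) ∧
      ∀ z, f z = (∏ w ∈ S, (1 - z / w) ^ analyticOrderNatAt f w) * g z := by
  classical
  induction S using Finset.induction_on with
  | empty => exact ⟨f, hf, by simp, by simp⟩
  | insert a S haS ih =>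
    obtain ⟨g, hg, hgS, hfg⟩ := ih fun w hw => hS w (Finset.mem_insert_of_mem hw)
    have ha : a ≠ 0 := hS a (Finset.mem_insert_self a S)
    set P : ℂ → ℂ := fun z => ∏ w ∈ S, (1 - z / w) ^ analyticOrderNatAt f w with hP
    have hPd : Differentiable ℂ P := by
      simp only [hP]
      fun_prop
    have hPa : P a ≠ 0 := by
      simp only [hP]
      refine Finset.prod_ne_zero_iff.2 fun w hw => pow_ne_zero _ ?_
      have hw0 : w ≠ 0 := hS w (Finset.mem_insert_of_mem hw)
      rw [sub_ne_zero, Ne, eq_comm, div_eq_one_iff_eq hw0]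
      rintro rfl
      exact haS hw
    have hfPg : f = P * g := funext hfg
    have hord : analyticOrderAt f a = analyticOrderAt g a := by
      rw [hfPg, analyticOrderAt_mul (hPd.analyticAt a) (hg.analyticAt a),
        (hPd.analyticAt a).analyticOrderAt_eq_zero.2 hPa, zero_add]
    have hordN : analyticOrderNatAt f a = analyticOrderNatAt g a := by
      simp only [analyticOrderNatAt, hord]
    obtain ⟨k, hk, hka, hgk⟩ := exists_entire_eq_pow_mul hg
      (hord ▸ analyticOrderAt_ne_top_of_entire hf h0 a)
    -- The power of `-a` converts `(z - a) ^ m` into the normalized factor `(1 - z / a) ^ m`.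
    refine ⟨fun z => (-a) ^ analyticOrderNatAt f a * k z, hk.const_mul _, fun w hw => ?_,
      fun z => ?_⟩
    · rcases Finset.mem_insert.1 hw with rfl | hw'
      · exact mul_ne_zero (pow_ne_zero _ (neg_ne_zero.2 ha)) hka
      · refine mul_ne_zero (pow_ne_zero _ (neg_ne_zero.2 ha)) fun h => hgS w hw' ?_
        rw [hgk w, h, mul_zero]
    · rw [Finset.prod_insert haS, hfg z, hgk z, ← hordN]
      have : (z - a) ^ analyticOrderNatAt f a
          = (1 - z / a) ^ analyticOrderNatAt f a * (-a) ^ analyticOrderNatAt f a := by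
        rw [← mul_pow]; congr 1; field_simp; ring
      rw [this]; ring

/-- Maximum principle for `g` on the disk of radius `ρ`: on its boundary every factor `1 - z / w`
has modulus at least `ρ / R - 1`. It serves twice: with `ρ = 4R` at the origin to count zeros, and
with `ρ = 2R` to bound the zero-free part. -/
theorem norm_mul_pow_le_of_eq_prod_mul {f g : ℂ → ℂ} (hg : Differentiable ℂ g) {S : Finset ℂ}
    {m : ℂ → ℕ} {R ρ B : ℝ} (hR : 0 < R) (hS : ∀ w ∈ S, w ≠ 0 ∧ ‖w‖ ≤ R)
    (hfg : ∀ z, f z = (∏ w ∈ S, (1 - z / w) ^ m w) * g z) (hρ : 2 * R ≤ ρ)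
    (hB : ∀ z, ‖z‖ = ρ → ‖f z‖ ≤ B) {z : ℂ} (hz : ‖z‖ ≤ ρ) :
    ‖g z‖ * (ρ / R - 1) ^ ∑ w ∈ S, m w ≤ B := by
  have hρ0 : 0 < ρ := by linarith
  have hq : 1 ≤ ρ / R - 1 := by
    have : 2 ≤ ρ / R := (le_div_iff₀ hR).2 hρ
    linarith
  have hqpos : 0 < (ρ / R - 1) ^ ∑ w ∈ S, m w := by positivity
  rw [← le_div_iff₀ hqpos]
  refine Complex.norm_le_of_forall_mem_frontier_norm_le (U := ball 0 ρ) isBounded_ball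
    hg.diffContOnCl (fun x hx => ?_) (by rw [closure_ball _ hρ0.ne']; simpa using hz)
  rw [frontier_ball _ hρ0.ne'] at hx
  have hx' : ‖x‖ = ρ := by simpa using hx
  rw [le_div_iff₀ hqpos]
  refine le_trans ?_ (hB x hx')
  rw [hfg x, norm_mul, mul_comm]
  refine mul_le_mul_of_nonneg_right ?_ (norm_nonneg _)
  rw [norm_prod, ← Finset.prod_pow_eq_pow_sum]
  refine Finset.prod_le_prod (fun w _ => by positivity) fun w hw => ?_
  rw [norm_pow]
  refine pow_le_pow_left₀ (by linarith) ?_ _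
  obtain ⟨hw0, hwR⟩ := hS w hw
  have h1 : ρ / R ≤ ‖x / w‖ := by
    rw [norm_div, hx']
    exact div_le_div_of_nonneg_left hρ0.le (norm_pos_iff.2 hw0) hwR
  have h2 : ‖x / w‖ - ‖(1 : ℂ)‖ ≤ ‖x / w - 1‖ := norm_sub_norm_le _ _
  rw [norm_sub_rev] at h2
  rw [norm_one] at h2
  linarith

/-- The number of zeros in a disk of an entire function of exponential type grows at most
linearly. -/
theorem sum_order_le {f : ℂ → ℂ} (hf : Differentiable ℂ f) (h0 : f 0 = 1) {C K : ℝ}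
    (hb : ∀ z, ‖f z‖ ≤ C * Real.exp (K * ‖z‖)) {R : ℝ} (hR : 0 < R)
    (S : Finset ℂ) (hS : ∀ w ∈ S, w ≠ 0 ∧ ‖w‖ ≤ R) :
    ((∑ w ∈ S, analyticOrderNatAt f w : ℕ) : ℝ) ≤ Real.log C + 4 * K * R := by
  obtain ⟨g, hg, -, hfg⟩ := exists_entire_eq_prod_mul hf (by simp [h0]) S fun w hw => (hS w hw).1
  have hg0 : g 0 = 1 := by
    have := hfg 0
    simpa [h0] using this.symm
  have h1 := norm_mul_pow_le_of_eq_prod_mul hg hR hS hfg (ρ := 4 * R) (by linarith)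
    (B := C * Real.exp (K * (4 * R))) (fun z hz => hz ▸ hb z) (z := 0)
    (by simpa using hR.le)
  have hC : 0 < C := by
    have := hb 0
    simp [h0] at this
    linarith
  rw [hg0, norm_one, one_mul, mul_div_assoc, div_self hR.ne'] at h1
  set k := ∑ w ∈ S, analyticOrderNatAt f w
  -- For `ρ = 4R` the base `ρ / R - 1` is `3`, which exceeds `e`.
  have h2 : Real.exp k ≤ C * Real.exp (K * (4 * R)) := by
    refine le_trans ?_ h1
    rw [show (k : ℝ) = k * 1 by ring, Real.exp_nat_mul]
    exact pow_le_pow_left₀ (Real.exp_pos _).le (by linarith [Real.exp_one_lt_d9]) _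
  have h3 := Real.log_le_log (Real.exp_pos _) h2
  rw [Real.log_exp, Real.log_mul hC.ne' (Real.exp_pos _).ne', Real.log_exp] at h3
  linarith

theorem finite_zeros_in_ball {f : ℂ → ℂ} (hf : Differentiable ℂ f) (h0 : f 0 = 1) {C K : ℝ}
    (hb : ∀ z, ‖f z‖ ≤ C * Real.exp (K * ‖z‖)) {R : ℝ} (hR : 0 < R) :
    {w : ℂ | f w = 0 ∧ ‖w‖ ≤ R}.Finite := by
  by_contra hinf
  obtain ⟨N, hN⟩ := exists_nat_gt (Real.log C + 4 * K * R)
  obtain ⟨S, hSsub, hScard⟩ := Set.Infinite.exists_subset_card_eq hinf N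
  have h1 := sum_order_le hf h0 hb hR S fun w hw => by
    obtain ⟨hw0, hwR⟩ := hSsub hw
    refine ⟨?_, hwR⟩
    rintro rfl
    simp [h0] at hw0
  have h2 : N ≤ ∑ w ∈ S, analyticOrderNatAt f w := by
    rw [← hScard, Finset.card_eq_sum_ones]
    refine Finset.sum_le_sum fun w hw => Nat.one_le_iff_ne_zero.2 fun h => ?_
    have h3 := analyticOrderAt_ne_top_of_entire hf (z₀ := 0) (by simp [h0]) w
    have h4 : analyticOrderAt f w = 0 := by
      rw [← Nat.cast_analyticOrderNatAt h3, h]; rfl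
    exact (hf.analyticAt w).analyticOrderAt_eq_zero.1 h4 (hSsub hw).1
  have : (N : ℝ) ≤ ((∑ w ∈ S, analyticOrderNatAt f w : ℕ) : ℝ) := by exact_mod_cast h2
  linarith

theorem apply_eq_zero_iff_order_ne_zero {f : ℂ → ℂ} (hf : Differentiable ℂ f) (h0 : f 0 = 1)
    (w : ℂ) : f w = 0 ↔ analyticOrderNatAt f w ≠ 0 := by
  have h3 := analyticOrderAt_ne_top_of_entire hf (z₀ := 0) (by simp [h0]) w
  rw [← (hf.analyticAt w).analyticOrderAt_ne_zero, ← Nat.cast_analyticOrderNatAt h3]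
  simp

theorem exists_pos_le_norm_of_order_ne_zero {f : ℂ → ℂ} (hf : Differentiable ℂ f) (h0 : f 0 = 1) :
    ∃ r > 0, ∀ w, analyticOrderNatAt f w ≠ 0 → r ≤ ‖w‖ := by
  have h1 : ∀ᶠ z in 𝓝 (0 : ℂ), f z ≠ 0 :=
    hf.continuous.continuousAt.eventually_ne (by simp [h0])
  obtain ⟨r, hr, hball⟩ := Metric.eventually_nhds_iff.1 h1
  refine ⟨r, hr, fun w hw => ?_⟩
  by_contra hlt
  exact hball (y := w) (by simpa using hlt) ((apply_eq_zero_iff_order_ne_zero hf h0 w).2 hw)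

/-- Dyadic decomposition: the zeros of modulus comparable to `2 ^ k * r` number `O(2 ^ k)` by
`sum_order_le`, and each contributes `O(4 ^ (-k))`. -/
theorem summable_order_div_sq {f : ℂ → ℂ} (hf : Differentiable ℂ f) (h0 : f 0 = 1) {C K : ℝ}
    (hb : ∀ z, ‖f z‖ ≤ C * Real.exp (K * ‖z‖)) :
    Summable fun w : {w : ℂ // w ≠ 0} => (analyticOrderNatAt f (w : ℂ) : ℝ) / ‖(w : ℂ)‖ ^ 2 := by
  classical
  obtain ⟨r, hr, hrle⟩ := exists_pos_le_norm_of_order_ne_zero hf h0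
  -- `κ w` is the index of the dyadic shell of `w`; points that are not zeros of `f` are put in
  -- shell `0`, where they contribute nothing.
  have hκ : ∀ w : {w : ℂ // w ≠ 0}, ∃ k : ℕ, analyticOrderNatAt f (w : ℂ) ≠ 0 →
      ‖(w : ℂ)‖ ≤ 2 ^ k * r ∧ 2 ^ k * r ≤ 2 * ‖(w : ℂ)‖ := by
    intro w
    by_cases hw : analyticOrderNatAt f (w : ℂ) = 0
    · exact ⟨0, fun h => absurd hw h⟩
    · obtain ⟨k, hk1, hk2⟩ := exists_nat_pow_near (x := ‖(w : ℂ)‖ / r) (y := 2)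
        ((one_le_div hr).2 (hrle w hw)) one_lt_two
      rw [le_div_iff₀ hr] at hk1
      rw [div_lt_iff₀ hr] at hk2
      exact ⟨k + 1, fun _ => ⟨hk2.le, by rw [pow_succ]; linarith⟩⟩
  choose κ hκ using hκ
  set v : ℕ → ℝ := fun k => 4 * (Real.log C + 4 * K * (2 ^ k * r)) / (2 ^ k * r) ^ 2 with hv
  have hvs : Summable v := by
    have h1 : v = fun k => (4 * Real.log C / r ^ 2) * (1 / 4) ^ k + (16 * K / r) * (1 / 2) ^ k := by
      funext k
      simp only [hv]
      have h4 : (4 : ℝ) ^ k = 2 ^ k * 2 ^ k := by rw [← mul_pow]; norm_num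
      rw [one_div_pow, one_div_pow, h4]
      field_simp
      ring
    rw [h1]
    exact ((summable_geometric_of_lt_one (by norm_num) (by norm_num)).mul_left _).add
      ((summable_geometric_of_lt_one (by norm_num) (by norm_num)).mul_left _)
  have hS : ∀ k (S : Finset {w : ℂ // w ≠ 0}), (∀ w ∈ S, κ w = k) →
      ∑ w ∈ S, (analyticOrderNatAt f (w : ℂ) : ℝ) / ‖(w : ℂ)‖ ^ 2 ≤ v k := by
    intro k S hSk
    set S' := (S.filter fun w : {w : ℂ // w ≠ 0} => analyticOrderNatAt f (w : ℂ) ≠ 0).map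
      (Function.Embedding.subtype _) with hS'
    have hcount := sum_order_le hf h0 hb (R := 2 ^ k * r) (by positivity) S' (by
      intro w hw
      obtain ⟨w', hw', rfl⟩ := Finset.mem_map.1 hw
      obtain ⟨h1, h2⟩ := Finset.mem_filter.1 hw'
      exact ⟨w'.2, hSk w' h1 ▸ (hκ w' h2).1⟩)
    rw [hS', Finset.sum_map] at hcount
    have h1 : ∀ w ∈ S.filter fun w : {w : ℂ // w ≠ 0} => analyticOrderNatAt f (w : ℂ) ≠ 0,
        (analyticOrderNatAt f (w : ℂ) : ℝ) / ‖(w : ℂ)‖ ^ 2 ≤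
          4 / (2 ^ k * r) ^ 2 * (analyticOrderNatAt f (w : ℂ) : ℝ) := by
      intro w hw
      obtain ⟨h1, h2⟩ := Finset.mem_filter.1 hw
      have h3 := (hκ w h2).2
      rw [hSk w h1] at h3
      have hw0 : 0 < ‖(w : ℂ)‖ := norm_pos_iff.2 w.2
      have hp : 0 < 2 ^ k * r := by positivity
      rw [div_eq_mul_inv, mul_comm]
      refine mul_le_mul_of_nonneg_right ?_ (Nat.cast_nonneg _)
      rw [inv_eq_one_div, div_le_div_iff₀ (by positivity) (by positivity)]
      nlinarith
    rw [← Finset.sum_filter_add_sum_filter_not S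
      fun w : {w : ℂ // w ≠ 0} => analyticOrderNatAt f (w : ℂ) ≠ 0]
    rw [Finset.sum_eq_zero (s := S.filter fun w : {w : ℂ // w ≠ 0} => ¬ analyticOrderNatAt f (w : ℂ) ≠ 0)
      (fun w hw => by
        have := (Finset.mem_filter.1 hw).2
        simp only [ne_eq, not_not] at this
        simp [this]), add_zero]
    refine (Finset.sum_le_sum h1).trans ?_
    rw [← Finset.mul_sum, hv]
    push_cast at hcount
    have := mul_le_mul_of_nonneg_left hcount (by positivity : 0 ≤ 4 / (2 ^ k * r) ^ 2)
    refine this.trans (le_of_eq ?_)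
    ring
  have hv0 : ∀ k, 0 ≤ v k := fun k => by simpa using hS k ∅ (by simp)
  refine summable_of_sum_le (c := ∑' k, v k) (fun w => by positivity) fun S => ?_
  rw [← Finset.sum_fiberwise_of_maps_to (s := S) (t := Finset.range (S.sup κ + 1)) (g := κ)
    (fun w hw => Finset.mem_range.2 (Nat.lt_succ_of_le (Finset.le_sup hw)))]
  refine (Finset.sum_le_sum fun k _ => hS k _ fun w hw => (Finset.mem_filter.1 hw).2).trans ?_
  exact hvs.sum_le_tsum _ fun k _ => hv0 k

/-- The linear terms of `1 - z` and `exp z` cancel, so the factor deviates from `1` only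
quadratically. This matches the summability of `m(w) / |w|²`. -/
theorem norm_primaryFactor_sub_one_le (z : ℂ) :
    ‖(1 - z) * Complex.exp z - 1‖ ≤ 2 * ‖z‖ ^ 2 * Real.exp ‖z‖ := by
  have h1 := Complex.norm_exp_sub_sum_le_norm_mul_exp z 2
  have h2 := Complex.norm_exp_sub_sum_le_norm_mul_exp z 1
  simp [Finset.sum_range_succ] at h1 h2
  have : (1 - z) * Complex.exp z - 1 = (Complex.exp z - (1 + z)) - z * (Complex.exp z - 1) := by
    ring
  rw [this]
  refine (norm_sub_le _ _).trans ?_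
  rw [norm_mul]
  nlinarith [mul_le_mul_of_nonneg_left h2 (norm_nonneg z)]

theorem norm_one_add_pow_sub_one_le (u : ℂ) (m : ℕ) :
    ‖(1 + u) ^ m - 1‖ ≤ m * ‖u‖ * Real.exp (m * ‖u‖) := by
  have h1 := (Finset.range m).norm_prod_one_add_sub_one_le fun _ => u
  simp only [Finset.prod_const, Finset.card_range, Finset.sum_const, nsmul_eq_mul] at h1
  refine h1.trans ?_
  set t := (m : ℝ) * ‖u‖
  have h2 := Real.add_one_le_exp (-t)
  have h3 : Real.exp t * Real.exp (-t) = 1 := by rw [← Real.exp_add]; simp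
  nlinarith [Real.exp_pos t]

theorem multipliable_primaryFactor_pow {m : ℂ → ℕ}
    (hm : Summable fun w : {w : ℂ // w ≠ 0} => (m w : ℝ) / ‖(w : ℂ)‖ ^ 2) {r : ℝ} (hr : 0 < r)
    (hmr : ∀ w, m w ≠ 0 → r ≤ ‖w‖) (E : ℂ) :
    Multipliable fun w : {w : ℂ // w ≠ 0} =>
      ((1 - E / (w : ℂ)) * Complex.exp (E / (w : ℂ))) ^ m w := by
  set u : {w : ℂ // w ≠ 0} → ℂ := fun w => (1 - E / (w : ℂ)) * Complex.exp (E / (w : ℂ)) - 1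
    with hu
  have hmu : ∀ w : {w : ℂ // w ≠ 0}, (m w : ℝ) * ‖u w‖ ≤
      2 * ‖E‖ ^ 2 * Real.exp (‖E‖ / r) * ((m w : ℝ) / ‖(w : ℂ)‖ ^ 2) := by
    intro w
    by_cases h : m w = 0
    · simp [h]
    · have h1 := norm_primaryFactor_sub_one_le (E / (w : ℂ))
      have h2 : ‖E / (w : ℂ)‖ ≤ ‖E‖ / r := by
        rw [norm_div]
        exact div_le_div_of_nonneg_left (norm_nonneg _) hr (hmr w h)
      have h3 : ‖u w‖ ≤ 2 * (‖E‖ / ‖(w : ℂ)‖) ^ 2 * Real.exp (‖E‖ / r) := by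
        refine h1.trans ?_
        rw [← norm_div]
        gcongr
      refine (mul_le_mul_of_nonneg_left h3 (Nat.cast_nonneg _)).trans (le_of_eq ?_)
      rw [div_pow]; ring
  have hsum : Summable fun w : {w : ℂ // w ≠ 0} => (m w : ℝ) * ‖u w‖ :=
    Summable.of_nonneg_of_le (fun w => by positivity) hmu (hm.mul_left _)
  have hbd : ∀ w : {w : ℂ // w ≠ 0}, (m w : ℝ) * ‖u w‖ ≤ ∑' w : {w : ℂ // w ≠ 0}, (m w : ℝ) * ‖u w‖ :=
    fun w => hsum.le_tsum w fun _ _ => by positivity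
  have h1 : Summable fun w : {w : ℂ // w ≠ 0} => (1 + u w) ^ m w - 1 := by
    refine Summable.of_norm_bounded (hsum.mul_right
      (Real.exp (∑' w : {w : ℂ // w ≠ 0}, (m w : ℝ) * ‖u w‖))) fun w => ?_
    refine (norm_one_add_pow_sub_one_le _ _).trans ?_
    have := hbd w
    gcongr
  have h2 := Complex.multipliable_one_add_of_summable h1
  refine h2.congr fun w => ?_
  simp [hu]

/-- A primitive `l` of `g' / g` exists on the disk, and `g * exp (-l)` has zero derivative. -/
theorem exists_log_of_ne_zero {g : ℂ → ℂ} (hg : Differentiable ℂ g) {R : ℝ}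
    (hne : ∀ z ∈ ball (0 : ℂ) R, g z ≠ 0) (h0 : g 0 = 1) :
    ∃ l : ℂ → ℂ, DifferentiableOn ℂ l (ball 0 R) ∧ l 0 = 0 ∧
      ∀ z ∈ ball (0 : ℂ) R, g z = Complex.exp (l z) := by
  by_cases hR : 0 < R
  swap
  · refine ⟨0, by rw [ball_eq_empty.2 (not_lt.1 hR)]; exact differentiableOn_empty, rfl, ?_⟩
    simp [ball_eq_empty.2 (not_lt.1 hR)]
  have hd : DifferentiableOn ℂ (fun z => deriv g z / g z) (ball 0 R) := fun z hz =>
    ((hg.analyticAt z).deriv.differentiableAt.div (hg z) (hne z hz)).differentiableWithinAt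
  obtain ⟨l, hl⟩ := hd.isExactOn_ball
  have h0mem : (0 : ℂ) ∈ ball (0 : ℂ) R := mem_ball_self hR
  refine ⟨fun z => l z - l 0, fun z hz =>
    ((hl z hz).differentiableAt.sub_const _).differentiableWithinAt, by simp, fun z hz => ?_⟩
  have hconst : ∀ z ∈ ball (0 : ℂ) R, HasDerivAt (fun z => g z * Complex.exp (-(l z - l 0))) 0 z := by
    intro z hz
    have h1 := (hg z).hasDerivAt.mul (((hl z hz).sub_const (l 0)).neg.cexp)
    convert! h1 using 1
    have := hne z hz
    field_simp
    ring
  have h2 := (convex_ball (0 : ℂ) R).is_const_of_fderivWithin_eq_zero (𝕜 := ℂ)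
    (f := fun z => g z * Complex.exp (-(l z - l 0)))
    (fun z hz => (hconst z hz).differentiableAt.differentiableWithinAt)
    (fun z hz => by
      rw [(hconst z hz).hasFDerivAt.hasFDerivWithinAt.fderivWithin
        (isOpen_ball.uniqueDiffWithinAt hz)]
      ext; simp) hz h0mem
  simp only [sub_self, neg_zero, Complex.exp_zero, mul_one, h0] at h2
  rw [Complex.exp_neg] at h2
  exact eq_of_mul_inv_eq_one h2

/-- Since primary factors are flat at the origin, the exponent in the factorization of `f` is
exactly `f'(0)`, whichever finite set of zeros has been divided out. -/
theorem hasDerivAt_prod_primaryFactor_pow (S : Finset ℂ) (m : ℂ → ℕ) :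
    HasDerivAt (fun z => ∏ w ∈ S, ((1 - z / w) * Complex.exp (z / w)) ^ m w) 0 0 := by
  classical
  induction S using Finset.induction_on with
  | empty => simpa using hasDerivAt_const (0 : ℂ) (1 : ℂ)
  | insert a S ha ih =>
    have h1 : HasDerivAt (fun z : ℂ => (1 - z / a) * Complex.exp (z / a)) 0 0 := by
      have h2 := ((hasDerivAt_id (0 : ℂ)).div_const a)
      have h3 := (h2.const_sub 1).mul h2.cexp
      convert! h3 using 1
      simp
    have h4 := (h1.pow (m a)).mul ih
    simp only [Finset.prod_insert ha]
    convert! h4 using 1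
    simp

/-- Hadamard factorization for entire functions of exponential type, normalized at the origin. -/
theorem eq_exp_mul_tprod_of_exponential_type {f : ℂ → ℂ} (hf : Differentiable ℂ f) (h0 : f 0 = 1)
    {C K : ℝ} (hK : 0 ≤ K) (hb : ∀ z, ‖f z‖ ≤ C * Real.exp (K * ‖z‖)) :
    (∀ E, Multipliable fun w : {w : ℂ // w ≠ 0} =>
      ((1 - E / (w : ℂ)) * Complex.exp (E / (w : ℂ))) ^ analyticOrderNatAt f w) ∧
    ∀ E, f E = Complex.exp (deriv f 0 * E) * ∏' w : {w : ℂ // w ≠ 0},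
      ((1 - E / (w : ℂ)) * Complex.exp (E / (w : ℂ))) ^ analyticOrderNatAt f w := by
  classical
  obtain ⟨r, hr, hrle⟩ := exists_pos_le_norm_of_order_ne_zero hf h0
  have hmult := multipliable_primaryFactor_pow (summable_order_div_sq hf h0 hb) hr hrle
  refine ⟨hmult, fun E => ?_⟩
  set m : ℂ → ℕ := fun w => analyticOrderNatAt f w with hm
  have hC : 1 ≤ C := by simpa [h0] using hb 0
  have hfin : ∀ N : ℕ, {w : ℂ | f w = 0 ∧ ‖w‖ ≤ (N : ℝ) + 1}.Finite := fun N =>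
    finite_zeros_in_ball hf h0 hb (by positivity)
  set S : ℕ → Finset ℂ := fun N => (hfin N).toFinset with hSdef
  have hSmem : ∀ N w, w ∈ S N ↔ f w = 0 ∧ ‖w‖ ≤ (N : ℝ) + 1 := fun N w => by simp [hSdef]
  have hS0 : ∀ N, ∀ w ∈ S N, w ≠ 0 := by
    rintro N w hw rfl
    simp [hSmem, h0] at hw
  set P : ℕ → ℂ → ℂ := fun N z => ∏ w ∈ S N, ((1 - z / w) * Complex.exp (z / w)) ^ m w with hP
  -- the remainder after dividing out the zeros of modulus at most `N + 1`
  have hrem : ∀ N : ℕ, 2 * ‖E‖ < (N : ℝ) + 1 → ∃ ρ : ℂ,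
      f E = P N E * Complex.exp (deriv f 0 * E) * Complex.exp ρ ∧
      ‖ρ‖ ≤ 16 * (Real.log C + 2 * K * ((N : ℝ) + 1) + 1) * ‖E‖ ^ 2 / ((N : ℝ) + 1) ^ 2 := by
    intro N hN
    set R : ℝ := (N : ℝ) + 1 with hR
    have hRpos : 0 < R := by positivity
    obtain ⟨g, hg, hgS, hfg⟩ := exists_entire_eq_prod_mul hf (by simp [h0]) (S N) (hS0 N)
    have hg0 : g 0 = 1 := by simpa [h0] using (hfg 0).symm
    have hgne : ∀ z ∈ ball (0 : ℂ) R, g z ≠ 0 := by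
      intro z hz h
      have hfz : f z = 0 := by rw [hfg z, h, mul_zero]
      exact hgS z ((hSmem N z).2 ⟨hfz, by simpa using (mem_ball_zero_iff.1 hz).le⟩) h
    obtain ⟨l, hl, hl0, hgl⟩ := exists_log_of_ne_zero hg hgne hg0
    -- The bound for the real part of `l` obtained from `norm_mul_pow_le_of_eq_prod_mul` with `ρ =
    -- 2R`, where `ρ / R - 1 = 1`. The summand `1` keeps it positive.
    set M : ℝ := Real.log C + 2 * K * R + 1 with hM
    have hMpos : 0 < M := by
      have := Real.log_nonneg hC
      positivity
    have hre : ∀ z ∈ ball (0 : ℂ) R, (l z).re ≤ M := by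
      intro z hz
      have h1 := norm_mul_pow_le_of_eq_prod_mul hg hRpos
        (fun w hw => ⟨hS0 N w hw, ((hSmem N w).1 hw).2⟩) hfg (ρ := 2 * R) le_rfl
        (B := C * Real.exp (K * (2 * R))) (fun z hz => hz ▸ hb z) (z := z)
        (by linarith [mem_ball_zero_iff.1 hz])
      rw [mul_div_assoc, div_self hRpos.ne', show (2 * 1 - 1 : ℝ) = 1 by norm_num, one_pow,
        mul_one, hgl z hz, Complex.norm_exp] at h1
      have h2 := Real.log_le_log (Real.exp_pos _) h1
      rw [Real.log_exp, Real.log_mul (by linarith) (Real.exp_pos _).ne', Real.log_exp] at h2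
      linarith
    -- Borel–Carathéodory turns the one-sided bound into a bound for `|l|` on half the disk.
    have hlb : ∀ z ∈ ball (0 : ℂ) (R / 2), ‖l z‖ ≤ 2 * M := by
      intro z hz
      have hz' : ‖z‖ < R / 2 := mem_ball_zero_iff.1 hz
      refine (Complex.borelCaratheodory_zero hMpos hl hre hRpos
        (mem_ball_zero_iff.2 (by linarith)) hl0).trans ?_
      rw [div_le_iff₀ (by linarith)]
      nlinarith
    have hsub : ball (0 : ℂ) (R / 2) ⊆ ball 0 R := ball_subset_ball (by linarith)
    have hld : ‖deriv l 0‖ ≤ 2 * M / (R / 2) :=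
      Complex.norm_deriv_le_div_of_mapsTo_ball (hl.mono hsub)
        (fun z hz => by rw [hl0]; simpa using hlb z hz) (by positivity)
    -- Without its linear part, `l` vanishes to second order at `0`, so the Schwarz lemma gives
    -- `|q(E)| = O(M |E|² / R²)`. As `M = O(R)`, this tends to zero when `R` grows.
    set q : ℂ → ℂ := fun z => l z - deriv l 0 * z with hq
    have hlat : HasDerivAt l (deriv l 0) 0 :=
      ((hl 0 (mem_ball_self hRpos)).differentiableAt (ball_mem_nhds _ hRpos)).hasDerivAt
    have hqE : ‖q E‖ ≤ 4 * M * (‖E‖ / (R / 2)) ^ 2 := by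
      have h1 := Complex.dist_le_mul_div_pow_of_mapsTo_ball_of_isLittleO (f := q) (c := 0) (z := E)
        (R₁ := R / 2) (R₂ := 4 * M) (n := 1)
        ((hl.mono hsub).sub (by fun_prop))
        (fun z hz => by
          simp only [hq, hl0, mul_zero, sub_zero, mem_closedBall, dist_zero_right]
          refine (norm_sub_le _ _).trans ?_
          rw [norm_mul]
          have hz' : ‖z‖ < R / 2 := mem_ball_zero_iff.1 hz
          have h2 : ‖deriv l 0‖ * ‖z‖ ≤ 2 * M / (R / 2) * (R / 2) :=
            mul_le_mul hld hz'.le (norm_nonneg _) (by positivity)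
          rw [div_mul_cancel₀ _ (by positivity)] at h2
          linarith [hlb z hz])
        (by
          have h2 := hlat.isLittleO
          simp only [hl0, sub_zero, smul_eq_mul] at h2
          simp only [hq, hl0, mul_zero, sub_zero, pow_one]
          refine (h2.norm_right).congr_left fun z => ?_
          ring)
        (mem_ball_zero_iff.2 (by linarith))
      simpa [hq, hl0] using h1
    set σ : ℂ := ∑ w ∈ S N, (m w : ℂ) / w with hσ
    have hPexp : ∀ z, P N z = (∏ w ∈ S N, (1 - z / w) ^ m w) * Complex.exp (z * σ) := by
      intro z
      simp only [hP, mul_pow, Finset.prod_mul_distrib, hσ, Finset.mul_sum, Complex.exp_sum,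
        ← Complex.exp_nat_mul]
      congr 1
      refine Finset.prod_congr rfl fun w _ => ?_
      congr 1; ring
    have hfP : ∀ z ∈ ball (0 : ℂ) R, f z = P N z * Complex.exp (l z - z * σ) := by
      intro z hz
      rw [hfg z, hgl z hz, hPexp, mul_assoc, ← Complex.exp_add]
      congr 2; ring
    have hderiv : deriv f 0 = deriv l 0 - σ := by
      have h1 : HasDerivAt (fun z => P N z * Complex.exp (l z - z * σ))
          (0 * Complex.exp (l 0 - 0 * σ) +
            P N 0 * (Complex.exp (l 0 - 0 * σ) * (deriv l 0 - 1 * σ))) 0 :=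
        (hasDerivAt_prod_primaryFactor_pow (S N) m).mul
          ((hlat.sub ((hasDerivAt_id (0 : ℂ)).mul_const σ)).cexp)
      have h2 := (h1.congr_of_eventuallyEq
        (Filter.eventually_of_mem (ball_mem_nhds _ hRpos) hfP)).deriv
      rw [h2]
      simp [hP, hl0]
    refine ⟨q E, ?_, hqE.trans (le_of_eq ?_)⟩
    · rw [hfP E (mem_ball_zero_iff.2 (by linarith [norm_nonneg E])), mul_assoc,
        ← Complex.exp_add, hderiv]
      congr 2
      simp only [hq]; ring
    · field_simp; ring
  -- the finite products converge to the infinite product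
  have hPlim : Tendsto (fun N => P N E) atTop (𝓝 (∏' w : {w : ℂ // w ≠ 0},
      ((1 - E / (w : ℂ)) * Complex.exp (E / (w : ℂ))) ^ m w)) := by
    have hprod := (hmult E).hasProd
    set F : {w : ℂ // w ≠ 0} → ℂ := fun w =>
      ((1 - E / (w : ℂ)) * Complex.exp (E / (w : ℂ))) ^ m w with hF
    intro V hV
    obtain ⟨s₀, hs₀⟩ := Filter.mem_atTop_sets.1 (hprod hV)
    obtain ⟨N₀, hN₀⟩ := exists_nat_gt (∑ w ∈ s₀, ‖(w : ℂ)‖)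
    refine Filter.mem_atTop_sets.2 ⟨N₀, fun N hN => ?_⟩
    set sN : Finset {w : ℂ // w ≠ 0} := (S N).subtype fun w => w ≠ 0
    have h1 : P N E = ∏ w ∈ sN, F w := by
      simp only [hP, hF]
      rw [Finset.prod_subtype_of_mem
        (f := fun w : ℂ => ((1 - E / w) * Complex.exp (E / w)) ^ m w) (hS0 N)]
    have h2 : ∏ w ∈ sN, F w = ∏ w ∈ sN ∪ s₀, F w := by
      refine Finset.prod_subset Finset.subset_union_left fun w hw hwn => ?_
      have hw0 : w ∈ s₀ := (Finset.mem_union.1 hw).resolve_left hwn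
      have hwN : ‖(w : ℂ)‖ ≤ (N : ℝ) + 1 := by
        have h3 := Finset.single_le_sum (f := fun w : {w : ℂ // w ≠ 0} => ‖(w : ℂ)‖)
          (fun _ _ => norm_nonneg _) hw0
        have : (N₀ : ℝ) ≤ N := by exact_mod_cast hN
        linarith
      have hm0 : m w = 0 := by
        by_contra hne
        exact hwn (Finset.mem_subtype.2 ((hSmem N w).2
          ⟨(apply_eq_zero_iff_order_ne_zero hf h0 w).2 hne, hwN⟩))
      simp [hF, hm0]
    show P N E ∈ V
    rw [h1, h2]
    exact hs₀ _ Finset.subset_union_right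
  -- pass to the limit
  have hev : ∀ᶠ N : ℕ in atTop, 2 * ‖E‖ < (N : ℝ) + 1 := by
    obtain ⟨N₀, hN₀⟩ := exists_nat_gt (2 * ‖E‖)
    filter_upwards [eventually_ge_atTop N₀] with N hN
    have : (N₀ : ℝ) ≤ N := by exact_mod_cast hN
    linarith
  have hρ : ∀ N : ℕ, ∃ ρ : ℂ, 2 * ‖E‖ < (N : ℝ) + 1 →
      f E = P N E * Complex.exp (deriv f 0 * E) * Complex.exp ρ ∧
      ‖ρ‖ ≤ 16 * (Real.log C + 2 * K * ((N : ℝ) + 1) + 1) * ‖E‖ ^ 2 / ((N : ℝ) + 1) ^ 2 := by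
    intro N
    by_cases h : 2 * ‖E‖ < (N : ℝ) + 1
    · obtain ⟨ρ, hρ⟩ := hrem N h
      exact ⟨ρ, fun _ => hρ⟩
    · exact ⟨0, fun h' => absurd h' h⟩
  choose ρ hρ using hρ
  have hρlim : Tendsto ρ atTop (𝓝 0) := by
    refine squeeze_zero_norm' (hev.mono fun N hN => (hρ N hN).2) ?_
    have h1 : Tendsto (fun N : ℕ => 1 / ((N : ℝ) + 1)) atTop (𝓝 0) :=
      tendsto_one_div_add_atTop_nhds_zero_nat
    have h2 := ((h1.mul h1).const_mul (16 * (Real.log C + 1) * ‖E‖ ^ 2)).add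
      (h1.const_mul (32 * K * ‖E‖ ^ 2))
    simp only [mul_zero, add_zero] at h2
    refine h2.congr fun N => ?_
    have : (N : ℝ) + 1 ≠ 0 := by positivity
    field_simp
    ring
  have hlim := (hPlim.mul_const (Complex.exp (deriv f 0 * E))).mul
    ((Complex.continuous_exp.tendsto 0).comp hρlim)
  rw [Complex.exp_zero, mul_one] at hlim
  have hconst : Tendsto (fun _ : ℕ => f E) atTop (𝓝 (f E)) := tendsto_const_nhds
  have := tendsto_nhds_unique (hconst.congr' (hev.mono fun N hN => (hρ N hN).1)) hlim
  rw [this, mul_comm]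

/-- Hadamard factorization for entire functions of exponential type. -/
theorem exists_hadamard_factorization {f : ℂ → ℂ} (hf : Differentiable ℂ f) {z₀ : ℂ}
    (hne : f z₀ ≠ 0) {C K : ℝ} (hK : 0 ≤ K) (hb : ∀ z, ‖f z‖ ≤ C * Real.exp (K * ‖z‖)) :
    (∀ E, Multipliable fun w : {w : ℂ // w ≠ 0} =>
      ((1 - E / (w : ℂ)) * Complex.exp (E / (w : ℂ))) ^ analyticOrderNatAt f w) ∧
    ∃ a d : ℂ, a ≠ 0 ∧ ∀ E, f E = a * (Complex.exp (d * E) * E ^ analyticOrderNatAt f 0 *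
      ∏' w : {w : ℂ // w ≠ 0},
        ((1 - E / (w : ℂ)) * Complex.exp (E / (w : ℂ))) ^ analyticOrderNatAt f w) := by
  have hord := analyticOrderAt_ne_top_of_entire hf hne
  obtain ⟨g, hg, hg0, hfg⟩ := exists_entire_eq_pow_mul hf (hord 0)
  simp only [sub_zero] at hfg
  set μ := analyticOrderNatAt f 0
  set h : ℂ → ℂ := fun z => (g 0)⁻¹ * g z with hh
  have hhd : Differentiable ℂ h := hg.const_mul _
  have hh0 : h 0 = 1 := by simp [hh, hg0]
  have hfh : f = fun z => (g 0 * z ^ μ) * h z := by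
    funext z
    rw [hfg z, hh]
    field_simp
  have hordh : ∀ w : ℂ, w ≠ 0 → analyticOrderNatAt h w = analyticOrderNatAt f w := by
    intro w hw
    have h1 : AnalyticAt ℂ (fun z : ℂ => g 0 * z ^ μ) w := by fun_prop
    have h2 : analyticOrderAt f w = analyticOrderAt h w := by
      conv_lhs => rw [hfh]
      rw [show (fun z => (g 0 * z ^ μ) * h z) = (fun z : ℂ => g 0 * z ^ μ) * h from rfl,
        analyticOrderAt_mul h1 (hhd.analyticAt w), h1.analyticOrderAt_eq_zero.2
        (mul_ne_zero hg0 (pow_ne_zero _ hw)), zero_add]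
    simp only [analyticOrderNatAt, h2]
  obtain ⟨B, hB⟩ := (isCompact_closedBall (0 : ℂ) 1).exists_bound_of_continuousOn
    hhd.continuous.continuousOn
  -- Dividing by `z ^ μ` preserves the growth bound: outside the unit disk the divisor has modulus
  -- at least one, inside compactness suffices.
  have hhb : ∀ z, ‖h z‖ ≤ max B (C / ‖g 0‖) * Real.exp (K * ‖z‖) := by
    intro z
    have hexp : 1 ≤ Real.exp (K * ‖z‖) := Real.one_le_exp (by positivity)
    rcases le_or_gt ‖z‖ 1 with hz | hz
    · have h1 := hB z (by simpa using hz)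
      have hB0 : 0 ≤ max B (C / ‖g 0‖) := ((norm_nonneg _).trans h1).trans (le_max_left _ _)
      calc ‖h z‖ ≤ max B (C / ‖g 0‖) := h1.trans (le_max_left _ _)
        _ ≤ _ := le_mul_of_one_le_right hB0 hexp
    · have h1 : ‖g 0‖ * ‖h z‖ ≤ ‖f z‖ := by
        rw [hfh]
        simp only [norm_mul, norm_pow]
        have : 1 ≤ ‖z‖ ^ μ := one_le_pow₀ hz.le
        have h2 : 0 ≤ ‖g 0‖ * ‖h z‖ := by positivity
        nlinarith
      have hg0' : 0 < ‖g 0‖ := norm_pos_iff.2 hg0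
      have h2 : ‖h z‖ ≤ C / ‖g 0‖ * Real.exp (K * ‖z‖) := by
        rw [div_mul_eq_mul_div, le_div_iff₀ hg0', mul_comm]
        exact h1.trans (hb z)
      exact h2.trans (mul_le_mul_of_nonneg_right (le_max_right _ _) (Real.exp_pos _).le)
  obtain ⟨h1, h2⟩ := eq_exp_mul_tprod_of_exponential_type hhd hh0 hK hhb
  have hfac : ∀ E : ℂ, (fun w : {w : ℂ // w ≠ 0} =>
      ((1 - E / (w : ℂ)) * Complex.exp (E / (w : ℂ))) ^ analyticOrderNatAt h w) =
      fun w : {w : ℂ // w ≠ 0} =>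
      ((1 - E / (w : ℂ)) * Complex.exp (E / (w : ℂ))) ^ analyticOrderNatAt f w := by
    intro E
    funext w
    rw [hordh w w.2]
  refine ⟨fun E => by simpa only [hfac] using h1 E, g 0, deriv h 0, hg0, fun E => ?_⟩
  conv_lhs => rw [hfh]
  simp only
  rw [h2 E]
  simp only [hfac]
  ring

end Entire

attribute [local instance] Matrix.normedAddCommGroup Matrix.normedSpace

/-! ### Derivatives and smoothness of products of `2 × 2` matrices and vectors. -/

section MatrixCalculus

/-- Matrix-vector multiplication as a continuous bilinear map. -/
noncomputable def mulVecL :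
    Matrix (Fin 2) (Fin 2) ℂ →L[ℝ] (Fin 2 → ℂ) →L[ℝ] (Fin 2 → ℂ) :=
  (LinearMap.mk₂ ℝ (fun (M : Matrix (Fin 2) (Fin 2) ℂ) v => M *ᵥ v)
    (fun _ _ _ => Matrix.add_mulVec _ _ _) (fun _ _ _ => Matrix.smul_mulVec _ _ _)
    (fun _ _ _ => Matrix.mulVec_add _ _ _)
    (fun _ _ _ => Matrix.mulVec_smul _ _ _)).toContinuousBilinearMap

@[simp] theorem mulVecL_apply (M : Matrix (Fin 2) (Fin 2) ℂ) (v : Fin 2 → ℂ) :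
    mulVecL M v = M *ᵥ v := rfl

/-- Matrix multiplication as a continuous bilinear map. -/
noncomputable def matMulL : Matrix (Fin 2) (Fin 2) ℂ →L[ℝ] Matrix (Fin 2) (Fin 2) ℂ →L[ℝ]
    Matrix (Fin 2) (Fin 2) ℂ :=
  (LinearMap.mk₂ ℝ (fun (M N : Matrix (Fin 2) (Fin 2) ℂ) => M * N)
    (fun _ _ _ => add_mul _ _ _) (fun _ _ _ => smul_mul_assoc _ _ _)
    (fun _ _ _ => mul_add _ _ _) (fun _ _ _ => mul_smul_comm _ _ _)).toContinuousBilinearMap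

theorem HasDerivAt.mulVec {M : ℝ → Matrix (Fin 2) (Fin 2) ℂ} {v : ℝ → Fin 2 → ℂ}
    {M' : Matrix (Fin 2) (Fin 2) ℂ} {v' : Fin 2 → ℂ} {x : ℝ} (hM : HasDerivAt M M' x)
    (hv : HasDerivAt v v' x) : HasDerivAt (fun x => M x *ᵥ v x) (M' *ᵥ v x + M x *ᵥ v') x := by
  have := mulVecL.hasDerivAt_of_bilinear (fun _ => hM) fun _ => hv
  rw [add_comm]
  exact this

theorem HasDerivAt.matMul {M N : ℝ → Matrix (Fin 2) (Fin 2) ℂ}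
    {M' N' : Matrix (Fin 2) (Fin 2) ℂ} {x : ℝ} (hM : HasDerivAt M M' x)
    (hN : HasDerivAt N N' x) : HasDerivAt (fun x => M x * N x) (M' * N x + M x * N') x := by
  have := matMulL.hasDerivAt_of_bilinear (fun _ => hM) fun _ => hN
  rw [add_comm]
  exact this

theorem HasDerivAt.const_mulVec (M : Matrix (Fin 2) (Fin 2) ℂ) {v : ℝ → Fin 2 → ℂ}
    {v' : Fin 2 → ℂ} {x : ℝ} (hv : HasDerivAt v v' x) :
    HasDerivAt (fun x => M *ᵥ v x) (M *ᵥ v') x :=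
  (mulVecL M).hasFDerivAt.comp_hasDerivAt x hv

theorem ContDiff.mulVec {k : WithTop ℕ∞} {M : ℝ → Matrix (Fin 2) (Fin 2) ℂ} {v : ℝ → Fin 2 → ℂ}
    (hM : ContDiff ℝ k M) (hv : ContDiff ℝ k v) : ContDiff ℝ k fun x => M x *ᵥ v x :=
  mulVecL.isBoundedBilinearMap.contDiff.comp (hM.prodMk hv)

theorem ContDiff.matMul {k : WithTop ℕ∞} {M N : ℝ → Matrix (Fin 2) (Fin 2) ℂ}
    (hM : ContDiff ℝ k M) (hN : ContDiff ℝ k N) : ContDiff ℝ k fun x => M x * N x :=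
  matMulL.isBoundedBilinearMap.contDiff.comp (hM.prodMk hN)

theorem ContDiff.matrix_of {k : WithTop ℕ∞} {M : ℝ → Matrix (Fin 2) (Fin 2) ℂ}
    (hM : ∀ i j, ContDiff ℝ k fun x => M x i j) : ContDiff ℝ k M :=
  contDiff_pi.2 fun i => contDiff_pi.2 fun j => hM i j

theorem hasDerivAt_matrix_iff {M : ℝ → Matrix (Fin 2) (Fin 2) ℂ} {M' : Matrix (Fin 2) (Fin 2) ℂ}
    {x : ℝ} : HasDerivAt M M' x ↔ ∀ i j, HasDerivAt (fun x => M x i j) (M' i j) x :=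
  ⟨fun h i j => hasDerivAt_pi.1 (hasDerivAt_pi.1 h i) j,
    fun h => hasDerivAt_pi.2 fun i => hasDerivAt_pi.2 fun j => h i j⟩

end MatrixCalculus

/-! ### The first order system: fundamental matrix, growth and expansion in `E`. -/

section System

/-- The coefficient matrix of the first order system `y' = U y` equivalent to `L y = E y`. -/
noncomputable def U (p q : ℝ → ℂ) (E : ℂ) (x : ℝ) : Matrix (Fin 2) (Fin 2) ℂ :=
  !![-Complex.I * E, q x; p x, Complex.I * E]

theorem L_apply (p q : ℝ → ℂ) (y : ℝ → Fin 2 → ℂ) (x : ℝ) :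
    (L p q).apply y x = Q p q x *ᵥ y x + J *ᵥ deriv y x := by
  simp [DiffExpr.apply, L, Fin.sum_univ_two, iteratedDeriv_one]

theorem J_mul_J : J * J = -1 := by
  ext i j; fin_cases i <;> fin_cases j <;> simp [J]

theorem U_eq (p q : ℝ → ℂ) (E : ℂ) (x : ℝ) : U p q E x = -(E • J) + J * Q p q x := by
  ext i j; fin_cases i <;> fin_cases j <;> simp [U, J, Q, mul_comm, ← mul_assoc]

theorem U_add (p q : ℝ → ℂ) (E h : ℂ) (x : ℝ) : U p q (E + h) x = U p q E x - h • J := by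
  rw [U_eq, U_eq, add_smul]; abel

/-- Multiply by `J` and use `J² = -1`. The inhomogeneity `w` is there for the generalized
eigenfunctions, which satisfy `(L - E) y = w`. -/
theorem Q_mulVec_add_J_mulVec_eq_iff (p q : ℝ → ℂ) (E : ℂ) (x : ℝ) (v v' w : Fin 2 → ℂ) :
    Q p q x *ᵥ v + J *ᵥ v' = E • v + w ↔ v' = U p q E x *ᵥ v - J *ᵥ w := by
  have hJ : ∀ u : Fin 2 → ℂ, J *ᵥ (J *ᵥ u) = -u := fun u => by
    rw [Matrix.mulVec_mulVec, J_mul_J, Matrix.neg_mulVec, Matrix.one_mulVec]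
  rw [U_eq, Matrix.add_mulVec, Matrix.neg_mulVec, Matrix.smul_mulVec, ← Matrix.mulVec_mulVec]
  constructor
  · intro h
    have h1 := congrArg (fun u => J *ᵥ u) h
    simp only [Matrix.mulVec_add, hJ, Matrix.mulVec_smul] at h1
    have h2 : v' = J *ᵥ (Q p q x *ᵥ v) - (J *ᵥ Q p q x *ᵥ v + -v') := by abel
    rw [h2, h1]; abel
  · rintro rfl
    simp only [Matrix.mulVec_add, Matrix.mulVec_sub, Matrix.mulVec_neg, Matrix.mulVec_smul, hJ]
    simp only [smul_neg, neg_neg, sub_neg_eq_add]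
    abel

theorem norm_U_mulVec_le (p q : ℝ → ℂ) (E : ℂ) (x : ℝ) (v : Fin 2 → ℂ) :
    ‖U p q E x *ᵥ v‖ ≤ (‖E‖ + (‖p x‖ + ‖q x‖)) * ‖v‖ := by
  have h0 := norm_le_pi_norm v 0
  have h1 := norm_le_pi_norm v 1
  have hn := norm_nonneg v
  refine (pi_norm_le_iff_of_nonneg (by positivity)).2 fun i => ?_
  fin_cases i
  · have : (U p q E x *ᵥ v) 0 = -Complex.I * E * v 0 + q x * v 1 := by
      simp [U, Matrix.mulVec, dotProduct, Fin.sum_univ_two]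
    simp only [Fin.zero_eta, this]
    refine (norm_add_le _ _).trans ?_
    simp only [norm_mul, norm_neg, Complex.norm_I, one_mul]
    nlinarith [mul_le_mul_of_nonneg_left h0 (norm_nonneg E),
      mul_le_mul_of_nonneg_left h1 (norm_nonneg (q x)), mul_nonneg (norm_nonneg (p x)) hn]
  · have : (U p q E x *ᵥ v) 1 = p x * v 0 + Complex.I * E * v 1 := by
      simp [U, Matrix.mulVec, dotProduct, Fin.sum_univ_two]
    simp only [Fin.mk_one, this]
    refine (norm_add_le _ _).trans ?_
    simp only [norm_mul, Complex.norm_I, one_mul]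
    nlinarith [mul_le_mul_of_nonneg_left h1 (norm_nonneg E),
      mul_le_mul_of_nonneg_left h0 (norm_nonneg (p x)), mul_nonneg (norm_nonneg (q x)) hn]

theorem norm_J_mulVec (v : Fin 2 → ℂ) : ‖J *ᵥ v‖ ≤ ‖v‖ := by
  refine (pi_norm_le_iff_of_nonneg (norm_nonneg _)).2 fun i => ?_
  have h0 := norm_le_pi_norm v i
  fin_cases i <;> simpa [J, Matrix.mulVec, dotProduct, Fin.sum_univ_two] using h0

variable {p q : ℝ → ℂ}

theorem contDiff_U {k : WithTop ℕ∞} (hp : ContDiff ℝ k p) (hq : ContDiff ℝ k q) (E : ℂ) :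
    ContDiff ℝ k (U p q E) := by
  refine ContDiff.matrix_of fun i j => ?_
  fin_cases i <;> fin_cases j <;> simp [U] <;> first | exact contDiff_const | assumption

theorem continuous_mulVecL_U (hp : Continuous p) (hq : Continuous q) (E : ℂ) :
    Continuous fun x => mulVecL (U p q E x) :=
  mulVecL.continuous.comp
    (contDiff_zero.1 (contDiff_U (contDiff_zero.2 hp) (contDiff_zero.2 hq) E))

theorem locAC_of_contDiff {y : ℝ → Fin 2 → ℂ} (hy : ContDiff ℝ 1 y) : LocAC y :=
  fun _ _ => hy.contDiffOn.absolutelyContinuousOnInterval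

theorem contDiff_one_of_hasDerivAt {X : Type*} [NormedAddCommGroup X] [NormedSpace ℝ X]
    {y g : ℝ → X} (h : ∀ x, HasDerivAt y (g x) x) (hg : Continuous g) : ContDiff ℝ 1 y :=
  contDiff_one_iff_deriv.2 ⟨fun x => (h x).differentiableAt, by
    rwa [show deriv y = g from funext fun x => (h x).deriv]⟩

/-- For continuous coefficients the right-hand side `U y` is continuous, so absolutely continuous
solutions are classical ones. -/
theorem isSolution_iff (hp : Continuous p) (hq : Continuous q) {E : ℂ} {y : ℝ → Fin 2 → ℂ} :
    IsSolution p q E y ↔ ∀ x, HasDerivAt y (U p q E x *ᵥ y x) x := by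
  have hL : ∀ x, (L p q).apply y x = E • y x ↔ deriv y x = U p q E x *ᵥ y x := fun x => by
    have := Q_mulVec_add_J_mulVec_eq_iff p q E x (y x) (deriv y x) 0
    simpa [L_apply] using this
  constructor
  · rintro ⟨hac, h⟩
    have hyc : Continuous y := by
      refine continuous_iff_continuousAt.2 fun x => ?_
      have := (hac (x - 1) (x + 1)).continuousOn
      exact this.continuousAt (Filter.mem_of_superset (Icc_mem_nhds (by linarith) (by linarith))
        Set.Icc_subset_uIcc)
    exact hasDerivAt_of_absolutelyContinuous hac ((continuous_mulVecL_U hp hq E).clm_apply hyc)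
      (h.mono fun x hx => (hL x).1 hx)
  · intro h
    have hyc : Continuous y := continuous_iff_continuousAt.2 fun x => (h x).continuousAt
    exact ⟨locAC_of_contDiff (contDiff_one_of_hasDerivAt h
      ((continuous_mulVecL_U hp hq E).clm_apply hyc)),
      Filter.Eventually.of_forall fun x => (hL x).2 (h x).deriv⟩

theorem sol_spec (hp : Continuous p) (hq : Continuous q) (E : ℂ) (x₀ : ℝ) (v : Fin 2 → ℂ) :
    (∀ x, HasDerivAt (sol p q E x₀ v) (U p q E x *ᵥ sol p q E x₀ v x) x) ∧
      sol p q E x₀ v x₀ = v := by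
  obtain ⟨y, hy0, hy⟩ := exists_linear_ode (continuous_mulVecL_U hp hq E)
    (continuous_const (y := (0 : Fin 2 → ℂ))) x₀ v
  have h : ∃ y, IsSolution p q E y ∧ y x₀ = v :=
    ⟨y, (isSolution_iff hp hq).2 fun x => by simpa using hy x, hy0⟩
  have := Classical.epsilon_spec h
  exact ⟨(isSolution_iff hp hq).1 this.1, this.2⟩

theorem eq_of_hasDerivAt_U (hp : Continuous p) (hq : Continuous q) {E : ℂ} {g y z : ℝ → Fin 2 → ℂ}
    {x₀ : ℝ} (hy : ∀ x, HasDerivAt y (U p q E x *ᵥ y x + g x) x)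
    (hz : ∀ x, HasDerivAt z (U p q E x *ᵥ z x + g x) x)
    (h0 : y x₀ = z x₀) : y = z := by
  have := eq_zero_of_linear_ode (y := y - z) (continuous_mulVecL_U hp hq E) (t₀ := x₀)
    (fun x => by
      have := (hy x).sub (hz x)
      simp only [add_sub_add_right_eq_sub] at this
      simpa [Matrix.mulVec_sub] using this) (by simp [h0])
  exact sub_eq_zero.1 this

theorem sol_eq (hp : Continuous p) (hq : Continuous q) {E : ℂ} {y : ℝ → Fin 2 → ℂ} {x₀ : ℝ}
    (hy : ∀ x, HasDerivAt y (U p q E x *ᵥ y x) x) : sol p q E x₀ (y x₀) = y :=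
  eq_of_hasDerivAt_U hp hq (g := 0) (by simpa using (sol_spec hp hq E x₀ (y x₀)).1)
    (by simpa using hy) (sol_spec hp hq E x₀ (y x₀)).2

theorem mulVec_single_one (M : Matrix (Fin 2) (Fin 2) ℂ) (j : Fin 2) :
    M *ᵥ Pi.single j 1 = fun i => M i j := by
  ext i; simp

theorem hasDerivAt_phi (hp : Continuous p) (hq : Continuous q) (E : ℂ) (x₀ x : ℝ) :
    HasDerivAt (fun x => phi p q E x x₀) (U p q E x * phi p q E x x₀) x := by
  refine hasDerivAt_matrix_iff.2 fun i j => ?_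
  have := hasDerivAt_pi.1 ((sol_spec hp hq E x₀ (Pi.single j 1)).1 x) i
  exact this

theorem phi_self (hp : Continuous p) (hq : Continuous q) (E : ℂ) (x₀ : ℝ) :
    phi p q E x₀ x₀ = 1 := by
  ext i j
  simp only [phi, Matrix.of_apply, (sol_spec hp hq E x₀ _).2]
  simp [Matrix.one_apply, Pi.single_apply]

/-- The inverse of the fundamental matrix, as its adjugate. -/
theorem hasDerivAt_adjugate {E : ℂ} {Y : ℝ → Matrix (Fin 2) (Fin 2) ℂ} {x : ℝ}
    (hY : HasDerivAt Y (U p q E x * Y x) x) :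
    HasDerivAt (fun x => (Y x).adjugate) (-((Y x).adjugate * U p q E x)) x := by
  have h := hasDerivAt_matrix_iff.1 hY
  refine hasDerivAt_matrix_iff.2 fun i j => ?_
  simp only [Matrix.adjugate_fin_two]
  fin_cases i <;> fin_cases j
  · convert! h 1 1 using 1
    simp [U, Matrix.mul_apply, Fin.sum_univ_two]; ring
  · convert! (h 0 1).neg using 1
    simp [U, Matrix.mul_apply, Fin.sum_univ_two]; ring
  · convert! (h 1 0).neg using 1
    simp [U, Matrix.mul_apply, Fin.sum_univ_two]; ring
  · convert! h 0 0 using 1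
    simp [U, Matrix.mul_apply, Fin.sum_univ_two]; ring

theorem eq_of_hasDerivAt_zero {X : Type*} [NormedAddCommGroup X] [NormedSpace ℝ X] {f : ℝ → X}
    (hf : ∀ x, HasDerivAt f 0 x) (x y : ℝ) : f x = f y :=
  is_const_of_deriv_eq_zero (fun x => (hf x).differentiableAt) (fun x => (hf x).deriv) x y

/-- Because `U` is traceless, the adjugate of `φ` solves the equation of the inverse; the product is
therefore constant. This is Liouville's formula `det φ = 1` in the form used later. -/
theorem adjugate_mul_phi (hp : Continuous p) (hq : Continuous q) (E : ℂ) (x₀ x : ℝ) :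
    (phi p q E x x₀).adjugate * phi p q E x x₀ = 1 := by
  have h : ∀ x, HasDerivAt (fun x => (phi p q E x x₀).adjugate * phi p q E x x₀) 0 x := by
    intro x
    have := HasDerivAt.matMul (hasDerivAt_adjugate (hasDerivAt_phi hp hq E x₀ x))
      (hasDerivAt_phi hp hq E x₀ x)
    convert! this using 1
    noncomm_ring
  rw [eq_of_hasDerivAt_zero h x x₀, phi_self hp hq, Matrix.adjugate_one, one_mul]

theorem phi_mul_adjugate (hp : Continuous p) (hq : Continuous q) (E : ℂ) (x₀ x : ℝ) :
    phi p q E x x₀ * (phi p q E x x₀).adjugate = 1 :=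
  mul_eq_one_comm.1 (adjugate_mul_phi hp hq E x₀ x)

theorem det_phi (hp : Continuous p) (hq : Continuous q) (E : ℂ) (x₀ x : ℝ) :
    (phi p q E x x₀).det = 1 := by
  have h := adjugate_mul_phi hp hq E x₀ x
  rw [Matrix.adjugate_mul] at h
  have := congrFun (congrFun h 0) 0
  simpa using this

theorem phi_eq_mul (hp : Continuous p) (hq : Continuous q) (E : ℂ) (x₀ x₁ x : ℝ) :
    phi p q E x x₁ = phi p q E x x₀ * (phi p q E x₁ x₀).adjugate := by
  have hcol : ∀ j, sol p q E x₁ (Pi.single j 1) =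
      fun x => (phi p q E x x₀ * (phi p q E x₁ x₀).adjugate) *ᵥ Pi.single j 1 := by
    intro j
    have h0 : (phi p q E x₁ x₀ * (phi p q E x₁ x₀).adjugate) *ᵥ Pi.single j 1 =
        (Pi.single j 1 : Fin 2 → ℂ) := by
      rw [phi_mul_adjugate hp hq, Matrix.one_mulVec]
    rw [← sol_eq hp hq (x₀ := x₁) (y := fun x => (phi p q E x x₀ *
      (phi p q E x₁ x₀).adjugate) *ᵥ Pi.single j 1) (E := E), h0]
    intro x
    have h1 := HasDerivAt.mulVec (hasDerivAt_phi hp hq E x₀ x)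
      (hasDerivAt_const x ((phi p q E x₁ x₀).adjugate *ᵥ Pi.single j 1))
    simp only [Matrix.mulVec_zero, add_zero] at h1
    simpa only [Matrix.mulVec_mulVec, Matrix.mul_assoc] using h1
  ext i j
  have := congrFun (congrFun (hcol j) x) i
  rw [phi, Matrix.of_apply, this, mulVec_single_one]

theorem continuous_sol (hp : Continuous p) (hq : Continuous q) (E : ℂ) (x₀ : ℝ)
    (v : Fin 2 → ℂ) : Continuous (sol p q E x₀ v) :=
  continuous_iff_continuousAt.2 fun x => ((sol_spec hp hq E x₀ v).1 x).continuousAt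

/-- Gronwall with the coefficient bound `|E| + M` over one period. It is the source of the
exponential type in the Hadamard argument. -/
theorem exists_norm_sol_le (hp : Continuous p) (hq : Continuous q) {Ω : ℝ} (hΩ : 0 < Ω) (x₀ : ℝ)
    (v : Fin 2 → ℂ) : ∃ M, ∀ E,
      ‖sol p q E x₀ v (x₀ + Ω)‖ ≤ M * Real.exp (Ω * ‖E‖) := by
  obtain ⟨M, hM⟩ := (isCompact_Icc (a := x₀) (b := x₀ + Ω)).exists_bound_of_continuousOn
    ((hp.norm.add hq.norm).continuousOn)
  refine ⟨‖v‖ * Real.exp (M * Ω), fun E => ?_⟩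
  have := norm_le_gronwallBound_of_norm_deriv_right_le (f := sol p q E x₀ v) (δ := ‖v‖)
    (K := ‖E‖ + M) (ε := 0) (a := x₀) (b := x₀ + Ω) (continuous_sol hp hq E x₀ v).continuousOn
    (fun x _ => ((sol_spec hp hq E x₀ v).1 x).hasDerivWithinAt)
    (by rw [(sol_spec hp hq E x₀ v).2]) (fun x hx => by
      rw [add_zero]
      refine (norm_U_mulVec_le p q E x _).trans (mul_le_mul_of_nonneg_right ?_ (norm_nonneg _))
      have := hM x (Set.Ico_subset_Icc_self hx)
      have h0 : ‖p x‖ + ‖q x‖ ≤ M := (le_abs_self _).trans this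
      linarith) (x₀ + Ω) ⟨by linarith, le_rfl⟩
  rw [gronwallBound_ε0] at this
  refine this.trans (le_of_eq ?_)
  rw [mul_assoc, ← Real.exp_add]
  congr 2; ring

/-- Solutions `s j` of `L s₀ = E s₀`, `(L - E) s (j + 1) = s j` with `s (j + 1) = 0` at `x₀`: the
Taylor coefficients of a solution with respect to `E`. -/
noncomputable def solTaylor (p q : ℝ → ℂ) (E : ℂ) (x₀ : ℝ) (v : Fin 2 → ℂ) : ℕ → ℝ → Fin 2 → ℂ
  | 0 => sol p q E x₀ v
  | j + 1 => Classical.epsilon fun y => (∀ x, HasDerivAt y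
      (U p q E x *ᵥ y x + -(J *ᵥ solTaylor p q E x₀ v j x)) x) ∧ y x₀ = 0

theorem continuous_solTaylor_and_spec (hp : Continuous p) (hq : Continuous q) (E : ℂ) (x₀ : ℝ)
    (v : Fin 2 → ℂ) (j : ℕ) : Continuous (solTaylor p q E x₀ v j) ∧
      (∀ x, HasDerivAt (solTaylor p q E x₀ v (j + 1)) (U p q E x *ᵥ solTaylor p q E x₀ v (j + 1) x
        + -(J *ᵥ solTaylor p q E x₀ v j x)) x) ∧ solTaylor p q E x₀ v (j + 1) x₀ = 0 := by
  have key : ∀ j, Continuous (solTaylor p q E x₀ v j) →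
      (∀ x, HasDerivAt (solTaylor p q E x₀ v (j + 1)) (U p q E x *ᵥ solTaylor p q E x₀ v (j + 1) x
        + -(J *ᵥ solTaylor p q E x₀ v j x)) x) ∧ solTaylor p q E x₀ v (j + 1) x₀ = 0 := by
    intro j hj
    obtain ⟨y, hy0, hy⟩ := exists_linear_ode (continuous_mulVecL_U hp hq E)
      (b := fun x => -(J *ᵥ solTaylor p q E x₀ v j x))
      (((mulVecL J).continuous.comp hj).neg) x₀ 0
    exact Classical.epsilon_spec (p := fun y => (∀ x, HasDerivAt y
      (U p q E x *ᵥ y x + -(J *ᵥ solTaylor p q E x₀ v j x)) x) ∧ y x₀ = 0) ⟨y, hy, hy0⟩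
  have hc : ∀ j, Continuous (solTaylor p q E x₀ v j) := by
    intro j
    induction j with
    | zero => exact continuous_sol hp hq E x₀ v
    | succ j ih => exact continuous_iff_continuousAt.2 fun x => ((key j ih).1 x).continuousAt
  exact ⟨hc j, key j (hc j)⟩

/-- The truncated sum telescopes: it solves the equation at `E + h` up to the residual `h ^ (N + 1)
• J s_N`. The error thus solves a linear equation with zero initial value and this small source, and
Gronwall applies, uniformly for `|h| ≤ 1`. -/
theorem exists_norm_sol_sub_taylor_le (hp : Continuous p) (hq : Continuous q) {Ω : ℝ}
    (hΩ : 0 < Ω) (E : ℂ) (x₀ : ℝ) (v : Fin 2 → ℂ) (N : ℕ) : ∃ C, ∀ h : ℂ, ‖h‖ ≤ 1 →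
      ‖sol p q (E + h) x₀ v (x₀ + Ω) -
        ∑ j ∈ Finset.range (N + 1), h ^ j • solTaylor p q E x₀ v j (x₀ + Ω)‖ ≤
      C * ‖h‖ ^ (N + 1) := by
  set s := solTaylor p q E x₀ v with hs
  have hspec := continuous_solTaylor_and_spec hp hq E x₀ v
  obtain ⟨M, hM⟩ := (isCompact_Icc (a := x₀) (b := x₀ + Ω)).exists_bound_of_continuousOn
    ((hp.norm.add hq.norm).continuousOn)
  obtain ⟨B, hB⟩ := (isCompact_Icc (a := x₀) (b := x₀ + Ω)).exists_bound_of_continuousOn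
    (hspec N).1.continuousOn
  have hM0 : 0 ≤ M := (norm_nonneg _).trans (hM x₀ ⟨le_rfl, by linarith⟩)
  set K : ℝ := ‖E‖ + 1 + M with hK
  have hKpos : 0 < K := by positivity
  refine ⟨B / K * (Real.exp (K * Ω) - 1), fun h hh => ?_⟩
  have hder : ∀ N x, HasDerivAt (fun x => ∑ j ∈ Finset.range (N + 1), h ^ j • s j x)
      (U p q (E + h) x *ᵥ (∑ j ∈ Finset.range (N + 1), h ^ j • s j x) +
        h ^ (N + 1) • (J *ᵥ s N x)) x := by
    intro N x
    induction N with
    | zero =>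
      have := (sol_spec hp hq E x₀ v).1 x
      simp only [zero_add, Finset.sum_range_one, pow_zero, one_smul, pow_one]
      convert! this using 1
      rw [U_add, Matrix.sub_mulVec, Matrix.smul_mulVec]
      simp [hs, solTaylor]
    | succ N ih =>
      have h1 := ((hspec N).2.1 x).const_smul (h ^ (N + 1))
      have h2 := ih.add h1
      simp only [Finset.sum_range_succ _ (N + 1)]
      refine h2.congr_deriv ?_
      rw [Matrix.mulVec_add, U_add, Matrix.mulVec_smul, Matrix.sub_mulVec _ _ (s (N + 1) x),
        Matrix.smul_mulVec, smul_sub, smul_add, smul_smul, smul_neg]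
      simp only [← hs]
      rw [show h ^ (N + 1) * h = h ^ (N + 1 + 1) by ring]
      abel
  have hr : ∀ x, HasDerivAt (fun x => sol p q (E + h) x₀ v x -
      ∑ j ∈ Finset.range (N + 1), h ^ j • s j x)
      (U p q (E + h) x *ᵥ (sol p q (E + h) x₀ v x -
      ∑ j ∈ Finset.range (N + 1), h ^ j • s j x) - h ^ (N + 1) • (J *ᵥ s N x)) x := by
    intro x
    have := ((sol_spec hp hq (E + h) x₀ v).1 x).sub (hder N x)
    refine this.congr_deriv ?_
    rw [Matrix.mulVec_sub]; abel
  have hr0 : sol p q (E + h) x₀ v x₀ - ∑ j ∈ Finset.range (N + 1), h ^ j • s j x₀ = 0 := by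
    rw [(sol_spec hp hq (E + h) x₀ v).2, Finset.sum_range_succ', Finset.sum_eq_zero
      (fun j _ => by rw [hs, (hspec j).2.2, smul_zero])]
    simp [hs, solTaylor, (sol_spec hp hq E x₀ v).2]
  have := norm_le_gronwallBound_of_norm_deriv_right_le (f := fun x => sol p q (E + h) x₀ v x -
      ∑ j ∈ Finset.range (N + 1), h ^ j • s j x) (δ := 0)
    (K := K) (ε := ‖h‖ ^ (N + 1) * B) (a := x₀) (b := x₀ + Ω)
    (fun x _ => (hr x).continuousAt.continuousWithinAt)
    (fun x _ => (hr x).hasDerivWithinAt)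
    (by rw [hr0, norm_zero]) (fun x hx => by
      have hx' := Set.Ico_subset_Icc_self hx
      refine (norm_sub_le _ _).trans (add_le_add ?_ ?_)
      · refine (norm_U_mulVec_le p q _ x _).trans (mul_le_mul_of_nonneg_right ?_ (norm_nonneg _))
        have h1 := hM x hx'
        have h0 : ‖p x‖ + ‖q x‖ ≤ M := (le_abs_self _).trans h1
        have h2 := norm_add_le E h
        linarith
      · rw [norm_smul, norm_pow]
        exact mul_le_mul_of_nonneg_left ((norm_J_mulVec _).trans (hB x hx')) (by positivity))
      (x₀ + Ω) ⟨by linarith, le_rfl⟩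
  rw [gronwallBound_of_K_ne_0 hKpos.ne'] at this
  refine this.trans (le_of_eq ?_)
  simp only [add_sub_cancel_left]
  ring

theorem differentiable_sol (hp : Continuous p) (hq : Continuous q) {Ω : ℝ}
    (hΩ : 0 < Ω) (x₀ : ℝ) (v : Fin 2 → ℂ) (i : Fin 2) :
    Differentiable ℂ fun E => sol p q E x₀ v (x₀ + Ω) i := by
  intro E
  obtain ⟨C, hC⟩ := exists_norm_sol_sub_taylor_le hp hq hΩ E x₀ v 1
  refine HasDerivAt.differentiableAt (f' := solTaylor p q E x₀ v 1 (x₀ + Ω) i) ?_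
  rw [hasDerivAt_iff_isLittleO_nhds_zero]
  have h1 : (fun h : ℂ => sol p q (E + h) x₀ v (x₀ + Ω) i - sol p q E x₀ v (x₀ + Ω) i -
      h • solTaylor p q E x₀ v 1 (x₀ + Ω) i) =O[nhds 0] fun h : ℂ => h ^ 2 := by
    refine Asymptotics.IsBigO.of_bound C ?_
    filter_upwards [Metric.closedBall_mem_nhds (0 : ℂ) one_pos] with h hh
    have h2 := hC h (by simpa using hh)
    have h3 := (norm_le_pi_norm _ i).trans h2
    simpa [Finset.sum_range_succ, solTaylor, sub_sub] using h3
  exact h1.trans_isLittleO (by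
    simpa using Asymptotics.isLittleO_pow_pow (𝕜 := ℂ) (show 1 < 2 by norm_num))

end System

/-! ### Algebraic multiplicities of Dirichlet eigenvalues as orders of zeros of `φ₁₂`. -/

section Dirichlet

variable {p q : ℝ → ℂ}

/-- The solution `s 0` with `s 0 = (0, 1)` at `x₀` and its Taylor coefficients in `E`; these span
the generalized eigenfunctions of the Dirichlet operator. -/
noncomputable def dirTaylor (p q : ℝ → ℂ) (E : ℂ) (x₀ : ℝ) : ℕ → ℝ → Fin 2 → ℂ :=
  solTaylor p q E x₀ (Pi.single 1 1)

theorem continuous_dirTaylor (hp : Continuous p) (hq : Continuous q) (E : ℂ) (x₀ : ℝ) (j : ℕ) :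
    Continuous (dirTaylor p q E x₀ j) :=
  (continuous_solTaylor_and_spec hp hq E x₀ _ j).1

theorem hasDerivAt_dirTaylor_zero (hp : Continuous p) (hq : Continuous q) (E : ℂ) (x₀ x : ℝ) :
    HasDerivAt (dirTaylor p q E x₀ 0) (U p q E x *ᵥ dirTaylor p q E x₀ 0 x) x :=
  (sol_spec hp hq E x₀ _).1 x

theorem hasDerivAt_dirTaylor_succ (hp : Continuous p) (hq : Continuous q) (E : ℂ) (x₀ : ℝ) (j : ℕ)
    (x : ℝ) : HasDerivAt (dirTaylor p q E x₀ (j + 1))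
      (U p q E x *ᵥ dirTaylor p q E x₀ (j + 1) x - J *ᵥ dirTaylor p q E x₀ j x) x := by
  rw [sub_eq_add_neg]
  exact (continuous_solTaylor_and_spec hp hq E x₀ _ j).2.1 x

theorem dirTaylor_zero_self (hp : Continuous p) (hq : Continuous q) (E : ℂ) (x₀ : ℝ) :
    dirTaylor p q E x₀ 0 x₀ = Pi.single 1 1 :=
  (sol_spec hp hq E x₀ _).2

theorem dirTaylor_succ_self (hp : Continuous p) (hq : Continuous q) (E : ℂ) (x₀ : ℝ) (j : ℕ) :
    dirTaylor p q E x₀ (j + 1) x₀ = 0 :=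
  (continuous_solTaylor_and_spec hp hq E x₀ _ j).2.2

theorem dirTaylor_self_fst (hp : Continuous p) (hq : Continuous q) (E : ℂ) (x₀ : ℝ) (j : ℕ) :
    dirTaylor p q E x₀ j x₀ 0 = 0 := by
  cases j with
  | zero => simp [dirTaylor_zero_self hp hq]
  | succ j => simp [dirTaylor_succ_self hp hq]

theorem continuous_sum_dirTaylor (hp : Continuous p) (hq : Continuous q) (E : ℂ) (x₀ : ℝ)
    (m : ℕ) (c : ℕ → ℂ) :
    Continuous fun x => ∑ j ∈ Finset.range m, c j • dirTaylor p q E x₀ j x := by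
  have := continuous_dirTaylor hp hq E x₀
  fun_prop

/-- Linear combinations of shifted Taylor coefficients. -/
theorem hasDerivAt_sum_dirTaylor_succ (hp : Continuous p) (hq : Continuous q) (E : ℂ) (x₀ : ℝ)
    (m : ℕ) (c : ℕ → ℂ) (x : ℝ) :
    HasDerivAt (fun x => ∑ j ∈ Finset.range m, c j • dirTaylor p q E x₀ (j + 1) x)
      (U p q E x *ᵥ (∑ j ∈ Finset.range m, c j • dirTaylor p q E x₀ (j + 1) x) -
        J *ᵥ ∑ j ∈ Finset.range m, c j • dirTaylor p q E x₀ j x) x := by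
  have := HasDerivAt.fun_sum (u := Finset.range m) fun j _ =>
    (hasDerivAt_dirTaylor_succ hp hq E x₀ j x).const_smul (c j)
  refine this.congr_deriv ?_
  simp only [Matrix.mulVec_sum, Matrix.mulVec_smul, smul_sub, Finset.sum_sub_distrib]

/-- At `x₀` only the zeroth function is nonzero, so `c 0 = 0`. Applying `L - E` to the rest lowers
every index by one, and induction applies. -/
theorem eq_zero_of_sum_dirTaylor_eq_zero (hp : Continuous p) (hq : Continuous q) {Ω : ℝ}
    (hΩ : 0 < Ω) (E : ℂ) (x₀ : ℝ) (m : ℕ) : ∀ c : ℕ → ℂ,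
      (∀ x ∈ Set.Icc x₀ (x₀ + Ω), ∑ j ∈ Finset.range m, c j • dirTaylor p q E x₀ j x = 0) →
      ∀ j < m, c j = 0 := by
  induction m with
  | zero => intro c _ j hj; omega
  | succ m ih =>
    intro c hc
    have h0 : c 0 = 0 := by
      have := hc x₀ ⟨le_rfl, by linarith⟩
      rw [Finset.sum_range_succ', Finset.sum_eq_zero
        (fun j _ => by rw [dirTaylor_succ_self hp hq, smul_zero]), zero_add,
        dirTaylor_zero_self hp hq] at this
      simpa using congrFun this 1
    have hu : ∀ x ∈ Set.Icc x₀ (x₀ + Ω),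
        ∑ j ∈ Finset.range m, c (j + 1) • dirTaylor p q E x₀ (j + 1) x = 0 := by
      intro x hx
      have := hc x hx
      rwa [Finset.sum_range_succ', h0, zero_smul, add_zero] at this
    have hIoo : Set.EqOn (fun x => ∑ j ∈ Finset.range m, c (j + 1) • dirTaylor p q E x₀ j x) 0
        (Set.Ioo x₀ (x₀ + Ω)) := by
      intro x hx
      have h1 := hasDerivAt_sum_dirTaylor_succ hp hq E x₀ m (fun j => c (j + 1)) x
      have h2 : HasDerivAt (fun x => ∑ j ∈ Finset.range m, c (j + 1) •
          dirTaylor p q E x₀ (j + 1) x) 0 x :=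
        (hasDerivAt_const x (0 : Fin 2 → ℂ)).congr_of_eventuallyEq
          (Filter.eventually_of_mem (Ioo_mem_nhds hx.1 hx.2) fun y hy =>
            hu y (Set.Ioo_subset_Icc_self hy))
      have h3 := h1.unique h2
      rw [hu x (Set.Ioo_subset_Icc_self hx), Matrix.mulVec_zero, zero_sub, neg_eq_zero] at h3
      have h4 := congrArg (fun u => J *ᵥ u) h3
      simp only [Matrix.mulVec_mulVec, J_mul_J, Matrix.neg_mulVec, Matrix.one_mulVec,
        Matrix.mulVec_zero, neg_eq_zero] at h4
      exact h4
    have hIcc := hIoo.closure (continuous_sum_dirTaylor hp hq E x₀ m fun j => c (j + 1))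
      continuous_const
    rw [closure_Ioo (by linarith)] at hIcc
    intro j hj
    cases j with
    | zero => exact h0
    | succ j => exact ih (fun j => c (j + 1)) (fun x hx => hIcc hx) j (by omega)

/-- The class in `L²([x₀, x₀ + Ω])²` of a continuous function. -/
noncomputable def toL2 (Ω x₀ : ℝ) {y : ℝ → Fin 2 → ℂ} (hy : Continuous y) : L2 Ω x₀ :=
  (show MemLp y 2 (volume.restrict (Set.Icc x₀ (x₀ + Ω))) from by
    obtain ⟨C, hC⟩ := (isCompact_Icc (a := x₀) (b := x₀ + Ω)).exists_bound_of_continuousOn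
      hy.continuousOn
    exact MemLp.of_bound hy.aestronglyMeasurable C
      ((ae_restrict_iff' measurableSet_Icc).2 (Filter.Eventually.of_forall hC))).toLp y

theorem coeFn_toL2 (Ω x₀ : ℝ) {y : ℝ → Fin 2 → ℂ} (hy : Continuous y) :
    toL2 Ω x₀ hy =ᵐ[volume.restrict (Set.Icc x₀ (x₀ + Ω))] y :=
  MemLp.coeFn_toLp _

/-- The class of the `j`-th generalized eigenfunction. -/
noncomputable def dirClass (Ω : ℝ) (hp : Continuous p) (hq : Continuous q) (E : ℂ) (x₀ : ℝ)
    (j : ℕ) : L2 Ω x₀ :=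
  toL2 Ω x₀ (continuous_dirTaylor hp hq E x₀ j)

theorem coeFn_sum_dirClass (Ω : ℝ) (hp : Continuous p) (hq : Continuous q) (E : ℂ) (x₀ : ℝ)
    (m : ℕ) (c : ℕ → ℂ) :
    (∑ j ∈ Finset.range m, c j • dirClass Ω hp hq E x₀ j : L2 Ω x₀)
      =ᵐ[volume.restrict (Set.Icc x₀ (x₀ + Ω))]
      fun x => ∑ j ∈ Finset.range m, c j • dirTaylor p q E x₀ j x := by
  induction m with
  | zero =>
    simp only [Finset.range_zero, Finset.sum_empty]
    exact Lp.coeFn_zero _ _ _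
  | succ m ih =>
    simp only [Finset.sum_range_succ]
    filter_upwards [ih, Lp.coeFn_add (∑ j ∈ Finset.range m, c j • dirClass Ω hp hq E x₀ j)
      (c m • dirClass Ω hp hq E x₀ m), Lp.coeFn_smul (c m) (dirClass Ω hp hq E x₀ m),
      coeFn_toL2 Ω x₀ (continuous_dirTaylor hp hq E x₀ m)] with x h1 h2 h3 h4
    rw [h2, Pi.add_apply, h1, h3, Pi.smul_apply]
    congr 2

theorem eq_zero_of_sum_dirClass_eq_zero {Ω : ℝ} (hΩ : 0 < Ω) (hp : Continuous p)
    (hq : Continuous q) (E : ℂ) (x₀ : ℝ) (m : ℕ) (c : ℕ → ℂ)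
    (h : ∑ j ∈ Finset.range m, c j • dirClass Ω hp hq E x₀ j = 0) : ∀ j < m, c j = 0 := by
  have h2 := coeFn_sum_dirClass Ω hp hq E x₀ m c
  rw [h] at h2
  have h3 := MeasureTheory.Measure.eqOn_Icc_of_ae_eq (μ := volume) (a := x₀) (b := x₀ + Ω)
    (f := fun x => ∑ j ∈ Finset.range m, c j • dirTaylor p q E x₀ j x) (g := 0)
    (by linarith) (h2.symm.trans (Lp.coeFn_zero _ _ _))
    (continuous_sum_dirTaylor hp hq E x₀ m c).continuousOn continuousOn_const
  exact eq_zero_of_sum_dirTaylor_eq_zero hp hq hΩ E x₀ m c fun x hx => h3 hx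

theorem linearIndependent_dirClass {Ω : ℝ} (hΩ : 0 < Ω) (hp : Continuous p) (hq : Continuous q)
    (E : ℂ) (x₀ : ℝ) (m : ℕ) :
    LinearIndependent ℂ fun j : Fin m => dirClass Ω hp hq E x₀ j := by
  rw [Fintype.linearIndependent_iff]
  intro g hg i
  have h1 : ∑ j ∈ Finset.range m, (fun j => if h : j < m then g ⟨j, h⟩ else 0) j •
      dirClass Ω hp hq E x₀ j = 0 := by
    rw [← Fin.sum_univ_eq_sum_range, ← hg]
    refine Finset.sum_congr rfl fun j _ => ?_
    beta_reduce
    rw [dif_pos j.2]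
  have := eq_zero_of_sum_dirClass_eq_zero hΩ hp hq E x₀ m _ h1 i i.2
  beta_reduce at this
  rwa [dif_pos i.2] at this

/-- The Taylor coefficients form a Jordan chain, `(L - E) s_(j+1) = s_j`. The boundary condition
holds at `x₀` by construction and at `x₀ + Ω` by assumption. -/
theorem dirClass_mem_rootKernel (hp : Continuous p) (hq : Continuous q) {Ω : ℝ} {E : ℂ} {x₀ : ℝ}
    (j : ℕ) (ha : ∀ i ≤ j, dirTaylor p q E x₀ i (x₀ + Ω) 0 = 0) :
    dirClass Ω hp hq E x₀ j ∈ rootKernel p q Ω x₀ E (j + 1) := by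
  have hac : ∀ j, AbsolutelyContinuousOnInterval (dirTaylor p q E x₀ j) x₀ (x₀ + Ω) := by
    intro j
    cases j with
    | zero =>
      exact locAC_of_contDiff (contDiff_one_of_hasDerivAt
        (hasDerivAt_dirTaylor_zero hp hq E x₀)
        ((continuous_mulVecL_U hp hq E).clm_apply (continuous_dirTaylor hp hq E x₀ 0))) _ _
    | succ j =>
      exact locAC_of_contDiff (contDiff_one_of_hasDerivAt
        (hasDerivAt_dirTaylor_succ hp hq E x₀ j)
        (((continuous_mulVecL_U hp hq E).clm_apply (continuous_dirTaylor hp hq E x₀ _)).sub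
          ((mulVecL J).continuous.comp (continuous_dirTaylor hp hq E x₀ j)))) _ _
  induction j with
  | zero =>
    refine ⟨E • dirClass Ω hp hq E x₀ 0, ⟨dirTaylor p q E x₀ 0, hac 0,
      dirTaylor_self_fst hp hq E x₀ 0, ha 0 le_rfl, coeFn_toL2 _ _ _, ?_⟩, by simp [rootKernel]⟩
    filter_upwards [Lp.coeFn_smul E (dirClass Ω hp hq E x₀ 0),
      coeFn_toL2 Ω x₀ (continuous_dirTaylor hp hq E x₀ 0)] with x h1 h2
    rw [h1, Pi.smul_apply, L_apply]
    have h3 := (Q_mulVec_add_J_mulVec_eq_iff p q E x (dirTaylor p q E x₀ 0 x)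
      (deriv (dirTaylor p q E x₀ 0) x) 0).2
      (by simpa using (hasDerivAt_dirTaylor_zero hp hq E x₀ x).deriv)
    rw [h3, add_zero]
    exact congrArg _ h2
  | succ j ih =>
    refine ⟨E • dirClass Ω hp hq E x₀ (j + 1) + dirClass Ω hp hq E x₀ j,
      ⟨dirTaylor p q E x₀ (j + 1), hac _, dirTaylor_self_fst hp hq E x₀ _, ha _ le_rfl,
        coeFn_toL2 _ _ _, ?_⟩, ?_⟩
    · filter_upwards [Lp.coeFn_add (E • dirClass Ω hp hq E x₀ (j + 1)) (dirClass Ω hp hq E x₀ j),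
        Lp.coeFn_smul E (dirClass Ω hp hq E x₀ (j + 1)),
        coeFn_toL2 Ω x₀ (continuous_dirTaylor hp hq E x₀ j),
        coeFn_toL2 Ω x₀ (continuous_dirTaylor hp hq E x₀ (j + 1))] with x h1 h2 h3 h4
      rw [h1, Pi.add_apply, h2, Pi.smul_apply, L_apply]
      rw [(Q_mulVec_add_J_mulVec_eq_iff p q E x (dirTaylor p q E x₀ (j + 1) x)
        (deriv (dirTaylor p q E x₀ (j + 1)) x) (dirTaylor p q E x₀ j x)).2
        (hasDerivAt_dirTaylor_succ hp hq E x₀ j x).deriv]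
      exact congrArg₂ _ (congrArg _ h4) h3
    · rw [add_sub_cancel_left]
      exact ih fun i hi => ha i (by omega)

/-- Every generalized eigenfunction is a combination of the first `m` Taylor coefficients, where
`m` is the order of the zero of the characteristic function. -/
theorem exists_sum_of_mem_rootKernel (hp : Continuous p) (hq : Continuous q) {Ω : ℝ} (hΩ : 0 < Ω)
    {E : ℂ} {x₀ : ℝ} {m : ℕ} (ha : ∀ i < m, dirTaylor p q E x₀ i (x₀ + Ω) 0 = 0)
    (hm : dirTaylor p q E x₀ m (x₀ + Ω) 0 ≠ 0) (k : ℕ) : ∀ f ∈ rootKernel p q Ω x₀ E k,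
      ∃ c : ℕ → ℂ, f = ∑ j ∈ Finset.range m, c j • dirClass Ω hp hq E x₀ j := by
  induction k with
  | zero =>
    intro f hf
    refine ⟨0, ?_⟩
    simpa [rootKernel] using hf
  | succ k ih =>
    rintro f ⟨h, ⟨y, hyac, hy0, hy1, hfy, hhy⟩, hker⟩
    obtain ⟨c, hc⟩ := ih _ hker
    set s := dirTaylor p q E x₀ with hs
    have hsc := continuous_dirTaylor hp hq E x₀
    set g : ℝ → Fin 2 → ℂ := fun x => ∑ j ∈ Finset.range m, c j • s j x with hg
    have hgc : Continuous g := continuous_sum_dirTaylor hp hq E x₀ m c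
    have hle : x₀ ≤ x₀ + Ω := by linarith
    have hyc : ContinuousOn y (Set.Icc x₀ (x₀ + Ω)) := by
      have := hyac.continuousOn
      rwa [Set.uIcc_of_le hle] at this
    -- `y` is controlled on the period interval only; the continuous extension makes the right-hand
    -- side `G` continuous on the whole line.
    set y' : ℝ → Fin 2 → ℂ := Set.IccExtend hle (Set.domRestrict (Set.Icc x₀ (x₀ + Ω)) y) with hy'
    have hy'c : Continuous y' := (continuousOn_iff_continuous_domRestrict.1 hyc).Icc_extend'
    have hy'eq : ∀ x ∈ Set.Icc x₀ (x₀ + Ω), y' x = y x := fun x hx => by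
      simp [hy', Set.IccExtend_of_mem hle _ hx]
    set G : ℝ → Fin 2 → ℂ := fun x => U p q E x *ᵥ y' x - J *ᵥ g x with hG
    have hGc : Continuous G := ((continuous_mulVecL_U hp hq E).clm_apply hy'c).sub
      ((mulVecL J).continuous.comp hgc)
    have hae : ∀ᵐ x, x ∈ Set.uIcc x₀ (x₀ + Ω) → deriv y x = G x := by
      rw [Set.uIcc_of_le hle, ← ae_restrict_iff' measurableSet_Icc]
      have h5 := coeFn_sum_dirClass Ω hp hq E x₀ m c
      rw [← hc] at h5
      filter_upwards [h5, hhy, hfy, Lp.coeFn_sub h (E • f), Lp.coeFn_smul E f,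
        ae_restrict_mem measurableSet_Icc] with x h1 h2 h3 h4 h6 h7
      rw [h4, Pi.sub_apply, h6, Pi.smul_apply, h2, h3, sub_eq_iff_eq_add', L_apply] at h1
      rw [(Q_mulVec_add_J_mulVec_eq_iff p q E x _ _ _).1 h1, hG]
      simp only [hy'eq x h7, hg, hs]
    have hint := eq_integral_of_absolutelyContinuous hyac hGc hae
    rw [Set.uIcc_of_le hle] at hint
    set Y : ℝ → Fin 2 → ℂ := fun x => y x₀ + ∫ t in x₀..x, G t with hY
    have hYd : ∀ x, HasDerivAt Y (G x) x := fun x =>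
      ((hGc.integral_hasStrictDerivAt x₀ x).hasDerivAt).const_add _
    set w : ℝ → Fin 2 → ℂ := fun x => ∑ j ∈ Finset.range m, c j • s (j + 1) x with hw
    set γ : ℂ := y x₀ 1 with hγ
    -- `w` is a particular solution of `(L - E) y = g`, obtained by raising the indices in `g` by
    -- one. As `y` has zero first component at `x₀`, a multiple of `s 0` accounts for the rest.
    have hz : ∀ x ∈ Set.Icc x₀ (x₀ + Ω), Y x - w x - γ • s 0 x = 0 := by
      have hzd : ∀ x, HasDerivAt (fun x => Y x - w x - γ • s 0 x)
          (G x - (U p q E x *ᵥ w x - J *ᵥ g x) - γ • (U p q E x *ᵥ s 0 x)) x := fun x =>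
        ((hYd x).sub (hasDerivAt_sum_dirTaylor_succ hp hq E x₀ m c x)).sub
          ((hasDerivAt_dirTaylor_zero hp hq E x₀ x).const_smul γ)
      refine eq_zero_of_linear_ode_right (continuous_mulVecL_U hp hq E)
        (fun x _ => (hzd x).continuousAt.continuousWithinAt) (fun x hx => ?_) ?_
      · refine (hzd x).hasDerivWithinAt.congr_deriv ?_
        have hx' := Set.Ico_subset_Icc_self hx
        have : Y x = y' x := by rw [hy'eq x hx', hint x hx']
        rw [mulVecL_apply, Matrix.mulVec_sub, Matrix.mulVec_sub, Matrix.mulVec_smul, this]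
        simp only [hG]
        abel
      · have h1 : w x₀ = 0 := Finset.sum_eq_zero fun j _ => by
          rw [hs, dirTaylor_succ_self hp hq, smul_zero]
        have h2 : s 0 x₀ = Pi.single 1 1 := dirTaylor_zero_self hp hq E x₀
        rw [h1, h2]
        ext i
        fin_cases i <;> simp [hY, hy0, hγ]
    have hyeq : ∀ x ∈ Set.Icc x₀ (x₀ + Ω), y x = w x + γ • s 0 x := fun x hx => by
      have h1 := hz x hx
      rw [sub_sub, sub_eq_zero] at h1
      rw [hint x hx, ← h1]
    have hend : ∑ j ∈ Finset.range m, c j * s (j + 1) (x₀ + Ω) 0 + γ * s 0 (x₀ + Ω) 0 = 0 := by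
      have h1 := congrFun (hyeq (x₀ + Ω) ⟨hle, le_rfl⟩) 0
      rw [hy1] at h1
      simpa [hw, Finset.sum_apply] using h1.symm
    have hf : f =ᵐ[volume.restrict (Set.Icc x₀ (x₀ + Ω))] fun x => w x + γ • s 0 x := by
      filter_upwards [hfy, ae_restrict_mem measurableSet_Icc] with x h1 h2
      rw [h1, hyeq x h2]
    cases m with
    | zero =>
      have hγ0 : γ = 0 := by simpa [hm] using hend
      refine ⟨0, ?_⟩
      simp only [Finset.range_zero, Finset.sum_empty]
      refine Lp.ext (hf.trans ?_)
      filter_upwards [Lp.coeFn_zero (Fin 2 → ℂ) 2 (volume.restrict (Set.Icc x₀ (x₀ + Ω)))]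
        with x hx
      rw [hx]
      simp [hw, hγ0]
    | succ m =>
      -- At the right end point all Taylor coefficients but that of index `m + 1` have zero first
      -- component, so the boundary condition kills the term that would lengthen the chain.
      have hcm : c m = 0 := by
        rw [Finset.sum_range_succ, Finset.sum_eq_zero
          (fun j hj => by rw [ha (j + 1) (by have := Finset.mem_range.1 hj; omega), mul_zero]),
          ha 0 (by omega), mul_zero, add_zero, zero_add] at hend
        exact (mul_eq_zero.1 hend).resolve_right hm
      refine ⟨fun j => Nat.casesOn j γ c, Lp.ext (hf.trans ?_)⟩
      refine Filter.EventuallyEq.trans (Filter.Eventually.of_forall fun x => ?_)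
        (coeFn_sum_dirClass Ω hp hq E x₀ (m + 1) _).symm
      simp only [hw]
      rw [Finset.sum_range_succ, hcm, zero_smul, add_zero, Finset.sum_range_succ']
      rfl

theorem toENat_rank_span_dirClass {Ω : ℝ} (hΩ : 0 < Ω) (hp : Continuous p) (hq : Continuous q)
    (E : ℂ) (x₀ : ℝ) (m : ℕ) :
    Cardinal.toENat (Module.rank ℂ (Submodule.span ℂ
      (Set.range fun j : Fin m => dirClass Ω hp hq E x₀ j))) = m := by
  have h := finrank_span_eq_card (linearIndependent_dirClass hΩ hp hq E x₀ m)
  have : Module.Finite ℂ (Submodule.span ℂ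
      (Set.range fun j : Fin m => dirClass Ω hp hq E x₀ j)) :=
    Module.Finite.span_of_finite ℂ (Set.finite_range _)
  rw [← Module.finrank_eq_rank, h]
  simp

theorem le_delta (hp : Continuous p) (hq : Continuous q) {Ω : ℝ} (hΩ : 0 < Ω)
    {E : ℂ} {x₀ : ℝ} {m : ℕ} (ha : ∀ i < m, dirTaylor p q E x₀ i (x₀ + Ω) 0 = 0) :
    (m : ℕ∞) ≤ delta p q Ω E x₀ := by
  rw [← toENat_rank_span_dirClass hΩ hp hq E x₀ m, delta]
  refine (OrderHomClass.mono Cardinal.toENat) (Submodule.rank_mono (Submodule.span_mono ?_))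
  rintro _ ⟨j, rfl⟩
  exact Set.mem_iUnion.2 ⟨j + 1, dirClass_mem_rootKernel hp hq j fun i hi => ha i (by omega)⟩

theorem delta_eq (hp : Continuous p) (hq : Continuous q) {Ω : ℝ} (hΩ : 0 < Ω)
    {E : ℂ} {x₀ : ℝ} {m : ℕ} (ha : ∀ i < m, dirTaylor p q E x₀ i (x₀ + Ω) 0 = 0)
    (hm : dirTaylor p q E x₀ m (x₀ + Ω) 0 ≠ 0) : delta p q Ω E x₀ = m := by
  refine le_antisymm ?_ (le_delta hp hq hΩ ha)
  rw [← toENat_rank_span_dirClass hΩ hp hq E x₀ m, delta]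
  refine (OrderHomClass.mono Cardinal.toENat) (Submodule.rank_mono (Submodule.span_le.2 ?_))
  intro f hf
  obtain ⟨k, hk⟩ := Set.mem_iUnion.1 hf
  obtain ⟨c, rfl⟩ := exists_sum_of_mem_rootKernel hp hq hΩ ha hm k f hk
  exact Submodule.sum_mem _ fun j hj => Submodule.smul_mem _ _
    (Submodule.subset_span ⟨⟨j, Finset.mem_range.1 hj⟩, rfl⟩)

/-- The Taylor coefficients of an analytic function are determined by its asymptotic expansion. -/
theorem asymptotic_coeff_of_order {f : ℂ → ℂ} {E : ℂ} (hf : AnalyticAt ℂ f E) {a : ℕ → ℂ}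
    (hexp : ∀ N, ∃ C, ∀ h : ℂ, ‖h‖ ≤ 1 →
      ‖f (E + h) - ∑ j ∈ Finset.range (N + 1), h ^ j * a j‖ ≤ C * ‖h‖ ^ (N + 1)) {m : ℕ} :
    ((m : ℕ∞) ≤ analyticOrderAt f E → ∀ j < m, a j = 0) ∧
    (analyticOrderAt f E = m → a m ≠ 0) := by
  open Topology in
  -- if `f = (z - E) ^ m g` with `g` analytic, then `a j = 0` for `j < m` and `a m = g E`
  have key : ∀ g : ℂ → ℂ, AnalyticAt ℂ g E → (∀ᶠ z in 𝓝 E, f z = (z - E) ^ m • g z) →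
      ∀ j ≤ m, a j = if j = m then g E else 0 := by
    intro g hg hfg j
    induction j using Nat.strong_induction_on with
    | _ j ih =>
      intro hj
      obtain ⟨C, hC⟩ := hexp j
      have hev : ∀ᶠ h in 𝓝[≠] (0 : ℂ), ‖h ^ (m - j) * g (E + h) - a j‖ ≤ C * ‖h‖ := by
        have h1 : ∀ᶠ h in 𝓝 (0 : ℂ), f (E + h) = h ^ m * g (E + h) := by
          have : Tendsto (fun h : ℂ => E + h) (𝓝 0) (𝓝 E) := by
            simpa using (continuous_const_add E).tendsto 0
          filter_upwards [this.eventually hfg] with h hh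
          simpa using hh
        filter_upwards [h1.filter_mono nhdsWithin_le_nhds, self_mem_nhdsWithin,
          nhdsWithin_le_nhds (Metric.closedBall_mem_nhds (0 : ℂ) one_pos)] with h h2 h3 h4
        have h5 := hC h (by simpa using h4)
        rw [Finset.sum_range_succ, Finset.sum_eq_zero (fun i hi => by
          have hi' := Finset.mem_range.1 hi
          rw [ih i hi' (by omega), if_neg (by omega), mul_zero]), zero_add, h2] at h5
        have hh : 0 < ‖h‖ ^ j := pow_pos (norm_pos_iff.2 h3) _
        have h6 : h ^ m * g (E + h) - h ^ j * a j = h ^ j * (h ^ (m - j) * g (E + h) - a j) := by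
          rw [mul_sub, ← mul_assoc, ← pow_add, Nat.add_sub_cancel' hj]
        rw [h6, norm_mul, norm_pow, pow_succ, mul_comm (C : ℝ), mul_assoc] at h5
        rw [mul_comm C]
        exact le_of_mul_le_mul_left h5 hh
      have hlim : Tendsto (fun h : ℂ => h ^ (m - j) * g (E + h)) (𝓝[≠] 0)
          (𝓝 ((0 : ℂ) ^ (m - j) * g (E + 0))) := by
        have hgc : ContinuousAt (fun h : ℂ => g (E + h)) 0 :=
          ContinuousAt.comp' (by simpa using hg.continuousAt) (by fun_prop)
        exact ((continuousAt_id.pow _).mul hgc).tendsto.mono_left nhdsWithin_le_nhds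
      have hzero : Tendsto (fun h : ℂ => C * ‖h‖) (𝓝[≠] 0) (𝓝 0) := by
        have : Tendsto (fun h : ℂ => C * ‖h‖) (𝓝 0) (𝓝 (C * ‖(0 : ℂ)‖)) :=
          (by fun_prop : Continuous fun h : ℂ => C * ‖h‖).tendsto 0
        rw [norm_zero, mul_zero] at this
        exact this.mono_left nhdsWithin_le_nhds
      have h7 := squeeze_zero_norm' hev hzero
      have h8 := tendsto_nhds_unique (hlim.sub_const (a j)) h7
      rw [sub_eq_zero, add_zero] at h8
      rw [← h8]
      split_ifs with hjm
      · simp [hjm]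
      · rw [zero_pow (by omega), zero_mul]
  refine ⟨fun h => ?_, fun h => ?_⟩
  · obtain ⟨g, hg, hfg⟩ := (natCast_le_analyticOrderAt hf).1 h
    intro j hj
    rw [key g hg hfg j hj.le, if_neg hj.ne]
  · obtain ⟨g, hg, hgE, hfg⟩ := hf.analyticOrderAt_eq_natCast.1 h
    rw [key g hg hfg m le_rfl, if_pos rfl]
    exact hgE

theorem differentiable_monodromy (hp : Continuous p) (hq : Continuous q) {Ω : ℝ} (hΩ : 0 < Ω)
    (x₀ : ℝ) (i j : Fin 2) : Differentiable ℂ fun E => monodromy p q Ω E x₀ i j :=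
  differentiable_sol hp hq hΩ x₀ _ i

theorem monodromy_expansion (hp : Continuous p) (hq : Continuous q) {Ω : ℝ} (hΩ : 0 < Ω)
    (E : ℂ) (x₀ : ℝ) (N : ℕ) : ∃ C, ∀ h : ℂ, ‖h‖ ≤ 1 →
      ‖monodromy p q Ω (E + h) x₀ 0 1 - ∑ j ∈ Finset.range (N + 1),
        h ^ j * dirTaylor p q E x₀ j (x₀ + Ω) 0‖ ≤ C * ‖h‖ ^ (N + 1) := by
  obtain ⟨C, hC⟩ := exists_norm_sol_sub_taylor_le hp hq hΩ E x₀ (Pi.single 1 1) N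
  refine ⟨C, fun h hh => ?_⟩
  have := (norm_le_pi_norm _ 0).trans (hC h hh)
  simpa [Finset.sum_apply, monodromy, phi, dirTaylor] using this

/-- Algebraic multiplicities of Dirichlet eigenvalues are at least the orders of the zeros of
`φ₁₂(·, x₀ + Ω, x₀)`. -/
theorem le_delta_of_le_order (hp : Continuous p) (hq : Continuous q) {Ω : ℝ} (hΩ : 0 < Ω)
    {E : ℂ} {x₀ : ℝ} {m : ℕ}
    (hm : (m : ℕ∞) ≤ analyticOrderAt (fun E => monodromy p q Ω E x₀ 0 1) E) :
    (m : ℕ∞) ≤ delta p q Ω E x₀ :=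
  le_delta hp hq hΩ ((asymptotic_coeff_of_order
    ((differentiable_monodromy hp hq hΩ x₀ 0 1).analyticAt E)
    (monodromy_expansion hp hq hΩ E x₀)).1 hm)

/-- Algebraic multiplicities of Dirichlet eigenvalues are the orders of the zeros of
`φ₁₂(·, x₀ + Ω, x₀)`. -/
theorem delta_eq_order (hp : Continuous p) (hq : Continuous q) {Ω : ℝ} (hΩ : 0 < Ω)
    {E : ℂ} {x₀ : ℝ} {m : ℕ}
    (hm : analyticOrderAt (fun E => monodromy p q Ω E x₀ 0 1) E = m) :
    delta p q Ω E x₀ = m := by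
  have h := asymptotic_coeff_of_order (m := m)
    ((differentiable_monodromy hp hq hΩ x₀ 0 1).analyticAt E)
    (monodromy_expansion hp hq hΩ E x₀)
  exact delta_eq hp hq hΩ (h.1 hm.ge) (h.2 hm)

end Dirichlet

/-! ### Extracting the coefficients of a polynomial in `E` from its values. -/

section Coefficients

/-- Lagrange interpolation at `0, …, m - 1`. The weights depend neither on the coefficients nor on
the module, so continuity and derivatives in `x` pass from the values to the coefficients. -/
theorem exists_coeff_functional (m k : ℕ) (hk : k < m) : ∃ w : ℕ → ℂ,
    ∀ {X : Type} [AddCommGroup X] [Module ℂ X] (c : ℕ → X),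
      c k = ∑ i ∈ Finset.range m, w i • ∑ l ∈ Finset.range m, (i : ℂ) ^ l • c l := by
  have hinj : Set.InjOn (fun i : ℕ => (i : ℂ)) (Finset.range m : Set ℕ) := fun i _ j _ h => by
    simpa using h
  refine ⟨fun i => (Lagrange.basis (Finset.range m) (fun i : ℕ => (i : ℂ)) i).coeff k,
    fun {X} _ _ c => ?_⟩
  have key : ∀ l < m, ∑ i ∈ Finset.range m,
      (Lagrange.basis (Finset.range m) (fun i : ℕ => (i : ℂ)) i).coeff k * (i : ℂ) ^ l =
      if k = l then 1 else 0 := fun l hl => by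
    have h1 := Lagrange.eq_interpolate (f := (Polynomial.X ^ l : Polynomial ℂ)) hinj (by
      rw [Polynomial.degree_X_pow, Finset.card_range]; exact_mod_cast hl)
    have h2 := congrArg (fun P : Polynomial ℂ => P.coeff k) h1
    simp only [Polynomial.coeff_X_pow, Lagrange.interpolate_apply, Polynomial.finsetSum_coeff,
      Polynomial.coeff_C_mul, Polynomial.eval_pow, Polynomial.eval_X] at h2
    rw [h2]
    exact Finset.sum_congr rfl fun i _ => mul_comm _ _
  simp_rw [Finset.smul_sum, smul_smul]
  rw [Finset.sum_comm]
  simp_rw [← Finset.sum_smul]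
  rw [Finset.sum_eq_single k, key k hk, if_pos rfl, one_smul]
  · intro l hl hlk
    rw [key l (Finset.mem_range.1 hl), if_neg hlk.symm, zero_smul]
  · exact fun h => absurd (Finset.mem_range.2 hk) h

theorem hasDerivAt_coeff {X : Type} [NormedAddCommGroup X] [NormedSpace ℝ X] [Module ℂ X]
    [ContinuousConstSMul ℂ X] [SMulCommClass ℝ ℂ X]
    {c d : ℕ → ℝ → X} {m : ℕ} {x : ℝ}
    (h : ∀ E : ℂ, HasDerivAt (fun x => ∑ k ∈ Finset.range m, E ^ k • c k x)
      (∑ k ∈ Finset.range m, E ^ k • d k x) x) {k : ℕ} (hk : k < m) :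
    HasDerivAt (c k) (d k x) x := by
  obtain ⟨w, hw⟩ := exists_coeff_functional m k hk
  have h1 : HasDerivAt (fun x => ∑ i ∈ Finset.range m, w i •
      ∑ l ∈ Finset.range m, (i : ℂ) ^ l • c l x) (∑ i ∈ Finset.range m, w i •
      ∑ l ∈ Finset.range m, (i : ℂ) ^ l • d l x) x :=
    HasDerivAt.fun_sum fun i _ => (h i).fun_const_smul (w i)
  rw [hw fun l => d l x]
  exact h1.congr_of_eventuallyEq (Filter.Eventually.of_forall fun x => hw fun l => c l x)

theorem continuous_coeff {X : Type} [TopologicalSpace X] [AddCommGroup X] [Module ℂ X]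
    [ContinuousConstSMul ℂ X] [ContinuousAdd X]
    {c : ℕ → ℝ → X} {m : ℕ}
    (h : ∀ E : ℂ, Continuous (fun x => ∑ k ∈ Finset.range m, E ^ k • c k x)) {k : ℕ}
    (hk : k < m) : Continuous (c k) := by
  obtain ⟨w, hw⟩ := exists_coeff_functional m k hk
  have : c k = fun x => ∑ i ∈ Finset.range m, w i • ∑ l ∈ Finset.range m, (i : ℂ) ^ l • c l x :=
    funext fun x => hw fun l => c l x
  rw [this]
  exact continuous_finsetSum _ fun i _ => (h i).const_smul (w i)

end Coefficients

/-! ### Calculus of differential expressions with matrix coefficients. -/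

section DiffSum

/-- The function `∑_{j < m} c_j y^(j)`. -/
noncomputable def diffSum (c : ℕ → ℝ → Matrix (Fin 2) (Fin 2) ℂ) (m : ℕ) (y : ℝ → Fin 2 → ℂ)
    (x : ℝ) : Fin 2 → ℂ :=
  ∑ j ∈ Finset.range m, c j x *ᵥ iteratedDeriv j y x

/-- The sequence `0, c₀, c₁, …`. -/
def shift {X : Type*} [Zero X] (c : ℕ → X) : ℕ → X
  | 0 => 0
  | j + 1 => c j

@[simp] theorem shift_zero {X : Type*} [Zero X] (c : ℕ → X) : shift c 0 = 0 := rfl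

@[simp] theorem shift_succ {X : Type*} [Zero X] (c : ℕ → X) (j : ℕ) : shift c (j + 1) = c j := rfl

theorem hasDerivAt_iteratedDeriv {X : Type*} [NormedAddCommGroup X] [NormedSpace ℝ X] {y : ℝ → X}
    {m j : ℕ} (hy : ContDiff ℝ m y) (hj : j < m) (x : ℝ) :
    HasDerivAt (iteratedDeriv j y) (iteratedDeriv (j + 1) y x) x := by
  rw [iteratedDeriv_succ]
  exact (hy.differentiable_iteratedDeriv j (by exact_mod_cast hj) x).hasDerivAt

/-- Leibniz rule: the new coefficients are `c'_j + c_(j-1)`. The convention `c' m = 0` lets both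
parts share the range up to index `m`. -/
theorem hasDerivAt_diffSum {c : ℕ → ℝ → Matrix (Fin 2) (Fin 2) ℂ}
    {c' : ℕ → Matrix (Fin 2) (Fin 2) ℂ} {m : ℕ} {y : ℝ → Fin 2 → ℂ} {x : ℝ}
    (hc : ∀ j < m, HasDerivAt (c j) (c' j) x) (hc' : c' m = 0) (hy : ContDiff ℝ m y) :
    HasDerivAt (diffSum c m y)
      (∑ j ∈ Finset.range (m + 1), (c' j + shift c j x) *ᵥ iteratedDeriv j y x) x := by
  have h1 : HasDerivAt (diffSum c m y) (∑ j ∈ Finset.range m,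
      (c' j *ᵥ iteratedDeriv j y x + c j x *ᵥ iteratedDeriv (j + 1) y x)) x :=
    HasDerivAt.fun_sum fun j hj => HasDerivAt.mulVec (hc j (Finset.mem_range.1 hj))
      (hasDerivAt_iteratedDeriv hy (Finset.mem_range.1 hj) x)
  convert! h1 using 1
  simp_rw [Matrix.add_mulVec]
  rw [Finset.sum_add_distrib, Finset.sum_add_distrib, Finset.sum_range_succ, hc',
    Matrix.zero_mulVec, add_zero, Finset.sum_range_succ' (fun j => shift c j x *ᵥ _)]
  simp

theorem deriv_zero_matrix (x : ℝ) : deriv (0 : ℝ → Matrix (Fin 2) (Fin 2) ℂ) x = 0 :=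
  deriv_const x 0

theorem contDiff_deriv {X : Type*} [NormedAddCommGroup X] [NormedSpace ℝ X] {f : ℝ → X} {r : ℕ}
    (hf : ContDiff ℝ (r + 1 : ℕ) f) : ContDiff ℝ r (deriv f) := by
  have : ContDiff ℝ ((r : WithTop ℕ∞) + 1) f := by exact_mod_cast hf
  exact (contDiff_succ_iff_deriv.1 this).2.2

theorem hasDerivAt_of_contDiff {X : Type*} [NormedAddCommGroup X] [NormedSpace ℝ X] {f : ℝ → X}
    {r : ℕ} (hf : ContDiff ℝ (r + 1 : ℕ) f) (x : ℝ) : HasDerivAt f (deriv f x) x :=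
  ((hf.differentiable (by simp)) x).hasDerivAt

variable {p q : ℝ → ℂ}

theorem contDiff_Q {k : WithTop ℕ∞} (hp : ContDiff ℝ k p) (hq : ContDiff ℝ k q) :
    ContDiff ℝ k (Q p q) := by
  refine ContDiff.matrix_of fun i j => ?_
  fin_cases i <;> fin_cases j
  · exact contDiff_const
  · exact contDiff_const.mul hq
  · exact contDiff_const.mul hp
  · exact contDiff_const

/-- The derivatives of `L y` are differential expressions in `y`. -/
theorem exists_iteratedDeriv_L_eq {n : ℕ} (hQ : ContDiff ℝ n (Q p q)) (k r : ℕ) (hk : k + r = n) :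
    ∃ c : ℕ → ℝ → Matrix (Fin 2) (Fin 2) ℂ, (∀ j, ContDiff ℝ r (c j)) ∧
      (∀ j, k + 1 < j → c j = 0) ∧ (∀ x, c (k + 1) x = J) ∧
      ∀ y, ContDiff ℝ (k + 1 : ℕ) y → iteratedDeriv k ((L p q).apply y) = diffSum c (k + 2) y := by
  induction k generalizing r with
  | zero =>
    refine ⟨fun j => match j with
      | 0 => Q p q
      | 1 => fun _ => J
      | _ + 2 => 0, ?_, ?_, fun _ => rfl, ?_⟩
    · rintro (_ | _ | j)
      · rwa [← hk, zero_add] at hQ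
      · exact contDiff_const
      · exact contDiff_const (c := (0 : Matrix (Fin 2) (Fin 2) ℂ))
    · rintro (_ | _ | j) hj
      · omega
      · omega
      · rfl
    · intro y _
      ext1 x
      rw [iteratedDeriv_zero, L_apply]
      simp [diffSum, Finset.sum_range_succ]
  | succ k ih =>
    obtain ⟨c, hc, hc0, hcJ, hcy⟩ := ih (r + 1) (by omega)
    refine ⟨fun j x => deriv (c j) x + shift c j x, ?_, ?_, ?_, ?_⟩
    · intro j
      refine (contDiff_deriv (hc j)).add ?_
      cases j with
      | zero => exact contDiff_const (c := (0 : Matrix (Fin 2) (Fin 2) ℂ))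
      | succ j => exact (hc j).of_le (by exact_mod_cast Nat.le_succ r)
    · intro j hj
      obtain ⟨j, rfl⟩ : ∃ i, j = i + 1 := ⟨j - 1, by omega⟩
      ext1 x
      simp only [shift_succ, hc0 j (by omega), hc0 (j + 1) (by omega), deriv_zero_matrix]
      exact add_zero 0
    · intro x
      simp only [shift_succ, hcJ, hc0 (k + 1 + 1) (by omega), deriv_zero_matrix, zero_add]
    · intro y hy
      have hy' : ContDiff ℝ (k + 1 : ℕ) y := hy.of_le (by exact_mod_cast Nat.le_succ _)
      rw [iteratedDeriv_succ, hcy y hy']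
      ext1 x
      refine (hasDerivAt_diffSum (c' := fun j => deriv (c j) x)
        (fun j _ => hasDerivAt_of_contDiff (hc j) x) ?_ hy).deriv
      simp only [hc0 (k + 2) (by omega), deriv_zero_matrix]

/-- The derivatives of solutions are obtained by applying matrices that are polynomials in `E`. -/
theorem exists_iteratedDeriv_solution_eq {n : ℕ} (hQ : ContDiff ℝ n (Q p q)) (k r : ℕ)
    (hk : k + r = n + 1) :
    ∃ M : ℕ → ℝ → Matrix (Fin 2) (Fin 2) ℂ, (∀ l, ContDiff ℝ r (M l)) ∧
      (∀ l, k < l → M l = 0) ∧ (∀ x, M k x = (-J) ^ k) ∧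
      ∀ (E : ℂ) (y : ℝ → Fin 2 → ℂ), (∀ x, HasDerivAt y (U p q E x *ᵥ y x) x) →
        ∀ x, iteratedDeriv k y x = (∑ l ∈ Finset.range (k + 1), E ^ l • M l x) *ᵥ y x := by
  induction k generalizing r with
  | zero =>
    refine ⟨fun l => match l with
      | 0 => fun _ => 1
      | _ + 1 => 0, ?_, ?_, fun _ => by simp, ?_⟩
    · rintro (_ | l)
      · exact contDiff_const
      · exact contDiff_const (c := (0 : Matrix (Fin 2) (Fin 2) ℂ))
    · rintro (_ | l) hl
      · omega
      · rfl
    · intro E y _ x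
      simp
  | succ k ih =>
    obtain ⟨M, hM, hM0, hMJ, hMy⟩ := ih (r + 1) (by omega)
    have hd0 : ∀ x, deriv (M (k + 1)) x = 0 := fun x => by
      rw [hM0 (k + 1) (by omega), deriv_zero_matrix]
    refine ⟨fun l x => deriv (M l) x + M l x * (J * Q p q x) - shift M l x * J, ?_, ?_, ?_, ?_⟩
    · intro l
      have hMr : ∀ l, ContDiff ℝ r (M l) := fun l => (hM l).of_le (by exact_mod_cast Nat.le_succ r)
      refine ((contDiff_deriv (hM l)).add (ContDiff.matMul (hMr l)
        (ContDiff.matMul contDiff_const (hQ.of_le (by exact_mod_cast (by omega))))) ).sub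
        (ContDiff.matMul ?_ contDiff_const)
      cases l with
      | zero => exact contDiff_const (c := (0 : Matrix (Fin 2) (Fin 2) ℂ))
      | succ l => exact hMr l
    · intro l hl
      obtain ⟨l, rfl⟩ : ∃ i, l = i + 1 := ⟨l - 1, by omega⟩
      ext1 x
      simp only [shift_succ, hM0 l (by omega), hM0 (l + 1) (by omega), deriv_zero_matrix, Pi.zero_apply,
        zero_mul, add_zero, sub_zero]
    · intro x
      simp only [shift_succ, hMJ, hd0]
      rw [hM0 (k + 1) (by omega)]
      simp [pow_succ]
    · intro E y hy x
      have h1 : iteratedDeriv k y = fun x =>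
        (∑ l ∈ Finset.range (k + 1), E ^ l • M l x) *ᵥ y x := funext fun x => hMy E y hy x
      rw [iteratedDeriv_succ, h1]
      have h2 : HasDerivAt (fun x => ∑ l ∈ Finset.range (k + 1), E ^ l • M l x)
          (∑ l ∈ Finset.range (k + 1), E ^ l • deriv (M l) x) x :=
        HasDerivAt.fun_sum fun l _ => (hasDerivAt_of_contDiff (hM l) x).fun_const_smul (E ^ l)
      rw [(HasDerivAt.mulVec h2 (hy x)).deriv, Matrix.mulVec_mulVec, ← Matrix.add_mulVec]
      congr 1
      rw [U_eq]
      simp only [smul_add, smul_sub, Finset.sum_sub_distrib, Finset.sum_add_distrib]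
      rw [Finset.sum_range_succ (fun l => E ^ l • deriv (M l) x) (k + 1), hd0, smul_zero, add_zero,
        Finset.sum_range_succ (fun l => E ^ l • (M l x * (J * Q p q x))) (k + 1),
        hM0 (k + 1) (by omega), Finset.sum_range_succ' (fun l => E ^ l • (shift M l x * J))]
      simp only [Pi.zero_apply, zero_mul, smul_zero, add_zero, shift_zero, shift_succ, mul_add,
        Finset.sum_mul, smul_mul_assoc, mul_neg, mul_smul_comm]
      rw [add_sub_assoc, sub_eq_neg_add]
      simp only [smul_smul, pow_succ, Finset.smul_sum, mul_comm]

end DiffSum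

/-! ### Locally absolutely continuous functions. -/

section LocAC

theorem LocAC.continuous {y : ℝ → Fin 2 → ℂ} (hy : LocAC y) : Continuous y := by
  refine continuous_iff_continuousAt.2 fun x => ?_
  exact (hy (x - 1) (x + 1)).continuousOn.continuousAt
    (Filter.mem_of_superset (Icc_mem_nhds (by linarith) (by linarith)) Set.Icc_subset_uIcc)

theorem LocAC.sub {y z : ℝ → Fin 2 → ℂ} (hy : LocAC y) (hz : LocAC z) :
    LocAC fun x => y x - z x := fun a b => (hy a b).fun_sub (hz a b)

theorem LocAC.const_mulVec (M : Matrix (Fin 2) (Fin 2) ℂ) {y : ℝ → Fin 2 → ℂ} (hy : LocAC y) :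
    LocAC fun x => M *ᵥ y x := by
  intro a b
  have h := Filter.Tendsto.const_mul ‖mulVecL M‖ (hy a b)
  rw [mul_zero] at h
  refine squeeze_zero (fun t => Finset.sum_nonneg fun i _ => dist_nonneg) (fun t => ?_) h
  rw [Finset.mul_sum]
  exact Finset.sum_le_sum fun i _ => (mulVecL M).lipschitz.dist_le_mul _ _

theorem LocAC.ae_differentiableAt {y : ℝ → Fin 2 → ℂ} (hy : LocAC y) :
    ∀ᵐ x, DifferentiableAt ℝ y x := by
  have h : ∀ N : ℕ, ∀ᵐ x, x ∈ Set.uIcc (-(N : ℝ)) N → DifferentiableAt ℝ y x := fun N =>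
    (hy _ _).boundedVariationOn.ae_differentiableAt_of_mem_uIcc
  filter_upwards [ae_all_iff.2 h] with x hx
  obtain ⟨N, hN⟩ := exists_nat_ge |x|
  refine hx N ?_
  rw [Set.uIcc_of_le (by linarith [abs_nonneg x])]
  exact abs_le.1 hN

/-- Each iterated derivative up to order `n` is continuous, and it is the almost everywhere
derivative of an absolutely continuous predecessor, hence its derivative everywhere. -/
theorem contDiff_of_inDomain {n : ℕ} {f : ℝ → Fin 2 → ℂ} (h : InDomain (n + 1) f) :
    ContDiff ℝ n f := by
  have hc : ∀ m ≤ n, Continuous (iteratedDeriv m f) := fun m hm => (h m (by omega)).continuous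
  refine contDiff_nat_iff_iteratedDeriv.2 ⟨hc, fun m hm x => ?_⟩
  refine (hasDerivAt_of_absolutelyContinuous (h m (by omega)) (hc (m + 1) hm)
    (Filter.Eventually.of_forall fun x => ?_) x).differentiableAt
  rw [iteratedDeriv_succ]

end LocAC

/-! ### From a commuting expression to the zero-curvature matrix `V`. -/

section Forward

variable {p q : ℝ → ℂ}

/-- On a constant vector, `L` acts as multiplication by `Q`, and the result must lie in the domain
of an expression of order `n + 1`. Mere local integrability is thereby upgraded to `n` continuous
derivatives. -/
theorem contDiff_of_commutes {n : ℕ} {A : DiffExpr (n + 1)} (hA : A.Commutes (L p q)) :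
    ContDiff ℝ n p ∧ ContDiff ℝ n q := by
  have h : ∀ v : Fin 2 → ℂ, ContDiff ℝ n fun x => Q p q x *ᵥ v := fun v => by
    have h1 := contDiff_of_inDomain (hA (fun _ => v) contDiff_const).1
    have : (L p q).apply (fun _ => v) = fun x => Q p q x *ᵥ v := by
      ext1 x; simp [L_apply]
    rwa [this] at h1
  have hI : Complex.I * Complex.I = -1 := Complex.I_mul_I
  constructor
  · have h1 := contDiff_pi.1 (h (Pi.single 0 1)) 1
    have : p = fun x => -Complex.I * (Q p q x *ᵥ Pi.single 0 1) 1 := by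
      ext1 x
      simp only [mulVec_single_one, Q]
      simp only [Matrix.of_apply, Matrix.cons_val', Matrix.cons_val_zero, Matrix.cons_val_one,
        Matrix.cons_val_fin_one]
      linear_combination p x * hI
    rw [this]
    exact contDiff_const.mul h1
  · have h1 := contDiff_pi.1 (h (Pi.single 1 1)) 0
    have : q = fun x => Complex.I * (Q p q x *ᵥ Pi.single 1 1) 0 := by
      ext1 x
      simp only [mulVec_single_one, Q]
      simp only [Matrix.of_apply, Matrix.cons_val', Matrix.cons_val_zero, Matrix.cons_val_one,
        Matrix.cons_val_fin_one]
      linear_combination q x * hI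
    rw [this]
    exact contDiff_const.mul h1

/-- The coefficients of a differential expression as a sequence. -/
noncomputable def DiffExpr.coeffs {m : ℕ} (A : DiffExpr m) :
    ℕ → ℝ → Matrix (Fin 2) (Fin 2) ℂ :=
  fun k => if h : k < m + 1 then A ⟨k, h⟩ else 0

theorem DiffExpr.apply_eq_diffSum {m : ℕ} (A : DiffExpr m) (y : ℝ → Fin 2 → ℂ) :
    A.apply y = diffSum A.coeffs (m + 1) y := by
  ext1 x
  rw [DiffExpr.apply, diffSum, Finset.sum_range]
  exact Finset.sum_congr rfl fun k _ => by
    simp only [DiffExpr.coeffs, dif_pos k.2]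

/-- The function `x ↦ e^{zx} v`. -/
noncomputable def expFun (z : ℂ) (v : Fin 2 → ℂ) (x : ℝ) : Fin 2 → ℂ :=
  Complex.exp (z * x) • v

theorem hasDerivAt_exp_mul_ofReal (z : ℂ) (x : ℝ) :
    HasDerivAt (fun x : ℝ => Complex.exp (z * x)) (z * Complex.exp (z * x)) x := by
  have h := ((hasDerivAt_id (x : ℂ)).const_mul z).cexp.comp_ofReal
  simpa [mul_comm] using h

theorem contDiff_exp_mul_ofReal {k : WithTop ℕ∞} (z : ℂ) :
    ContDiff ℝ k fun x : ℝ => Complex.exp (z * x) :=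
  (contDiff_const.mul Complex.ofRealCLM.contDiff).cexp

theorem contDiff_expFun {k : WithTop ℕ∞} (z : ℂ) (v : Fin 2 → ℂ) : ContDiff ℝ k (expFun z v) :=
  (contDiff_exp_mul_ofReal z).smul contDiff_const

theorem iteratedDeriv_expFun (z : ℂ) (v : Fin 2 → ℂ) (k : ℕ) :
    iteratedDeriv k (expFun z v) = fun x : ℝ => Complex.exp (z * x) • z ^ k • v := by
  induction k with
  | zero => simp [expFun, funext_iff]
  | succ k ih =>
    rw [iteratedDeriv_succ, ih]
    ext1 x
    rw [((hasDerivAt_exp_mul_ofReal z x).smul_const (z ^ k • v)).deriv, pow_succ]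
    simp only [smul_smul]
    congr 1
    ring

theorem diffSum_expFun (c : ℕ → ℝ → Matrix (Fin 2) (Fin 2) ℂ) (m : ℕ) (z : ℂ) (v : Fin 2 → ℂ)
    (x : ℝ) : diffSum c m (expFun z v) x =
      Complex.exp (z * x) • ∑ k ∈ Finset.range m, z ^ k • (c k x *ᵥ v) := by
  simp only [diffSum, iteratedDeriv_expFun, Matrix.mulVec_smul, Finset.smul_sum]

theorem exp_neg_mul_ofReal_smul (z : ℂ) (x : ℝ) (v : Fin 2 → ℂ) :
    Complex.exp (-z * x) • Complex.exp (z * x) • v = v := by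
  rw [smul_smul, ← Complex.exp_add, neg_mul, neg_add_cancel, Complex.exp_zero, one_smul]

/-- On `exp (z x) v` an expression acts, up to the exponential, through its symbol `∑ z ^ k c_k(x)
v`. This is polynomial in `z`, so its coefficients inherit the regularity. -/
theorem continuous_of_diffSum_expFun {c : ℕ → ℝ → Matrix (Fin 2) (Fin 2) ℂ} {m : ℕ}
    (h : ∀ z v, Continuous (diffSum c m (expFun z v))) {k : ℕ} (hk : k < m) :
    Continuous (c k) := by
  have h1 : ∀ v, Continuous fun x => c k x *ᵥ v := fun v => by
    refine continuous_coeff (c := fun k x => c k x *ᵥ v) (m := m) (fun z => ?_) hk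
    have h2 := ((contDiff_exp_mul_ofReal (k := 0) (-z)).continuous).smul (h z v)
    refine h2.congr fun x => ?_
    change Complex.exp (-z * x) • diffSum c m (expFun z v) x = _
    rw [diffSum_expFun, exp_neg_mul_ofReal_smul]
  refine continuous_matrix fun i j => ?_
  have h2 := (continuous_apply i).comp (h1 (Pi.single j 1))
  exact h2.congr fun x => by simp

theorem hasDerivAt_of_diffSum_expFun {c d : ℕ → ℝ → Matrix (Fin 2) (Fin 2) ℂ} {m : ℕ} {x : ℝ}
    (h : ∀ z v, HasDerivAt (diffSum c (m + 1) (expFun z v))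
      (diffSum d (m + 1) (expFun z v) x) x) (hc : c m = 0) {k : ℕ} (hk : k < m + 1) :
    HasDerivAt (c k) (d k x - shift c k x) x := by
  have h1 : ∀ v, HasDerivAt (fun x => c k x *ᵥ v) ((d k x - shift c k x) *ᵥ v) x := fun v => by
    refine hasDerivAt_coeff (c := fun k x => c k x *ᵥ v)
      (d := fun k x => (d k x - shift c k x) *ᵥ v) (m := m + 1) (fun z => ?_) hk
    have h2 := (hasDerivAt_exp_mul_ofReal (-z) x).smul (h z v)
    have h3 : (fun x : ℝ => Complex.exp (-z * x) • diffSum c (m + 1) (expFun z v) x) =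
        fun x => ∑ k ∈ Finset.range (m + 1), z ^ k • (c k x *ᵥ v) := by
      ext1 x
      rw [diffSum_expFun, exp_neg_mul_ofReal_smul]
    change HasDerivAt (fun x : ℝ => Complex.exp (-z * x) • diffSum c (m + 1) (expFun z v) x) _ _
      at h2
    rw [h3] at h2
    refine h2.congr_deriv ?_
    rw [diffSum_expFun, diffSum_expFun, exp_neg_mul_ofReal_smul, mul_smul, exp_neg_mul_ofReal_smul]
    simp only [Matrix.sub_mulVec, smul_sub, Finset.sum_sub_distrib]
    rw [neg_smul, sub_eq_add_neg, Finset.sum_range_succ (fun k => z ^ k • (c k x *ᵥ v)), hc,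
      Finset.sum_range_succ' (fun k => z ^ k • (shift c k x *ᵥ v))]
    simp only [Pi.zero_apply, Matrix.zero_mulVec, smul_zero, add_zero, shift_zero, shift_succ,
      Finset.smul_sum, pow_succ', smul_smul]
  refine hasDerivAt_matrix_iff.2 fun i j => ?_
  have h2 := hasDerivAt_pi.1 (h1 (Pi.single j 1)) i
  simpa only [mulVec_single_one] using h2

theorem contDiff_of_hasDerivAt_U {n : ℕ} (hp : ContDiff ℝ n p) (hq : ContDiff ℝ n q) {E : ℂ}
    {y : ℝ → Fin 2 → ℂ} (hy : ∀ x, HasDerivAt y (U p q E x *ᵥ y x) x) :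
    ContDiff ℝ (n + 1 : ℕ) y := by
  have h : ∀ k ≤ n + 1, ContDiff ℝ k y := by
    intro k
    induction k with
    | zero =>
      exact fun _ => contDiff_zero.2 (continuous_iff_continuousAt.2 fun x => (hy x).continuousAt)
    | succ k ih =>
      intro hk
      have hU : ContDiff ℝ k (U p q E) :=
        (contDiff_U hp hq E).of_le (by exact_mod_cast (by omega))
      have h1 : deriv y = fun x => U p q E x *ᵥ y x := funext fun x => (hy x).deriv
      have : ContDiff ℝ ((k : WithTop ℕ∞) + 1) y := by
        refine contDiff_succ_iff_deriv.2 ⟨fun x => (hy x).differentiableAt, by simp, ?_⟩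
        rw [h1]
        exact ContDiff.mulVec hU (ih (by omega))
      exact_mod_cast this
  exact h _ le_rfl

/-- The commutation relation, in integrated form, for functions of finite smoothness. -/
theorem hasDerivAt_of_commutes {n : ℕ} {A : DiffExpr (n + 1)}
    (hJ : A.HasLeadingCoeff (J ^ (n + 2))) (hA : A.Commutes (L p q)) {y : ℝ → Fin 2 → ℂ}
    (hy : ContDiff ℝ (n + 1 : ℕ) y) (x : ℝ) :
    HasDerivAt (fun x => J *ᵥ A.apply y x - J ^ (n + 2) *ᵥ iteratedDeriv n ((L p q).apply y) x)
      (-(Q p q x *ᵥ A.apply y x) + ∑ l ∈ Finset.range (n + 1),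
        A.coeffs l x *ᵥ iteratedDeriv l ((L p q).apply y) x) x := by
  obtain ⟨hp, hq⟩ := contDiff_of_commutes hA
  have hQ := contDiff_Q hp hq
  set a := A.coeffs with ha
  have haJ : ∀ x, a (n + 1) x = J ^ (n + 2) := fun x => by
    rw [← hJ x]
    simp [ha, DiffExpr.coeffs, Fin.last]
  have hac : ∀ k < n + 2, Continuous (a k) := fun k hk =>
    continuous_of_diffSum_expFun (fun z v => by
      have h := (hA (expFun z v) (contDiff_expFun z v)).2.1 0 one_pos
      rw [iteratedDeriv_zero, A.apply_eq_diffSum] at h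
      exact h.continuous) hk
  have hex : ∀ l, ∃ c : ℕ → ℝ → Matrix (Fin 2) (Fin 2) ℂ, l ≤ n → (∀ j, Continuous (c j)) ∧
      (∀ j, l + 1 < j → c j = 0) ∧ (∀ x, c (l + 1) x = J) ∧
      ∀ y, ContDiff ℝ (l + 1 : ℕ) y →
        iteratedDeriv l ((L p q).apply y) = diffSum c (l + 2) y := fun l => by
    by_cases hl : l ≤ n
    · obtain ⟨c, h1, h2, h3, h4⟩ := exists_iteratedDeriv_L_eq hQ l (n - l) (by omega)
      exact ⟨c, fun _ => ⟨fun j => (h1 j).continuous, h2, h3, h4⟩⟩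
    · exact ⟨0, fun h => absurd h hl⟩
  choose c hc using hex
  have hcy : ∀ l ≤ n, ∀ y, ContDiff ℝ (n + 1 : ℕ) y → ∀ x,
      iteratedDeriv l ((L p q).apply y) x = diffSum (c l) (n + 2) y x := fun l hl y hy x => by
    rw [(hc l hl).2.2.2 y (hy.of_le (by exact_mod_cast (by omega)))]
    refine Finset.sum_subset (Finset.range_mono (by omega)) fun j _ hj => ?_
    rw [(hc l hl).2.1 j (by have := Finset.mem_range.not.1 hj; omega)]
    simp
  -- The relation holds on smooth functions and is needed for solutions, which need only be `n + 1`
  -- times differentiable. It is therefore written as `(C y)' = D y`, with the two top order terms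
  -- `J (A y)'` and `J ^ (n + 2) (L y)^(n+1)` collected under one derivative.
  set C : ℕ → ℝ → Matrix (Fin 2) (Fin 2) ℂ := fun k x => J * a k x - J ^ (n + 2) * c n k x
    with hC
  set D : ℕ → ℝ → Matrix (Fin 2) (Fin 2) ℂ := fun k x =>
    -(Q p q x * a k x) + ∑ l ∈ Finset.range (n + 1), a l x * c l k x with hD
  -- The leading coefficients cancel because powers of `J` commute; `C` thus has order `n`, and `C
  -- y` is differentiable for `y` of class `C^(n+1)`.
  have hC0 : C (n + 1) = 0 := by
    ext1 x
    simp only [hC, haJ, (hc n le_rfl).2.2.1, Pi.zero_apply]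
    rw [← pow_succ, ← pow_succ', sub_self]
  have hCy : ∀ y, ContDiff ℝ (n + 1 : ℕ) y → (fun x => J *ᵥ A.apply y x -
      J ^ (n + 2) *ᵥ iteratedDeriv n ((L p q).apply y) x) = diffSum C (n + 2) y := by
    intro y hy
    ext1 x
    rw [hcy n le_rfl y hy, A.apply_eq_diffSum]
    simp only [diffSum, hC, Matrix.mulVec_sum, Matrix.mulVec_mulVec, Matrix.sub_mulVec,
      Finset.sum_sub_distrib, ha]
  have hDy : ∀ y, ContDiff ℝ (n + 1 : ℕ) y → ∀ x, -(Q p q x *ᵥ A.apply y x) +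
      ∑ l ∈ Finset.range (n + 1), a l x *ᵥ iteratedDeriv l ((L p q).apply y) x =
      diffSum D (n + 2) y x := by
    intro y hy x
    rw [Finset.sum_congr rfl fun l hl => by
      rw [hcy l (by have := Finset.mem_range.1 hl; omega) y hy], A.apply_eq_diffSum]
    simp only [diffSum, hD, Matrix.mulVec_sum, Matrix.mulVec_mulVec, Matrix.add_mulVec,
      Matrix.neg_mulVec, Finset.sum_add_distrib, Finset.sum_neg_distrib, Matrix.sum_mulVec, ha]
    rw [Finset.sum_comm]
  have hDc : ∀ k < n + 2, Continuous (D k) := fun k hk =>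
    ((hQ.continuous.matrix_mul (hac k hk)).neg).add (continuous_finsetSum _ fun l hl =>
      (hac l (by have := Finset.mem_range.1 hl; omega)).matrix_mul
        ((hc l (by have := Finset.mem_range.1 hl; omega)).1 k))
  have hsmooth : ∀ y, ContDiff ℝ ∞ y → ∀ x,
      HasDerivAt (diffSum C (n + 2) y) (diffSum D (n + 2) y x) x := by
    intro y hy
    have hy' : ContDiff ℝ (n + 1 : ℕ) y := hy.of_le (by exact_mod_cast le_top)
    obtain ⟨h1, h2, h3⟩ := hA y hy
    have hac1 : LocAC (A.apply y) := by simpa using h2 0 one_pos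
    have hac2 : LocAC (iteratedDeriv n ((L p q).apply y)) := h1 n (by omega)
    rw [← hCy y hy']
    refine hasDerivAt_of_absolutelyContinuous
      ((hac1.const_mulVec J).sub (hac2.const_mulVec (J ^ (n + 2)))) ?_ ?_
    · refine continuous_finsetSum _ fun k hk => ?_
      exact (hDc k (Finset.mem_range.1 hk)).matrix_mulVec
        (hy.continuous_iteratedDeriv k (by exact_mod_cast le_top))
    · filter_upwards [h3, hac1.ae_differentiableAt, hac2.ae_differentiableAt] with x h4 h5 h6
      rw [((HasDerivAt.const_mulVec J h5.hasDerivAt).fun_sub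
        (HasDerivAt.const_mulVec (J ^ (n + 2)) h6.hasDerivAt)).deriv, ← hDy y hy']
      rw [L_apply, A.apply_eq_diffSum, diffSum, Finset.sum_range_succ, ← ha, haJ,
        iteratedDeriv_succ] at h4
      rw [eq_neg_add_iff_add_eq, ← add_sub_assoc, sub_eq_iff_eq_add]
      exact h4.symm
  -- Testing on exponentials yields identities between coefficients, which then hold irrespective of
  -- the smoothness of `y`.
  have hCd : ∀ k < n + 2, ∀ x, HasDerivAt (C k) (D k x - shift C k x) x := fun k hk x =>
    hasDerivAt_of_diffSum_expFun (fun z v => hsmooth _ (contDiff_expFun z v) x) hC0 hk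
  have hfin := hasDerivAt_diffSum (c := C) (c' := fun j => D j x - shift C j x) (m := n + 1)
    (x := x) (fun j hj => hCd j (by omega) x) (by
      have h1 := hCd (n + 1) (by omega) x
      rw [hC0] at h1
      exact h1.unique (hasDerivAt_const x 0)) hy
  rw [hCy y hy, hDy y hy]
  have h2 : diffSum C (n + 2) y = diffSum C (n + 1) y := by
    ext1 x
    rw [diffSum, Finset.sum_range_succ, hC0]
    simp [diffSum]
  rw [h2]
  simpa only [sub_add_cancel, diffSum] using hfin

/-- A commuting expression maps solutions of `L y = E y` to solutions. -/
theorem hasDerivAt_apply_of_commutes {n : ℕ} {A : DiffExpr (n + 1)}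
    (hJ : A.HasLeadingCoeff (J ^ (n + 2))) (hA : A.Commutes (L p q)) {E : ℂ} {y : ℝ → Fin 2 → ℂ}
    (hy : ∀ x, HasDerivAt y (U p q E x *ᵥ y x) x) (x : ℝ) :
    HasDerivAt (A.apply y) (U p q E x *ᵥ A.apply y x) x := by
  obtain ⟨hp, hq⟩ := contDiff_of_commutes hA
  have hy' := contDiff_of_hasDerivAt_U hp hq hy
  have hL : (L p q).apply y = fun x => E • y x := by
    ext1 x
    rw [L_apply, (hy x).deriv]
    have := (Q_mulVec_add_J_mulVec_eq_iff p q E x (y x) (U p q E x *ᵥ y x) 0).2 (by simp)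
    simpa using this
  have hLk : ∀ l ≤ n + 1, iteratedDeriv l ((L p q).apply y) = fun x => E • iteratedDeriv l y x := by
    intro l
    induction l with
    | zero => intro _; simpa using hL
    | succ l ih =>
      intro hl
      rw [iteratedDeriv_succ, ih (by omega)]
      ext1 x
      exact ((hasDerivAt_iteratedDeriv hy' (j := l) (by omega) x).const_smul E).deriv
  have h1 := hasDerivAt_of_commutes hJ hA hy' x
  have h2 : HasDerivAt (fun x => J ^ (n + 2) *ᵥ iteratedDeriv n ((L p q).apply y) x)
      (J ^ (n + 2) *ᵥ (E • iteratedDeriv (n + 1) y x)) x := by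
    rw [hLk n (by omega)]
    exact HasDerivAt.const_mulVec _
      ((hasDerivAt_iteratedDeriv hy' (j := n) (by omega) x).const_smul E)
  -- For a solution the term moved under the derivative is itself differentiable; it is added back,
  -- and `-J`, the inverse of `J`, isolates `A y`.
  have h3 := HasDerivAt.const_mulVec (-J) (h1.add h2)
  have h4 : ∀ v : Fin 2 → ℂ, -J *ᵥ (J *ᵥ v) = v := fun v => by
    rw [Matrix.mulVec_mulVec, neg_mul, J_mul_J, neg_neg, Matrix.one_mulVec]
  have h5 : (fun x => -J *ᵥ ((fun x => J *ᵥ A.apply y x - J ^ (n + 2) *ᵥ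
      iteratedDeriv n ((L p q).apply y) x) + fun x => J ^ (n + 2) *ᵥ
      iteratedDeriv n ((L p q).apply y) x) x) = A.apply y := by
    ext1 x
    simp only [Pi.add_apply, sub_add_cancel, h4]
  rw [h5] at h3
  refine h3.congr_deriv ?_
  have hlead : J ^ (n + 2) = A.coeffs (n + 1) x := by
    rw [← hJ x]
    simp [DiffExpr.coeffs, Fin.last]
  have h6 : ∑ l ∈ Finset.range (n + 1), A.coeffs l x *ᵥ iteratedDeriv l ((L p q).apply y) x +
      J ^ (n + 2) *ᵥ (E • iteratedDeriv (n + 1) y x) = E • A.apply y x := by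
    rw [A.apply_eq_diffSum, diffSum, Finset.sum_range_succ _ (n + 1), hlead, smul_add,
      Finset.smul_sum, Matrix.mulVec_smul]
    congr 1
    refine Finset.sum_congr rfl fun l hl => ?_
    rw [hLk l (by have := Finset.mem_range.1 hl; omega), Matrix.mulVec_smul]
  rw [add_assoc, h6, U_eq, Matrix.add_mulVec, Matrix.mulVec_add, Matrix.mulVec_neg,
    Matrix.mulVec_smul, ← Matrix.mulVec_mulVec, Matrix.neg_mulVec, Matrix.neg_mulVec,
    Matrix.neg_mulVec, Matrix.smul_mulVec, neg_neg, smul_neg]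
  abel

/-- A commuting expression of order `n + 1` gives rise to a matrix `V`, polynomial in the spectral
parameter, with `V' = [U, V]`. -/
theorem exists_zeroCurvature {n : ℕ} {A : DiffExpr (n + 1)}
    (hJ : A.HasLeadingCoeff (J ^ (n + 2))) (hA : A.Commutes (L p q)) :
    ∃ v : ℕ → ℝ → Matrix (Fin 2) (Fin 2) ℂ, (∀ x, v (n + 1) x = J) ∧ ∀ (E : ℂ) (x : ℝ),
      HasDerivAt (fun x => ∑ l ∈ Finset.range (n + 2), E ^ l • v l x)
        (U p q E x * (∑ l ∈ Finset.range (n + 2), E ^ l • v l x) -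
          (∑ l ∈ Finset.range (n + 2), E ^ l • v l x) * U p q E x) x := by
  obtain ⟨hp, hq⟩ := contDiff_of_commutes hA
  have hQ := contDiff_Q hp hq
  have hex : ∀ k, ∃ M : ℕ → ℝ → Matrix (Fin 2) (Fin 2) ℂ, k ≤ n + 1 →
      (∀ l, k < l → M l = 0) ∧ (∀ x, M k x = (-J) ^ k) ∧
      ∀ (E : ℂ) (y : ℝ → Fin 2 → ℂ), (∀ x, HasDerivAt y (U p q E x *ᵥ y x) x) →
        ∀ x, iteratedDeriv k y x = (∑ l ∈ Finset.range (k + 1), E ^ l • M l x) *ᵥ y x := fun k => by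
    by_cases hk : k ≤ n + 1
    · obtain ⟨M, -, h2, h3, h4⟩ :=
        exists_iteratedDeriv_solution_eq hQ k (n + 1 - k) (by omega)
      exact ⟨M, fun _ => ⟨h2, h3, h4⟩⟩
    · exact ⟨0, fun h => absurd h hk⟩
  choose M hM using hex
  set v : ℕ → ℝ → Matrix (Fin 2) (Fin 2) ℂ := fun l x =>
    ∑ k ∈ Finset.range (n + 2), A.coeffs k x * M k l x with hv
  set V : ℂ → ℝ → Matrix (Fin 2) (Fin 2) ℂ := fun E x =>
    ∑ l ∈ Finset.range (n + 2), E ^ l • v l x with hV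
  have hVy : ∀ (E : ℂ) (y : ℝ → Fin 2 → ℂ), (∀ x, HasDerivAt y (U p q E x *ᵥ y x) x) →
      A.apply y = fun x => V E x *ᵥ y x := by
    intro E y hy
    ext1 x
    have h1 : ∀ k ∈ Finset.range (n + 2), A.coeffs k x *ᵥ iteratedDeriv k y x =
        (∑ l ∈ Finset.range (n + 2), E ^ l • (A.coeffs k x * M k l x)) *ᵥ y x := fun k hk => by
      have hk' : k ≤ n + 1 := by have := Finset.mem_range.1 hk; omega
      rw [(hM k hk').2.2 E y hy, Matrix.mulVec_mulVec, Finset.mul_sum]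
      congr 1
      simp only [mul_smul_comm]
      refine Finset.sum_subset (Finset.range_mono (by omega)) fun l _ hl => ?_
      rw [(hM k hk').1 l (by have := Finset.mem_range.not.1 hl; omega)]
      simp
    rw [A.apply_eq_diffSum, diffSum, Finset.sum_congr rfl h1, ← Matrix.sum_mulVec,
      Finset.sum_comm]
    simp only [hV, hv, Finset.smul_sum]
  refine ⟨v, fun x => ?_, fun E x => ?_⟩
  · have hlead : A.coeffs (n + 1) x = J ^ (n + 2) := by
      rw [← hJ x]
      simp [DiffExpr.coeffs, Fin.last]
    simp only [hv]
    rw [Finset.sum_range_succ, Finset.sum_eq_zero, zero_add, hlead, (hM (n + 1) le_rfl).2.1,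
      pow_succ' J (n + 1), mul_assoc, ← (Commute.refl J).neg_right.mul_pow, mul_neg, J_mul_J,
      neg_neg, one_pow, mul_one]
    · intro k hk
      rw [(hM k (by have := Finset.mem_range.1 hk; omega)).1 (n + 1) (Finset.mem_range.1 hk)]
      simp
  · have hpc := hp.continuous
    have hqc := hq.continuous
    -- On solutions `A` acts as `V`, so the columns of `V φ` are again solutions; multiplying by the
    -- inverse of `φ` gives `V' = [U, V]`.
    have h1 : ∀ x, HasDerivAt (fun x => V E x * phi p q E x 0)
        (U p q E x * (V E x * phi p q E x 0)) x := fun x => by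
      refine hasDerivAt_matrix_iff.2 fun i j => ?_
      have hs := (sol_spec hpc hqc E 0 (Pi.single j 1)).1
      have h2 := hasDerivAt_pi.1 (hasDerivAt_apply_of_commutes hJ hA hs x) i
      rw [hVy E _ hs] at h2
      exact h2
    have h2 := HasDerivAt.matMul (h1 x) (hasDerivAt_adjugate (hasDerivAt_phi hpc hqc E 0 x))
    have h3 : ∀ x, V E x * phi p q E x 0 * (phi p q E x 0).adjugate = V E x := fun x => by
      rw [mul_assoc, phi_mul_adjugate hpc hqc, mul_one]
    refine (h2.congr_of_eventuallyEq
      (Filter.Eventually.of_forall fun x => (h3 x).symm)).congr_deriv ?_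
    rw [mul_assoc (U p q E x), h3, mul_neg, ← mul_assoc, h3, sub_eq_add_neg]

end Forward

/-! ### Consequences of `V' = [U, V]`. -/

section ZeroCurvature

variable {p q : ℝ → ℂ}

theorem U_apply (p q : ℝ → ℂ) (E : ℂ) (x : ℝ) :
    U p q E x 0 0 = -Complex.I * E ∧ U p q E x 0 1 = q x ∧ U p q E x 1 0 = p x ∧
      U p q E x 1 1 = Complex.I * E := ⟨rfl, rfl, rfl, rfl⟩

/-- The matrix polynomial `∑_{l < m} E^l v_l(x)`. -/
noncomputable def matPoly (v : ℕ → ℝ → Matrix (Fin 2) (Fin 2) ℂ) (m : ℕ) (E : ℂ) (x : ℝ) :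
    Matrix (Fin 2) (Fin 2) ℂ :=
  ∑ l ∈ Finset.range m, E ^ l • v l x

/-- A traceless matrix polynomial of degree `n + 1` in the spectral parameter with leading
coefficient `J` that satisfies `V' = [U, V]`. -/
structure IsZeroCurvature (p q : ℝ → ℂ) (n : ℕ) (v : ℕ → ℝ → Matrix (Fin 2) (Fin 2) ℂ) :
    Prop where
  leading : ∀ x, v (n + 1) x = J
  trace_eq : ∀ l x, (v l x).trace = 0
  hasDerivAt : ∀ E x, HasDerivAt (matPoly v (n + 2) E)
    (U p q E x * matPoly v (n + 2) E x - matPoly v (n + 2) E x * U p q E x) x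

/-- Commutators are traceless, so the trace of `V` is constant in `x`. Subtracting half of it times
the identity changes neither the commutator nor, since `J` is traceless, the leading coefficient. -/
theorem exists_isZeroCurvature {n : ℕ} {A : DiffExpr (n + 1)}
    (hJ : A.HasLeadingCoeff (J ^ (n + 2))) (hA : A.Commutes (L p q)) :
    ∃ v, IsZeroCurvature p q n v := by
  obtain ⟨v, hv, hd⟩ := exists_zeroCurvature hJ hA
  refine ⟨fun l x => v l x - ((v l x).trace / 2) • (1 : Matrix (Fin 2) (Fin 2) ℂ),
    fun x => ?_, fun l x => ?_, fun E x => ?_⟩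
  · simp [hv, J, Matrix.trace_fin_two]
  · simp [Matrix.trace_fin_two]
  · set V := matPoly v (n + 2) E with hV
    have h1 : matPoly (fun l x => v l x - ((v l x).trace / 2) • (1 : Matrix (Fin 2) (Fin 2) ℂ))
        (n + 2) E = fun x => V x - ((V x).trace / 2) • (1 : Matrix (Fin 2) (Fin 2) ℂ) := by
      ext1 x
      simp only [hV, matPoly, smul_sub, Finset.sum_sub_distrib, Matrix.trace_sum,
        Matrix.trace_smul, Finset.sum_div, Finset.sum_smul, smul_smul, smul_eq_mul, mul_div_assoc]
    have h2 := hd E x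
    change HasDerivAt V (U p q E x * V x - V x * U p q E x) x at h2
    have h3 := hasDerivAt_matrix_iff.1 h2
    have h4 : HasDerivAt (fun x => (V x).trace / 2) 0 x := by
      have h5 := ((h3 0 0).fun_add (h3 1 1)).div_const 2
      simp only [Matrix.trace_fin_two]
      refine h5.congr_deriv ?_
      simp [Matrix.mul_apply, Fin.sum_univ_two]
      ring
    rw [h1]
    refine (h2.fun_sub (h4.smul_const (1 : Matrix (Fin 2) (Fin 2) ℂ))).congr_deriv ?_
    simp only [zero_smul, sub_zero, mul_sub, sub_mul, mul_smul_comm, smul_mul_assoc, mul_one,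
      one_mul]
    abel

variable {n : ℕ} {v : ℕ → ℝ → Matrix (Fin 2) (Fin 2) ℂ}

/-- `V` intertwines the values of solutions at different points. -/
theorem IsZeroCurvature.mul_phi (hv : IsZeroCurvature p q n v) (hp : Continuous p)
    (hq : Continuous q) (E : ℂ) (x₀ x : ℝ) :
    matPoly v (n + 2) E x * phi p q E x x₀ = phi p q E x x₀ * matPoly v (n + 2) E x₀ := by
  have h1 : ∀ x, HasDerivAt (fun x => matPoly v (n + 2) E x * phi p q E x x₀)
      (U p q E x * (matPoly v (n + 2) E x * phi p q E x x₀)) x := fun x => by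
    refine (HasDerivAt.matMul (hv.hasDerivAt E x) (hasDerivAt_phi hp hq E x₀ x)).congr_deriv ?_
    noncomm_ring
  have h2 : ∀ x, HasDerivAt (fun x => phi p q E x x₀ * matPoly v (n + 2) E x₀)
      (U p q E x * (phi p q E x x₀ * matPoly v (n + 2) E x₀)) x := fun x => by
    refine (HasDerivAt.matMul (hasDerivAt_phi hp hq E x₀ x)
      (hasDerivAt_const x (matPoly v (n + 2) E x₀))).congr_deriv ?_
    simp [mul_assoc]
  ext i j
  have key := eq_of_hasDerivAt_U (g := 0) hp hq (E := E) (x₀ := x₀)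
    (y := fun x => (matPoly v (n + 2) E x * phi p q E x x₀) *ᵥ Pi.single j 1)
    (z := fun x => (phi p q E x x₀ * matPoly v (n + 2) E x₀) *ᵥ Pi.single j 1)
    (fun x => by
      refine (HasDerivAt.mulVec (h1 x) (hasDerivAt_const x _)).congr_deriv ?_
      simp only [Matrix.mulVec_zero, add_zero, Pi.zero_apply, Matrix.mulVec_mulVec])
    (fun x => by
      refine (HasDerivAt.mulVec (h2 x) (hasDerivAt_const x _)).congr_deriv ?_
      simp only [Matrix.mulVec_zero, add_zero, Pi.zero_apply, Matrix.mulVec_mulVec])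
    (by simp only [phi_self hp hq, mul_one, one_mul])
  have h3 := congrFun (congrFun key x) i
  simpa only [mulVec_single_one] using h3

theorem IsZeroCurvature.eq_zero (hv : IsZeroCurvature p q n v) (hp : Continuous p)
    (hq : Continuous q) {E : ℂ} {x₀ : ℝ} (h : matPoly v (n + 2) E x₀ = 0) (x : ℝ) :
    matPoly v (n + 2) E x = 0 := by
  have h1 := hv.mul_phi hp hq E x₀ x
  rw [h, mul_zero] at h1
  have h2 := congrArg (· * (phi p q E x x₀).adjugate) h1
  simpa only [mul_assoc, phi_mul_adjugate hp hq, mul_one, zero_mul] using h2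

theorem IsZeroCurvature.apply_one_one (hv : IsZeroCurvature p q n v) (E : ℂ) (x : ℝ) :
    matPoly v (n + 2) E x 1 1 = -matPoly v (n + 2) E x 0 0 := by
  have : (matPoly v (n + 2) E x).trace = 0 := by
    simp [matPoly, Matrix.trace_sum, hv.trace_eq]
  rw [Matrix.trace_fin_two] at this
  linear_combination this

theorem IsZeroCurvature.hasDerivAt_zero_zero (hv : IsZeroCurvature p q n v) (E : ℂ) (x : ℝ) :
    HasDerivAt (fun x => matPoly v (n + 2) E x 0 0)
      (q x * matPoly v (n + 2) E x 1 0 - p x * matPoly v (n + 2) E x 0 1) x := by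
  refine (hasDerivAt_matrix_iff.1 (hv.hasDerivAt E x) 0 0).congr_deriv ?_
  simp only [Matrix.sub_apply, Matrix.mul_apply, Fin.sum_univ_two, U_apply]
  ring

theorem IsZeroCurvature.hasDerivAt_zero_one (hv : IsZeroCurvature p q n v) (E : ℂ) (x : ℝ) :
    HasDerivAt (fun x => matPoly v (n + 2) E x 0 1)
      (-2 * Complex.I * E * matPoly v (n + 2) E x 0 1 -
        2 * q x * matPoly v (n + 2) E x 0 0) x := by
  refine (hasDerivAt_matrix_iff.1 (hv.hasDerivAt E x) 0 1).congr_deriv ?_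
  simp only [Matrix.sub_apply, Matrix.mul_apply, Fin.sum_univ_two, U_apply, hv.apply_one_one]
  ring

/-- If the upper right entry of `V` vanishes identically for some `E`, then so does `V`. -/
theorem IsZeroCurvature.eq_zero_of_zero_one (hv : IsZeroCurvature p q n v) (hp : Continuous p)
    (hq : Continuous q) {x₀ : ℝ} (hx₀ : q x₀ ≠ 0) {E : ℂ}
    (h : ∀ x, matPoly v (n + 2) E x 0 1 = 0) (x : ℝ) : matPoly v (n + 2) E x = 0 := by
  -- The equation for `V₁₂` forces `q V₁₁ = 0`, so `V₁₁` vanishes near `x₀`; the equation for `V₁₁`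
  -- then gives `V₂₁(x₀) = 0`. A zero of `V` at one point propagates to the line.
  have h1 : ∀ x, q x * matPoly v (n + 2) E x 0 0 = 0 := fun x => by
    have h2 := hv.hasDerivAt_zero_one E x
    have h3 : (fun x => matPoly v (n + 2) E x 0 1) = fun _ => 0 := funext h
    rw [h3] at h2
    have h4 := h2.unique (hasDerivAt_const x 0)
    rw [h] at h4
    linear_combination -h4 / 2
  have hev : ∀ᶠ x in nhds x₀, matPoly v (n + 2) E x 0 0 = 0 := by
    filter_upwards [hq.continuousAt.eventually_ne hx₀] with x hx
    exact (mul_eq_zero.1 (h1 x)).resolve_left hx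
  have h10 : matPoly v (n + 2) E x₀ 1 0 = 0 := by
    have h2 := (hv.hasDerivAt_zero_zero E x₀).congr_of_eventuallyEq
      (f₁ := fun _ => 0) (hev.mono fun x hx => hx.symm)
    have h3 := h2.unique (hasDerivAt_const x₀ 0)
    rw [h, mul_zero, sub_zero] at h3
    exact (mul_eq_zero.1 h3).resolve_left hx₀
  refine hv.eq_zero hp hq (x₀ := x₀) ?_ x
  ext i j
  fin_cases i <;> fin_cases j
  · exact hev.self_of_nhds
  · exact h x₀
  · exact h10
  · simpa [hv.apply_one_one] using hev.self_of_nhds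

/-- Comparison of powers of `E`, with `U = -E J + J Q`. The power `E ^ (n + 2)` would carry `[J, J]
= 0`, so no relation is lost by stopping at `n + 1`. -/
theorem IsZeroCurvature.hasDerivAt_coeff (hv : IsZeroCurvature p q n v) {l : ℕ} (hl : l < n + 2)
    (x : ℝ) : HasDerivAt (v l) (J * Q p q x * v l x - v l x * (J * Q p q x) -
      (J * shift v l x - shift v l x * J)) x := by
  refine AKNS.hasDerivAt_coeff (d := fun l x => J * Q p q x * v l x - v l x * (J * Q p q x) -
      (J * shift v l x - shift v l x * J)) (m := n + 2) (fun E => ?_) hl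
  refine (hv.hasDerivAt E x).congr_deriv ?_
  simp only [smul_sub, Finset.sum_sub_distrib]
  rw [Finset.sum_range_succ' (fun l => E ^ l • (J * shift v l x)),
    Finset.sum_range_succ' (fun l => E ^ l • (shift v l x * J))]
  have h1 : ∑ l ∈ Finset.range (n + 1), E ^ l • v l x =
      matPoly v (n + 2) E x - E ^ (n + 1) • J := by
    rw [matPoly, Finset.sum_range_succ _ (n + 1), hv.leading, add_sub_cancel_right]
  have h2 : ∑ k ∈ Finset.range (n + 1), E ^ (k + 1) • (J * shift v (k + 1) x) =
      E • (J * (matPoly v (n + 2) E x - E ^ (n + 1) • J)) := by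
    rw [← h1, Finset.mul_sum, Finset.smul_sum]
    exact Finset.sum_congr rfl fun k _ => by
      rw [mul_smul_comm, smul_smul, pow_succ', shift_succ]
  have h3 : ∑ k ∈ Finset.range (n + 1), E ^ (k + 1) • (shift v (k + 1) x * J) =
      E • ((matPoly v (n + 2) E x - E ^ (n + 1) • J) * J) := by
    rw [← h1, Finset.sum_mul, Finset.smul_sum]
    exact Finset.sum_congr rfl fun k _ => by
      rw [smul_mul_assoc, smul_smul, pow_succ', shift_succ]
  rw [h2, h3]
  simp only [← mul_smul_comm]
  simp only [shift_zero, Pi.zero_apply, mul_zero, zero_mul, pow_zero, mul_smul_comm]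
  rw [U_eq]
  have h4 : ∑ i ∈ Finset.range (n + 2), E ^ i • (J * Q p q x * v i x) =
      J * Q p q x * matPoly v (n + 2) E x := by
    simp only [matPoly, Finset.mul_sum, mul_smul_comm]
  have h5 : ∑ i ∈ Finset.range (n + 2), E ^ i • (v i x * (J * Q p q x)) =
      matPoly v (n + 2) E x * (J * Q p q x) := by
    simp only [matPoly, Finset.sum_mul, smul_mul_assoc]
  simp only [h4, h5]
  simp only [mul_sub, sub_mul, add_mul, mul_add, smul_sub, neg_mul, mul_neg, smul_mul_assoc,
    mul_smul_comm, smul_zero]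
  abel

end ZeroCurvature

/-! ### From the recursion back to commuting expressions. -/

section Converse

variable {p q : ℝ → ℂ} {n : ℕ}

/-- The powers of `L` are differential expressions. -/
theorem exists_iterate_L_eq (hQ : ContDiff ℝ n (Q p q)) (k r : ℕ) (hk : k + r = n + 1) :
    ∃ c : ℕ → ℝ → Matrix (Fin 2) (Fin 2) ℂ, (∀ j, ContDiff ℝ r (c j)) ∧
      (∀ j, k < j → c j = 0) ∧ (∀ x, c k x = J ^ k) ∧
      ∀ y, ContDiff ℝ k y → (L p q).apply^[k] y = diffSum c (k + 1) y := by
  induction k generalizing r with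
  | zero =>
    refine ⟨fun j => match j with
      | 0 => fun _ => 1
      | _ + 1 => 0, ?_, ?_, fun _ => by simp, ?_⟩
    · rintro (_ | j)
      · exact contDiff_const
      · exact contDiff_const (c := (0 : Matrix (Fin 2) (Fin 2) ℂ))
    · rintro (_ | j) hj
      · omega
      · rfl
    · intro y _
      ext1 x
      rw [diffSum, Finset.sum_range_one, iteratedDeriv_zero, Matrix.one_mulVec]
      rfl
  | succ k ih =>
    obtain ⟨c, hc, hc0, hcJ, hcy⟩ := ih (r + 1) (by omega)
    have hd0 : ∀ x, deriv (c (k + 1)) x = 0 := fun x => by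
      rw [hc0 (k + 1) (by omega), deriv_zero_matrix]
    refine ⟨fun j x => Q p q x * c j x + J * (deriv (c j) x + shift c j x), ?_, ?_, ?_, ?_⟩
    · intro j
      have hcr : ∀ j, ContDiff ℝ r (c j) := fun j => (hc j).of_le (by exact_mod_cast Nat.le_succ r)
      refine (ContDiff.matMul (hQ.of_le (by exact_mod_cast (by omega))) (hcr j)).add
        (ContDiff.matMul contDiff_const ((contDiff_deriv (hc j)).add ?_))
      cases j with
      | zero => exact contDiff_const (c := (0 : Matrix (Fin 2) (Fin 2) ℂ))
      | succ j => exact hcr j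
    · intro j hj
      obtain ⟨j, rfl⟩ : ∃ i, j = i + 1 := ⟨j - 1, by omega⟩
      ext1 x
      simp only [shift_succ, hc0 j (by omega), hc0 (j + 1) (by omega), deriv_zero_matrix,
        Pi.zero_apply, mul_zero, add_zero]
    · intro x
      simp only [shift_succ, hcJ, hd0]
      rw [hc0 (k + 1) (by omega), Pi.zero_apply, mul_zero, zero_add, zero_add, pow_succ']
    · intro y hy
      have hy' : ContDiff ℝ k y := hy.of_le (by exact_mod_cast Nat.le_succ _)
      rw [Function.iterate_succ_apply', hcy y hy']
      ext1 x
      rw [L_apply, (hasDerivAt_diffSum (c' := fun j => deriv (c j) x)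
        (fun j _ => hasDerivAt_of_contDiff (hc j) x) (hd0 x) hy).deriv]
      have h1 : diffSum c (k + 1) y x = diffSum c (k + 2) y x := by
        rw [diffSum, diffSum, Finset.sum_range_succ _ (k + 1), hc0 (k + 1) (by omega)]
        simp
      rw [h1]
      simp only [diffSum, Matrix.mulVec_sum, Matrix.mulVec_mulVec, Matrix.add_mulVec,
        Finset.sum_add_distrib, mul_add, Matrix.mulVec_add]

theorem contDiff_L_apply (hQ : ContDiff ℝ n (Q p q)) {y : ℝ → Fin 2 → ℂ} (hy : ContDiff ℝ ∞ y) :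
    ContDiff ℝ n ((L p q).apply y) := by
  have h : (L p q).apply y = fun x => Q p q x *ᵥ y x + J *ᵥ deriv y x := funext (L_apply p q y)
  rw [h]
  have hd : ContDiff ℝ n (deriv y) :=
    contDiff_deriv (hy.of_le (by exact_mod_cast le_top))
  exact (ContDiff.mulVec hQ (hy.of_le (by exact_mod_cast le_top))).add
    (ContDiff.mulVec contDiff_const hd)

/-- If `b` satisfies the recursion for the coefficients of a commuting expression `∑ b_k L^k`, this
expression indeed commutes with `L`. -/
theorem exists_commutes_of_recursion (hQ : ContDiff ℝ n (Q p q))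
    {b : ℕ → ℝ → Matrix (Fin 2) (Fin 2) ℂ} (hbJ : ∀ x, b n x = J)
    (hb : ∀ k < n + 1, ∀ x, HasDerivAt (b k) (J * Q p q x * b k x - b k x * (J * Q p q x) -
      (J * shift b k x - shift b k x * J)) x) :
    ∃ P : DiffExpr n, P.HasLeadingCoeff (J ^ (n + 1)) ∧ P.Commutes (L p q) := by
  have hex : ∀ k, ∃ c : ℕ → ℝ → Matrix (Fin 2) (Fin 2) ℂ, k < n + 1 →
      (∀ j, ContDiff ℝ 1 (c j)) ∧ (∀ j, k < j → c j = 0) ∧ (∀ x, c k x = J ^ k) ∧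
      ∀ y, ContDiff ℝ k y → (L p q).apply^[k] y = diffSum c (k + 1) y := fun k => by
    by_cases hk : k < n + 1
    · obtain ⟨c, h1, h2, h3, h4⟩ := exists_iterate_L_eq hQ k (n + 1 - k) (by omega)
      exact ⟨c, fun _ => ⟨fun j => (h1 j).of_le (by exact_mod_cast (by omega)), h2, h3, h4⟩⟩
    · exact ⟨0, fun h => absurd h hk⟩
  choose c hc using hex
  -- The expression `∑ b_k L ^ k` expanded in powers of the derivative; its leading coefficient is
  -- `b_n J ^ n = J ^ (n + 1)`.
  set P : DiffExpr n := fun j x => ∑ k ∈ Finset.range (n + 1), b k x * c k j x with hP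
  have hPy : ∀ y, ContDiff ℝ n y → P.apply y = fun x =>
      ∑ k ∈ Finset.range (n + 1), b k x *ᵥ (L p q).apply^[k] y x := by
    intro y hy
    ext1 x
    have h1 : ∀ k ∈ Finset.range (n + 1), b k x *ᵥ (L p q).apply^[k] y x =
        ∑ j ∈ Finset.range (n + 1), (b k x * c k j x) *ᵥ iteratedDeriv j y x := fun k hk => by
      have hk' := Finset.mem_range.1 hk
      rw [(hc k hk').2.2.2 y (hy.of_le (by exact_mod_cast (by omega))), diffSum, Matrix.mulVec_sum]
      simp only [Matrix.mulVec_mulVec]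
      refine Finset.sum_subset (Finset.range_mono (by omega)) fun j _ hj => ?_
      rw [(hc k hk').2.1 j (by have := Finset.mem_range.not.1 hj; omega)]
      simp
    rw [Finset.sum_congr rfl h1, Finset.sum_comm, DiffExpr.apply, Finset.sum_range]
    simp only [hP, Matrix.sum_mulVec]
  refine ⟨P, fun x => ?_, fun y hy => ?_⟩
  · simp only [hP, Fin.val_last]
    rw [Finset.sum_range_succ, Finset.sum_eq_zero, zero_add, hbJ, (hc n (by omega)).2.2.1,
      pow_succ']
    intro k hk
    rw [(hc k (by have := Finset.mem_range.1 hk; omega)).2.1 n (Finset.mem_range.1 hk)]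
    simp
  have hLy := contDiff_L_apply hQ hy
  have hyn : ∀ k : ℕ, ContDiff ℝ k y := fun k => hy.of_le (by exact_mod_cast le_top)
  set u : ℕ → ℝ → Fin 2 → ℂ := fun k => (L p q).apply^[k] y with hu
  have hu1 : ∀ k < n + 1, ContDiff ℝ 1 (u k) := fun k hk => by
    simp only [hu]
    rw [(hc k hk).2.2.2 y (hyn k)]
    refine ContDiff.sum fun j _ => ContDiff.mulVec ((hc k hk).1 j) ?_
    exact contDiff_one_of_hasDerivAt
      (hasDerivAt_iteratedDeriv (hyn (j + 1)) (Nat.lt_succ_self j))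
      ((hyn (j + 1)).continuous_iteratedDeriv (j + 1) le_rfl)
  have hud : ∀ k < n + 1, ∀ x, HasDerivAt (u k) (-J *ᵥ (u (k + 1) x - Q p q x *ᵥ u k x)) x := by
    intro k hk x
    refine ((hu1 k hk).differentiable one_ne_zero x).hasDerivAt.congr_deriv ?_
    simp only [hu, Function.iterate_succ_apply', L_apply, add_sub_cancel_left]
    rw [Matrix.mulVec_mulVec, neg_mul, J_mul_J, neg_neg, Matrix.one_mulVec]
  have hb1 : ∀ k < n + 1, ContDiff ℝ 1 (b k) := by
    have hbc : ∀ k < n + 1, Continuous (b k) := fun k hk =>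
      continuous_iff_continuousAt.2 fun x => (hb k hk x).continuousAt
    intro k hk
    have hs : Continuous (shift b k) := by
      cases k with
      | zero => exact continuous_const (y := (0 : Matrix (Fin 2) (Fin 2) ℂ))
      | succ k => exact hbc k (by omega)
    have hJQ : Continuous fun x => J * Q p q x := continuous_const.matrix_mul hQ.continuous
    exact contDiff_one_of_hasDerivAt (hb k hk) (((hJQ.matrix_mul (hbc k hk)).sub
      ((hbc k hk).matrix_mul hJQ)).sub ((continuous_const.matrix_mul hs).sub
        (hs.matrix_mul continuous_const)))
  refine ⟨fun j hj => ?_, fun j hj => ?_, Filter.Eventually.of_forall fun x => ?_⟩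
  · exact locAC_of_contDiff (contDiff_one_of_hasDerivAt (hasDerivAt_iteratedDeriv hLy hj)
      (hLy.continuous_iteratedDeriv (j + 1) (by exact_mod_cast hj)))
  · obtain rfl : j = 0 := by omega
    rw [iteratedDeriv_zero, hPy y (hyn n)]
    exact locAC_of_contDiff (ContDiff.sum fun k hk =>
      ContDiff.mulVec (hb1 k (Finset.mem_range.1 hk)) (hu1 k (Finset.mem_range.1 hk)))
  · have hd : HasDerivAt (P.apply y) (∑ k ∈ Finset.range (n + 1),
        ((J * Q p q x * b k x - b k x * (J * Q p q x) -
          (J * shift b k x - shift b k x * J)) *ᵥ u k x +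
        b k x *ᵥ (-J *ᵥ (u (k + 1) x - Q p q x *ᵥ u k x)))) x := by
      rw [hPy y (hyn n)]
      exact HasDerivAt.fun_sum fun k hk => HasDerivAt.mulVec (hb k (Finset.mem_range.1 hk) x)
        (hud k (Finset.mem_range.1 hk) x)
    rw [L_apply, hd.deriv, hPy _ hLy, hPy y (hyn n), Matrix.mulVec_sum, Matrix.mulVec_sum,
      ← Finset.sum_add_distrib]
    -- With `u k = L ^ k y`, the recursion removes `Q` from `L (b_k u_k)`. In the sum over `k` the
    -- terms `J b_k J` telescope, leaving `b_k u_(k+1)` for `k < n` and `-J³ u_(n+1) = b_n u_(n+1)`,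
    -- that is, `P L y`.
    have hterm : ∀ k, Q p q x *ᵥ b k x *ᵥ u k x + J *ᵥ
        ((J * Q p q x * b k x - b k x * (J * Q p q x) -
          (J * shift b k x - shift b k x * J)) *ᵥ u k x +
        b k x *ᵥ (-J *ᵥ (u (k + 1) x - Q p q x *ᵥ u k x))) =
        (shift b k x + J * shift b k x * J) *ᵥ u k x - (J * b k x * J) *ᵥ u (k + 1) x := by
      intro k
      simp only [Matrix.mulVec_add, Matrix.mulVec_sub, Matrix.mulVec_mulVec]
      have hJJ : ∀ M : Matrix (Fin 2) (Fin 2) ℂ, J * (J * M) = -M := fun M => by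
        rw [← mul_assoc, J_mul_J, neg_one_mul]
      simp only [mul_sub, mul_assoc, hJJ, Matrix.add_mulVec, Matrix.sub_mulVec, mul_neg,
        neg_mul, Matrix.neg_mulVec]
      abel
    rw [Finset.sum_congr rfl fun k _ => hterm k, Finset.sum_sub_distrib,
      Finset.sum_range_succ' (fun k => (shift b k x + J * shift b k x * J) *ᵥ u k x),
      Finset.sum_range_succ (fun k => (J * b k x * J) *ᵥ u (k + 1) x), hbJ, J_mul_J]
    simp only [shift_succ, shift_zero, Pi.zero_apply, mul_zero, zero_mul, add_zero,
      Matrix.zero_mulVec, Matrix.add_mulVec, Finset.sum_add_distrib]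
    rw [Finset.sum_range_succ, hbJ]
    simp only [neg_mul, one_mul, Matrix.neg_mulVec, hu, Function.iterate_succ_apply]
    abel

/-- If `V(E₀, ·)` vanishes identically, there is a commuting expression of lower order. -/
theorem IsZeroCurvature.exists_commutes {v : ℕ → ℝ → Matrix (Fin 2) (Fin 2) ℂ}
    (hv : IsZeroCurvature p q n v) (hQ : ContDiff ℝ n (Q p q)) {E : ℂ}
    (h : ∀ x, matPoly v (n + 2) E x = 0) :
    ∃ P : DiffExpr n, P.HasLeadingCoeff (J ^ (n + 1)) ∧ P.Commutes (L p q) := by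
  -- The Horner coefficients of the quotient of `V(z)` by `z - E`, a polynomial of degree `n` with
  -- leading coefficient `J`.
  set b : ℕ → ℝ → Matrix (Fin 2) (Fin 2) ℂ := fun k x =>
    ∑ j ∈ Finset.range (n + 1 - k), E ^ j • v (k + 1 + j) x with hb
  refine exists_commutes_of_recursion hQ (b := b) (fun x => by simp [hb, hv.leading]) ?_
  intro k hk x
  have h1 : HasDerivAt (b k) (∑ j ∈ Finset.range (n + 1 - k), E ^ j •
      (J * Q p q x * v (k + 1 + j) x - v (k + 1 + j) x * (J * Q p q x) -
      (J * shift v (k + 1 + j) x - shift v (k + 1 + j) x * J))) x :=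
    HasDerivAt.fun_sum fun j hj => (hv.hasDerivAt_coeff
      (by have := Finset.mem_range.1 hj; omega) x).fun_const_smul (E ^ j)
  refine h1.congr_deriv ?_
  -- Shifting commutes with the division up to the boundary term in `v_(n+1) = J`, which disappears
  -- from the commutator with `J`. For `k = 0` this is where `V(E) = 0` enters.
  have h2 : ∃ z : ℂ, ∑ j ∈ Finset.range (n + 1 - k), E ^ j • shift v (k + 1 + j) x =
      shift b k x - z • J := by
    refine ⟨E ^ (n + 1 - k), ?_⟩
    cases k with
    | zero =>
      have h3 := h x
      rw [matPoly, Finset.sum_range_succ, hv.leading] at h3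
      rw [shift_zero, Pi.zero_apply, zero_sub, Nat.sub_zero, ← eq_neg_of_add_eq_zero_left h3]
      refine Finset.sum_congr rfl fun j _ => ?_
      rw [show 0 + 1 + j = j + 1 by ring, shift_succ]
    | succ k =>
      simp only [shift_succ, hb]
      rw [show n + 1 - k = n + 1 - (k + 1) + 1 by omega, Finset.sum_range_succ,
        show k + 1 + (n + 1 - (k + 1)) = n + 1 by omega, hv.leading, add_sub_cancel_right]
      refine Finset.sum_congr rfl fun j _ => ?_
      rw [show k + 1 + 1 + j = k + 1 + j + 1 by ring, shift_succ]
  obtain ⟨z, hz⟩ := h2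
  have h3 : J * (∑ j ∈ Finset.range (n + 1 - k), E ^ j • shift v (k + 1 + j) x) -
      (∑ j ∈ Finset.range (n + 1 - k), E ^ j • shift v (k + 1 + j) x) * J =
      J * shift b k x - shift b k x * J := by
    rw [hz, mul_sub, sub_mul, mul_smul_comm, smul_mul_assoc]
    abel
  rw [← h3]
  simp only [hb, smul_sub, Finset.sum_sub_distrib, Finset.mul_sum, Finset.sum_mul, mul_smul_comm,
    smul_mul_assoc]

end Converse

/-! ### The monodromy matrix: dependence on the base point, and an energy where it is not unimodular
scalar. -/

section Monodromy

variable {p q : ℝ → ℂ} {Ω : ℝ}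

theorem U_add_period (hpΩ : Function.Periodic p Ω) (hqΩ : Function.Periodic q Ω) (E : ℂ) (x : ℝ) :
    U p q E (x + Ω) = U p q E x := by
  rw [U, U, hpΩ, hqΩ]

theorem phi_add_period (hp : Continuous p) (hq : Continuous q) (hpΩ : Function.Periodic p Ω)
    (hqΩ : Function.Periodic q Ω) (E : ℂ) (x₀ x : ℝ) :
    phi p q E (x + Ω) (x₀ + Ω) = phi p q E x x₀ := by
  ext i j
  have h := sol_spec hp hq E (x₀ + Ω) (Pi.single j 1)
  have h1 := sol_eq hp hq (E := E) (x₀ := x₀)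
    (y := fun x => sol p q E (x₀ + Ω) (Pi.single j 1) (x + Ω)) (fun x => by
      have h2 := HasDerivAt.comp_add_const x Ω (h.1 (x + Ω))
      rwa [U_add_period hpΩ hqΩ] at h2)
  rw [h.2] at h1
  exact (congrFun (congrFun h1 x) i).symm

theorem monodromy_eq_conj (hp : Continuous p) (hq : Continuous q) (hpΩ : Function.Periodic p Ω)
    (hqΩ : Function.Periodic q Ω) (E : ℂ) (x₀ x : ℝ) : monodromy p q Ω E x =
      phi p q E x x₀ * monodromy p q Ω E x₀ * (phi p q E x x₀).adjugate := by
  have h1 := phi_eq_mul hp hq E x₀ x (x + Ω)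
  have h2 := phi_eq_mul hp hq E x₀ (x₀ + Ω) (x + Ω)
  have h3 : phi p q E (x + Ω) x₀ = phi p q E x x₀ * phi p q E (x₀ + Ω) x₀ := by
    rw [← phi_add_period hp hq hpΩ hqΩ E x₀ x, h2, mul_assoc, adjugate_mul_phi hp hq, mul_one]
  rw [monodromy, h1, h3, monodromy]

/-- In the cone `|y₁| > |y₂|`, the indefinite form `|y₁|² - |y₂|²` is increasing along solutions if
`E` is far up on the imaginary axis. -/
theorem exists_monodromy_ne_smul_one (hp : Continuous p) (hq : Continuous q) (hΩ : 0 < Ω) :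
    ∃ E : ℂ, ∀ s : ℂ, ‖s‖ = 1 → monodromy p q Ω E 0 ≠ s • (1 : Matrix (Fin 2) (Fin 2) ℂ) := by
  obtain ⟨B, hB⟩ := isCompact_Icc.exists_bound_of_continuousOn (s := Set.Icc 0 Ω)
    (f := fun x => ‖p x‖ + ‖q x‖) (hp.norm.add hq.norm).continuousOn
  -- For `E = iτ` the diagonal of `U` is `(τ, -τ)`, so the derivative of `|y₁|² - |y₂|²` is at least
  -- `(2τ - B)(|y₁|² + |y₂|²) > 0`. A unimodular scalar monodromy would return the form to its
  -- initial value.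
  set τ : ℝ := B + 1 with hτ
  set E : ℂ := Complex.I * τ with hE
  refine ⟨E, fun s hs hT => ?_⟩
  obtain ⟨hyd, hy0⟩ := sol_spec hp hq E 0 (Pi.single 0 1)
  set y := sol p q E 0 (Pi.single 0 1) with hy
  have hyne : ∀ x, y x ≠ 0 := fun x hx => by
    have h1 := eq_of_hasDerivAt_U hp hq (g := 0) (E := E) (x₀ := x) (y := y) (z := 0)
      (by simpa using hyd) (fun x => by simp)
      (by rw [hx]; rfl)
    have h2 := congrFun (congrFun h1 0) 0
    rw [hy0] at h2
    simp at h2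
  have hI : Complex.I * (Complex.I * (τ : ℂ)) = -τ := by
    rw [← mul_assoc, Complex.I_mul_I, neg_one_mul]
  have hd0 : ∀ x, HasDerivAt (fun x => y x 0) (τ • y x 0 + q x * y x 1) x := fun x => by
    refine (hasDerivAt_pi.1 (hyd x) 0).congr_deriv ?_
    simp only [Matrix.mulVec, dotProduct, Fin.sum_univ_two, U_apply, hE, Complex.real_smul]
    linear_combination -y x 0 * hI
  have hd1 : ∀ x, HasDerivAt (fun x => y x 1) (p x * y x 0 - τ • y x 1) x := fun x => by
    refine (hasDerivAt_pi.1 (hyd x) 1).congr_deriv ?_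
    simp only [Matrix.mulVec, dotProduct, Fin.sum_univ_two, U_apply, hE, Complex.real_smul]
    linear_combination y x 1 * hI
  set f : ℝ → ℝ := fun x => ‖y x 0‖ ^ 2 - ‖y x 1‖ ^ 2 with hf
  have hfd := fun x => (hd0 x).norm_sq.fun_sub (hd1 x).norm_sq
  have hmono : StrictMonoOn f (Set.Icc 0 Ω) := by
    refine strictMonoOn_of_deriv_pos (convex_Icc 0 Ω)
      (fun x _ => (hfd x).continuousAt.continuousWithinAt) fun x hx => ?_
    rw [interior_Icc] at hx
    rw [(hfd x).deriv, inner_add_right, inner_sub_right, real_inner_smul_right,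
      real_inner_smul_right, real_inner_self_eq_norm_sq, real_inner_self_eq_norm_sq]
    have h1 := abs_le.1 (abs_real_inner_le_norm (y x 0) (q x * y x 1))
    have h2 := abs_le.1 (abs_real_inner_le_norm (y x 1) (p x * y x 0))
    rw [norm_mul] at h1 h2
    have h3 : ‖p x‖ + ‖q x‖ ≤ B := (le_abs_self _).trans (hB x (Set.Ioo_subset_Icc_self hx))
    have h4 : 0 < ‖y x 0‖ ^ 2 + ‖y x 1‖ ^ 2 := by
      by_contra hcon
      have h5 : ‖y x 0‖ = 0 := by nlinarith [sq_nonneg ‖y x 0‖, sq_nonneg ‖y x 1‖]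
      have h6 : ‖y x 1‖ = 0 := by nlinarith [sq_nonneg ‖y x 0‖, sq_nonneg ‖y x 1‖]
      refine hyne x (funext fun i => ?_)
      fin_cases i
      · exact norm_eq_zero.1 h5
      · exact norm_eq_zero.1 h6
    have h7 : (‖p x‖ + ‖q x‖) * (2 * (‖y x 0‖ * ‖y x 1‖)) ≤
        B * (‖y x 0‖ ^ 2 + ‖y x 1‖ ^ 2) :=
      mul_le_mul h3 (by nlinarith [sq_nonneg (‖y x 0‖ - ‖y x 1‖)]) (by positivity)
        ((by positivity : 0 ≤ ‖p x‖ + ‖q x‖).trans h3)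
    have h8 : 0 ≤ B := (by positivity : 0 ≤ ‖p x‖ + ‖q x‖).trans h3
    have h9 := mul_nonneg h8 h4.le
    nlinarith
  have h1 := hmono (Set.left_mem_Icc.2 hΩ.le) (Set.right_mem_Icc.2 hΩ.le) hΩ
  have h2 : ∀ i, y Ω i = (s • (1 : Matrix (Fin 2) (Fin 2) ℂ)) i 0 := fun i => by
    rw [← hT, monodromy, zero_add]
    rfl
  simp [hf, h2, hs, hy0] at h1

end Monodromy

/-! ### Periodicity of `V` from minimality of the order. -/

section Periodicity

variable {p q : ℝ → ℂ} {Ω : ℝ} {n : ℕ} {v : ℕ → ℝ → Matrix (Fin 2) (Fin 2) ℂ}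

theorem eq_smul_J {W : Matrix (Fin 2) (Fin 2) ℂ} (h : W.trace = 0) (h01 : W 0 1 = 0)
    (h10 : W 1 0 = 0) : W = (-Complex.I * W 0 0) • J := by
  have hI := Complex.I_mul_I
  rw [Matrix.trace_fin_two] at h
  ext i j
  fin_cases i <;> fin_cases j <;>
    simp only [J, Matrix.smul_apply, smul_eq_mul, Matrix.of_apply, Matrix.cons_val', Fin.zero_eta,
      Fin.mk_one, Matrix.cons_val_zero, Matrix.cons_val_one, Matrix.cons_val_fin_one]
  · linear_combination W 0 0 * hI
  · rw [h01, mul_zero]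
  · rw [h10, mul_zero]
  · linear_combination h - W 0 0 * hI

theorem Q_add_period (hpΩ : Function.Periodic p Ω) (hqΩ : Function.Periodic q Ω) (x : ℝ) :
    Q p q (x + Ω) = Q p q x := by
  rw [Q, Q, hpΩ, hqΩ]

/-- If no expression of lower order commutes with `L`, then `V` is periodic. -/
theorem IsZeroCurvature.periodic (hv : IsZeroCurvature p q n v) (hQ : ContDiff ℝ n (Q p q))
    (hpΩ : Function.Periodic p Ω) (hqΩ : Function.Periodic q Ω)
    (hmin : ∀ m < n + 1, ¬ ∃ P : DiffExpr m, P.HasLeadingCoeff (J ^ (m + 1)) ∧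
      P.Commutes (L p q)) (E : ℂ) (x : ℝ) :
    matPoly v (n + 2) E (x + Ω) = matPoly v (n + 2) E x := by
  set w : ℕ → ℝ → Matrix (Fin 2) (Fin 2) ℂ := fun l x => v l (x + Ω) - v l x with hw
  have hws : ∀ l x, shift w l x = shift v l (x + Ω) - shift v l x := fun l x => by
    cases l with
    | zero => simp
    | succ l => rfl
  have hwd : ∀ l < n + 2, ∀ x, HasDerivAt (w l) (J * Q p q x * w l x - w l x * (J * Q p q x) -
      (J * shift w l x - shift w l x * J)) x := fun l hl x => by
    refine ((HasDerivAt.comp_add_const x Ω (hv.hasDerivAt_coeff hl (x + Ω))).fun_sub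
      (hv.hasDerivAt_coeff hl x)).congr_deriv ?_
    rw [Q_add_period hpΩ hqΩ, hws]
    simp only [hw, mul_sub, sub_mul]
    abel
  have hwt : ∀ l x, (w l x).trace = 0 := fun l x => by
    simp only [hw, Matrix.trace_sub, hv.trace_eq, sub_self]
  -- Descending induction on the coefficients of the increment `w`, which obeys the same linear
  -- recursion as `v` and has zero top coefficient.
  have key : ∀ k ≤ n + 1, ∀ x, w (n + 1 - k) x = 0 := by
    intro k
    induction k with
    | zero =>
      intro _ x
      simp only [hw, Nat.sub_zero, hv.leading, sub_self]
    | succ k ih =>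
      intro hk
      set m := n + 1 - (k + 1) with hm
      have hm1 : w (m + 1) = 0 := funext fun x => by
        rw [show m + 1 = n + 1 - k by omega]
        exact ih (by omega) x
      -- The recursion one index higher, where `w` vanishes, says that the next coefficient commutes
      -- with `J`. Being traceless it is a multiple of `J`, constant in `x` by its own recursion.
      have hcomm : ∀ x, J * w m x = w m x * J := fun x => by
        have h1 := hwd (m + 1) (by omega) x
        rw [hm1] at h1
        have h2 := h1.unique (hasDerivAt_const x 0)
        simpa [sub_eq_zero, eq_comm] using h2
      have h01 : ∀ x, w m x 0 1 = 0 := fun x => by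
        have h1 := congrFun (congrFun (hcomm x) 0) 1
        simp only [J, Matrix.mul_apply, Fin.sum_univ_two, Matrix.of_apply, Matrix.cons_val',
          Matrix.cons_val_zero, Matrix.cons_val_one, Matrix.cons_val_fin_one] at h1
        have h2 : 2 * Complex.I * w m x 0 1 = 0 := by linear_combination h1
        simpa using h2
      have h10 : ∀ x, w m x 1 0 = 0 := fun x => by
        have h1 := congrFun (congrFun (hcomm x) 1) 0
        simp only [J, Matrix.mul_apply, Fin.sum_univ_two, Matrix.of_apply, Matrix.cons_val',
          Matrix.cons_val_zero, Matrix.cons_val_one, Matrix.cons_val_fin_one] at h1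
        have h2 : 2 * Complex.I * w m x 1 0 = 0 := by linear_combination -h1
        simpa using h2
      have h00 : ∀ x, HasDerivAt (fun x => w m x 0 0) 0 x := fun x => by
        refine (hasDerivAt_matrix_iff.1 (hwd m (by omega) x) 0 0).congr_deriv ?_
        simp only [J, Q, Matrix.sub_apply, Matrix.mul_apply, Fin.sum_univ_two, Matrix.of_apply,
          Matrix.cons_val', Matrix.cons_val_zero, Matrix.cons_val_one, Matrix.cons_val_fin_one,
          h01, h10]
        ring
      set α := -Complex.I * w m 0 0 0 with hα
      have hwα : ∀ x, w m x = α • J := fun x => by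
        rw [eq_smul_J (hwt m x) (h01 x) (h10 x), eq_of_hasDerivAt_zero h00 x 0]
      by_cases hα0 : α = 0
      · intro x
        rw [hwα, hα0, zero_smul]
      -- Were the constant `α` nonzero, `α⁻¹ w` would have leading coefficient `J` at index `m` and
      -- yield a commuting expression of order `m < n + 1`.
      · refine absurd ?_ (hmin m (by omega))
        refine exists_commutes_of_recursion (b := fun l x => α⁻¹ • w l x)
          (hQ.of_le (by exact_mod_cast (by omega)))
          (fun x => by rw [hwα, smul_smul, inv_mul_cancel₀ hα0, one_smul]) fun l hl x => ?_
        refine ((hwd l (by omega) x).fun_const_smul α⁻¹).congr_deriv ?_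
        have hs : shift (fun l x => α⁻¹ • w l x) l x = α⁻¹ • shift w l x := by
          cases l with
          | zero => simp
          | succ l => rfl
        rw [hs]
        simp only [smul_sub, mul_smul_comm, smul_mul_assoc]
  refine Finset.sum_congr rfl fun l hl => ?_
  have h1 := key (n + 1 - l) (by omega) x
  rw [show n + 1 - (n + 1 - l) = l by have := Finset.mem_range.1 hl; omega] at h1
  rw [sub_eq_zero.1 h1]

end Periodicity

/-! ### Degrees and roots of the entries of `V`. -/

section EntryPolynomials

open Polynomial

/-- The entries of the matrix polynomial as polynomials. -/
noncomputable def entryPoly (v : ℕ → ℝ → Matrix (Fin 2) (Fin 2) ℂ) (m : ℕ) (i j : Fin 2) (x : ℝ) :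
    ℂ[X] :=
  ∑ l ∈ Finset.range m, C (v l x i j) * X ^ l

variable {p q : ℝ → ℂ} {n : ℕ} {v : ℕ → ℝ → Matrix (Fin 2) (Fin 2) ℂ}

theorem eval_entryPoly (m : ℕ) (i j : Fin 2) (x : ℝ) (E : ℂ) :
    (entryPoly v m i j x).eval E = matPoly v m E x i j := by
  simp only [entryPoly, matPoly, eval_finsetSum, eval_mul, eval_C, eval_pow, eval_X,
    Matrix.sum_apply, Matrix.smul_apply, smul_eq_mul, mul_comm]

theorem coeff_entryPoly (m : ℕ) (i j : Fin 2) (x : ℝ) (l : ℕ) :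
    (entryPoly v m i j x).coeff l = if l < m then v l x i j else 0 := by
  simp [entryPoly, coeff_X_pow]

theorem natDegree_entryPoly_le (hv : IsZeroCurvature p q n v) {i j : Fin 2} (hij : J i j = 0)
    (x : ℝ) : (entryPoly v (n + 2) i j x).natDegree ≤ n := by
  refine natDegree_le_iff_coeff_eq_zero.2 fun l hl => ?_
  rw [coeff_entryPoly]
  split_ifs with h
  · obtain rfl : l = n + 1 := by omega
    rw [hv.leading, hij]
  · rfl

/-- The recursion at the constant top coefficient reads `[J, v_n] = [J Q, J]`, which determines the
off-diagonal part of `v_n`. This fixes the number of movable eigenvalues where `q(x) ≠ 0`. -/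
theorem IsZeroCurvature.coeff_zero_one (hv : IsZeroCurvature p q n v) (x : ℝ) :
    (entryPoly v (n + 2) 0 1 x).coeff n = -q x := by
  rw [coeff_entryPoly, if_pos (by omega)]
  have h1 := hv.hasDerivAt_coeff (l := n + 1) (by omega) x
  have h2 : v (n + 1) = fun _ => J := funext hv.leading
  rw [h2] at h1
  have h3 := congrFun (congrFun (h1.unique (hasDerivAt_const x J)) 0) 1
  simp only [J, Q, shift_succ, Matrix.sub_apply, Matrix.mul_apply, Fin.sum_univ_two,
    Matrix.of_apply, Matrix.cons_val', Matrix.cons_val_zero, Matrix.cons_val_one,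
    Matrix.cons_val_fin_one, Matrix.zero_apply] at h3
  have hI := Complex.I_mul_I
  have h4 : 2 * Complex.I * (v n x 0 1 + q x) = 0 := by
    linear_combination -h3 + 2 * Complex.I * q x * hI
  have h5 : v n x 0 1 + q x = 0 := by simpa using h4
  linear_combination h5

theorem IsZeroCurvature.natDegree_zero_one (hv : IsZeroCurvature p q n v) {x : ℝ} (hx : q x ≠ 0) :
    (entryPoly v (n + 2) 0 1 x).natDegree = n :=
  natDegree_eq_of_le_of_coeff_ne_zero (natDegree_entryPoly_le hv (by simp [J]) x)
    (by rw [hv.coeff_zero_one]; simpa using hx)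

theorem IsZeroCurvature.natDegree_zero_zero (hv : IsZeroCurvature p q n v) (x : ℝ) :
    (entryPoly v (n + 2) 0 0 x).natDegree = n + 1 := by
  refine natDegree_eq_of_le_of_coeff_ne_zero ?_ ?_
  · refine natDegree_le_iff_coeff_eq_zero.2 fun l hl => ?_
    rw [coeff_entryPoly, if_neg (by omega)]
  · rw [coeff_entryPoly, if_pos (by omega), hv.leading]
    simp [J]

/-- The polynomial `-det V`. -/
noncomputable def curvePoly (v : ℕ → ℝ → Matrix (Fin 2) (Fin 2) ℂ) (m : ℕ) (x : ℝ) : ℂ[X] :=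
  entryPoly v m 0 0 x ^ 2 + entryPoly v m 0 1 x * entryPoly v m 1 0 x

theorem IsZeroCurvature.natDegree_curvePoly (hv : IsZeroCurvature p q n v) (x : ℝ) :
    (curvePoly v (n + 2) x).natDegree = 2 * n + 2 := by
  have h1 : (entryPoly v (n + 2) 0 0 x ^ 2).natDegree = 2 * n + 2 := by
    rw [natDegree_pow, hv.natDegree_zero_zero]; ring
  have h2 : (entryPoly v (n + 2) 0 1 x * entryPoly v (n + 2) 1 0 x).natDegree ≤ n + n :=
    natDegree_mul_le_of_le (natDegree_entryPoly_le hv (by simp [J]) x)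
      (natDegree_entryPoly_le hv (by simp [J]) x)
  rw [curvePoly, natDegree_add_eq_left_of_natDegree_lt (by omega), h1]

theorem IsZeroCurvature.eval_curvePoly (hv : IsZeroCurvature p q n v) (x : ℝ) (E : ℂ) :
    (curvePoly v (n + 2) x).eval E = -(matPoly v (n + 2) E x).det := by
  rw [curvePoly, eval_add, eval_pow, eval_mul, eval_entryPoly, eval_entryPoly, eval_entryPoly,
    Matrix.det_fin_two, hv.apply_one_one]
  ring

theorem analyticOrderAt_eval {P : ℂ[X]} (hP : P ≠ 0) (E : ℂ) :
    analyticOrderAt (fun z => P.eval z) E = P.rootMultiplicity E := by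
  obtain ⟨R, hR, hR'⟩ := exists_eq_pow_rootMultiplicity_mul_and_not_dvd P hP E
  refine (AnalyticAt.analyticOrderAt_eq_natCast
    (P.differentiable.analyticAt E)).2 ⟨fun z => R.eval z, R.differentiable.analyticAt E, ?_,
      Filter.Eventually.of_forall fun z => ?_⟩
  · rwa [Ne, ← IsRoot.def, ← dvd_iff_isRoot]
  · conv_lhs => rw [hR]
    simp

theorem hasSum_rootMultiplicity {P : ℂ[X]} :
    HasSum (fun E => (P.rootMultiplicity E : ℕ∞)) (P.natDegree : ℕ∞) := by
  classical
  have h : ∑ E ∈ P.roots.toFinset, (P.rootMultiplicity E : ℕ∞) = (P.natDegree : ℕ∞) := by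
    rw [← IsAlgClosed.card_roots_eq_natDegree, ← Multiset.toFinset_sum_count_eq, Nat.cast_sum]
    simp only [count_roots]
  rw [← h]
  refine hasSum_sum_of_ne_finset_zero fun E hE => ?_
  rw [← count_roots, Multiset.count_eq_zero_of_notMem (by simpa using hE), Nat.cast_zero]

theorem exists_le_norm_eval {P : ℂ[X]} (hP : P ≠ 0) :
    ∃ δ > 0, ∃ ρ, ∀ z : ℂ, ρ ≤ ‖z‖ → δ ≤ ‖P.eval z‖ := by
  by_cases hd : 0 < P.degree
  · have h1 := P.tendsto_norm_atTop hd (z := fun z : ℂ => z) tendsto_norm_cobounded_atTop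
    have h2 := h1.eventually_ge_atTop 1
    rw [← comap_norm_atTop, Filter.eventually_comap] at h2
    obtain ⟨ρ, hρ⟩ := Filter.eventually_atTop.1 h2
    exact ⟨1, one_pos, ρ, fun z hz => hρ _ hz z rfl⟩
  · rw [eq_C_of_degree_le_zero (not_lt.1 hd)] at hP ⊢
    refine ⟨‖P.coeff 0‖, norm_pos_iff.2 fun h => hP (by rw [h, C_0]), 0, fun z _ => ?_⟩
    rw [eval_C]

end EntryPolynomials

/-! ### The entire multiplier `c` in `T = t + c V`. -/

section Multiplier

variable {p q : ℝ → ℂ} {Ω : ℝ} {n : ℕ} {v : ℕ → ℝ → Matrix (Fin 2) (Fin 2) ℂ}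

/-- The commutant of a non-scalar `2 × 2` matrix is spanned by the identity and the matrix; the `(0,
1)` entry identifies the coefficient. -/
theorem eq_smul_one_add_smul_of_commute {T V : Matrix (Fin 2) (Fin 2) ℂ} (hV : V.trace = 0)
    (h01 : V 0 1 ≠ 0) (h : V * T = T * V) :
    T = (T.trace / 2) • (1 : Matrix (Fin 2) (Fin 2) ℂ) + (T 0 1 / V 0 1) • V := by
  rw [Matrix.trace_fin_two] at hV
  have h1 := congrFun (congrFun h 0) 0
  have h2 := congrFun (congrFun h 0) 1
  simp only [Matrix.mul_apply, Fin.sum_univ_two] at h1 h2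
  have h4 : V 1 1 = -V 0 0 := by linear_combination hV
  rw [h4] at h2
  ext i j
  fin_cases i <;> fin_cases j <;>
    simp only [Matrix.add_apply, Matrix.smul_apply, Matrix.one_apply, Matrix.trace_fin_two,
      smul_eq_mul, Fin.zero_eta, Fin.mk_one, Fin.isValue, if_true, zero_ne_one, one_ne_zero,
      if_false, h4] <;> field_simp
  · linear_combination -h2
  · ring
  · linear_combination 2 * h1
  · linear_combination h2

/-- The monodromy matrix is a combination of the identity and of `V`. -/
theorem IsZeroCurvature.exists_multiplier (hv : IsZeroCurvature p q n v) (hp : Continuous p)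
    (hq : Continuous q) (hpΩ : Function.Periodic p Ω) (hqΩ : Function.Periodic q Ω)
    (hper : ∀ E x, matPoly v (n + 2) E (x + Ω) = matPoly v (n + 2) E x)
    (hne : ∀ E, ∃ x, matPoly v (n + 2) E x 0 1 ≠ 0) : ∃ c : ℂ → ℂ, ∀ E x, ∃ t : ℂ,
      monodromy p q Ω E x = t • (1 : Matrix (Fin 2) (Fin 2) ℂ) + c E • matPoly v (n + 2) E x := by
  have h : ∀ E, ∃ c : ℂ, ∀ x, ∃ t : ℂ,
      monodromy p q Ω E x = t • (1 : Matrix (Fin 2) (Fin 2) ℂ) + c • matPoly v (n + 2) E x := by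
    intro E
    obtain ⟨x₀, hx₀⟩ := hne E
    have h1 := hv.mul_phi hp hq E x₀ (x₀ + Ω)
    rw [hper] at h1
    have h2 := eq_smul_one_add_smul_of_commute (by
      rw [Matrix.trace_fin_two, hv.apply_one_one, add_neg_cancel]) hx₀ h1
    -- Conjugation by `φ(E, x, x₀)` carries both `T` and `V` from `x₀` to `x`, so the coefficient
    -- found at `x₀` serves everywhere.
    refine ⟨phi p q E (x₀ + Ω) x₀ 0 1 / matPoly v (n + 2) E x₀ 0 1, fun x =>
      ⟨(phi p q E (x₀ + Ω) x₀).trace / 2, ?_⟩⟩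
    rw [monodromy_eq_conj hp hq hpΩ hqΩ E x₀ x, monodromy]
    conv_lhs => rw [h2]
    rw [mul_add, add_mul, mul_smul_comm, mul_one, smul_mul_assoc, phi_mul_adjugate hp hq,
      mul_smul_comm, smul_mul_assoc, ← hv.mul_phi hp hq, mul_assoc, phi_mul_adjugate hp hq, mul_one]
  choose c hc using h
  exact ⟨c, hc⟩

variable {c : ℂ → ℂ}

theorem monodromy_zero_one_eq (hc : ∀ E x, ∃ t : ℂ, monodromy p q Ω E x =
      t • (1 : Matrix (Fin 2) (Fin 2) ℂ) + c E • matPoly v (n + 2) E x) (E : ℂ) (x : ℝ) :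
    monodromy p q Ω E x 0 1 = c E * (entryPoly v (n + 2) 0 1 x).eval E := by
  obtain ⟨t, ht⟩ := hc E x
  rw [ht, eval_entryPoly]
  simp

/-- Near a given `E`, `c` is the quotient of `T₁₂` by `V₁₂` at a point `x` chosen so that `V₁₂(E, x)
≠ 0`; independence of `x` makes these local quotients one function. -/
theorem differentiable_multiplier (hp : Continuous p) (hq : Continuous q) (hΩ : 0 < Ω)
    (hc : ∀ E x, ∃ t : ℂ, monodromy p q Ω E x =
      t • (1 : Matrix (Fin 2) (Fin 2) ℂ) + c E • matPoly v (n + 2) E x)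
    (hne : ∀ E, ∃ x, (entryPoly v (n + 2) 0 1 x).eval E ≠ 0) : Differentiable ℂ c := by
  intro E
  obtain ⟨x, hx⟩ := hne E
  have h1 : c =ᶠ[nhds E] fun z => monodromy p q Ω z x 0 1 / (entryPoly v (n + 2) 0 1 x).eval z := by
    filter_upwards [(entryPoly v (n + 2) 0 1 x).continuous.continuousAt.eventually_ne hx] with z hz
    rw [monodromy_zero_one_eq hc, mul_div_cancel_right₀ _ hz]
  exact ((differentiable_monodromy hp hq hΩ x 0 1 E).div
    (entryPoly v (n + 2) 0 1 x).differentiableAt hx).congr_of_eventuallyEq h1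

/-- Far from the origin the nonzero polynomial `V₁₂` is bounded below, so `c` grows no faster than
`T₁₂`; a compact disk remains. -/
theorem exists_norm_multiplier_le (hp : Continuous p) (hq : Continuous q) (hΩ : 0 < Ω)
    (hc : ∀ E x, ∃ t : ℂ, monodromy p q Ω E x =
      t • (1 : Matrix (Fin 2) (Fin 2) ℂ) + c E • matPoly v (n + 2) E x)
    (hcd : Continuous c) {x : ℝ} (hx : entryPoly v (n + 2) 0 1 x ≠ 0) :
    ∃ C, ∀ E, ‖c E‖ ≤ C * Real.exp (Ω * ‖E‖) := by
  obtain ⟨M, hM⟩ := exists_norm_sol_le hp hq hΩ x (Pi.single 1 1)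
  obtain ⟨δ, hδ, ρ, hρ⟩ := exists_le_norm_eval hx
  obtain ⟨B, hB⟩ := (isCompact_closedBall (0 : ℂ) ρ).exists_bound_of_continuousOn hcd.continuousOn
  refine ⟨max (M / δ) B, fun E => ?_⟩
  have hexp : 1 ≤ Real.exp (Ω * ‖E‖) := Real.one_le_exp (by positivity)
  rcases le_total ρ ‖E‖ with hE | hE
  · have h1 : ‖c E‖ * δ ≤ M * Real.exp (Ω * ‖E‖) := by
      calc ‖c E‖ * δ ≤ ‖c E‖ * ‖(entryPoly v (n + 2) 0 1 x).eval E‖ :=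
            mul_le_mul_of_nonneg_left (hρ E hE) (norm_nonneg _)
        _ = ‖monodromy p q Ω E x 0 1‖ := by rw [monodromy_zero_one_eq hc, norm_mul]
        _ ≤ ‖sol p q E x (Pi.single 1 1) (x + Ω)‖ :=
            norm_le_pi_norm (sol p q E x (Pi.single 1 1) (x + Ω)) 0
        _ ≤ _ := hM E
    rw [← le_div_iff₀ hδ, mul_div_right_comm] at h1
    exact h1.trans (mul_le_mul_of_nonneg_right (le_max_left _ _) (Real.exp_pos _).le)
  · have h1 : ‖c E‖ ≤ max (M / δ) B := (hB E (by simpa using hE)).trans (le_max_right _ _)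
    calc ‖c E‖ ≤ max (M / δ) B * 1 := by rwa [mul_one]
      _ ≤ _ := mul_le_mul_of_nonneg_left hexp ((norm_nonneg _).trans h1)

/-- Where `c` vanishes, `T` is scalar, and `det T = 1` makes the scalar unimodular;
`exists_monodromy_ne_smul_one` excludes this at one energy. -/
theorem exists_multiplier_ne_zero (hp : Continuous p) (hq : Continuous q) (hΩ : 0 < Ω)
    (hc : ∀ E x, ∃ t : ℂ, monodromy p q Ω E x =
      t • (1 : Matrix (Fin 2) (Fin 2) ℂ) + c E • matPoly v (n + 2) E x) : ∃ E, c E ≠ 0 := by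
  obtain ⟨E, hE⟩ := exists_monodromy_ne_smul_one hp hq hΩ
  refine ⟨E, fun h => ?_⟩
  obtain ⟨t, ht⟩ := hc E 0
  rw [h, zero_smul, add_zero] at ht
  refine hE t ?_ ht
  have hdet : (monodromy p q Ω E 0).det = 1 := det_phi hp hq E 0 (0 + Ω)
  rw [ht] at hdet
  have h1 : t ^ 2 = 1 := by simpa [Matrix.det_smul] using hdet
  have h2 : ‖t‖ ^ 2 = 1 := by rw [← norm_pow, h1, norm_one]
  exact (pow_eq_one_iff_of_nonneg (norm_nonneg t) two_ne_zero).1 h2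

/-- For traceless `V`, `T = t + c V` has trace `2t` and determinant `t² + c² det V = 1`. The
determinant of `V` may be taken at `0` since it is constant in `x`. -/
theorem IsZeroCurvature.trace_sq_sub_four (hv : IsZeroCurvature p q n v) (hp : Continuous p)
    (hq : Continuous q) (hc : ∀ E x, ∃ t : ℂ, monodromy p q Ω E x =
      t • (1 : Matrix (Fin 2) (Fin 2) ℂ) + c E • matPoly v (n + 2) E x) (E : ℂ) (x : ℝ) :
    (monodromy p q Ω E x).trace ^ 2 - 4 = 4 * c E ^ 2 * (curvePoly v (n + 2) 0).eval E := by
  have hdet : (monodromy p q Ω E x).det = 1 := det_phi hp hq E x (x + Ω)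
  have hV : (matPoly v (n + 2) E x).det = (matPoly v (n + 2) E 0).det := by
    have h1 := congrArg Matrix.det (hv.mul_phi hp hq E 0 x)
    rwa [Matrix.det_mul, Matrix.det_mul, det_phi hp hq, mul_one, one_mul] at h1
  obtain ⟨t, ht⟩ := hc E x
  rw [hv.eval_curvePoly, ← hV]
  rw [ht] at hdet ⊢
  rw [Matrix.det_fin_two] at hdet ⊢
  simp only [Matrix.trace_fin_two, Matrix.add_apply, Matrix.smul_apply, Matrix.one_apply,
    smul_eq_mul, Fin.isValue, if_true, zero_ne_one, one_ne_zero, if_false, hv.apply_one_one]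
    at hdet ⊢
  linear_combination 4 * hdet

end Multiplier

/-! ### Splitting multiplicities into immovable and movable parts. -/

section Multiplicities

variable {p q : ℝ → ℂ} {Ω : ℝ} {n : ℕ} {v : ℕ → ℝ → Matrix (Fin 2) (Fin 2) ℂ} {c : ℂ → ℂ}

theorem analyticOrderAt_monodromy (hcd : Differentiable ℂ c) {z₀ : ℂ} (hz₀ : c z₀ ≠ 0)
    (hc : ∀ E x, ∃ t : ℂ, monodromy p q Ω E x =
      t • (1 : Matrix (Fin 2) (Fin 2) ℂ) + c E • matPoly v (n + 2) E x) (E : ℂ) (x : ℝ) :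
    analyticOrderAt (fun E => monodromy p q Ω E x 0 1) E = analyticOrderNatAt c E +
      analyticOrderAt (fun z => (entryPoly v (n + 2) 0 1 x).eval z) E := by
  have h1 : (fun E => monodromy p q Ω E x 0 1) =
      c * fun z => (entryPoly v (n + 2) 0 1 x).eval z := funext fun E =>
    monodromy_zero_one_eq hc E x
  rw [h1, analyticOrderAt_mul (hcd.analyticAt E)
    ((entryPoly v (n + 2) 0 1 x).differentiable.analyticAt E),
    Nat.cast_analyticOrderNatAt (analyticOrderAt_ne_top_of_entire hcd hz₀ E)]

theorem delta_eq_add (hp : Continuous p) (hq : Continuous q) (hΩ : 0 < Ω)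
    (hcd : Differentiable ℂ c) {z₀ : ℂ} (hz₀ : c z₀ ≠ 0)
    (hc : ∀ E x, ∃ t : ℂ, monodromy p q Ω E x =
      t • (1 : Matrix (Fin 2) (Fin 2) ℂ) + c E • matPoly v (n + 2) E x) (E : ℂ) {x : ℝ}
    (hx : entryPoly v (n + 2) 0 1 x ≠ 0) :
    delta p q Ω E x = analyticOrderNatAt c E + (entryPoly v (n + 2) 0 1 x).rootMultiplicity E := by
  have h1 := analyticOrderAt_monodromy hcd hz₀ hc E x
  rw [analyticOrderAt_eval hx] at h1
  rw [← Nat.cast_add]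
  exact delta_eq_order hp hq hΩ (by exact_mod_cast h1)

/-- The order of `c` is attained at any `x` with `V₁₂(E, x) ≠ 0`. The lower bound must cover all
`x`, including those where `V₁₂(·, x)` might be the zero polynomial, hence `le_delta_of_le_order`
instead of the exact formula. -/
theorem deltaI_eq (hp : Continuous p) (hq : Continuous q) (hΩ : 0 < Ω)
    (hcd : Differentiable ℂ c) {z₀ : ℂ} (hz₀ : c z₀ ≠ 0)
    (hc : ∀ E x, ∃ t : ℂ, monodromy p q Ω E x =
      t • (1 : Matrix (Fin 2) (Fin 2) ℂ) + c E • matPoly v (n + 2) E x)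
    (hne : ∀ E, ∃ x, (entryPoly v (n + 2) 0 1 x).eval E ≠ 0) (E : ℂ) :
    deltaI p q Ω E = analyticOrderNatAt c E := by
  refine le_antisymm ?_ (le_iInf fun x => le_delta_of_le_order hp hq hΩ ?_)
  · obtain ⟨x, hx⟩ := hne E
    refine (iInf_le _ x).trans ?_
    have hx0 : entryPoly v (n + 2) 0 1 x ≠ 0 := fun h => hx (by rw [h, Polynomial.eval_zero])
    rw [delta_eq_add hp hq hΩ hcd hz₀ hc E hx0, Polynomial.rootMultiplicity_eq_zero hx,
      Nat.cast_zero, add_zero]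
  · rw [analyticOrderAt_monodromy hcd hz₀ hc E x]
    exact le_self_add

end Multiplicities

end AKNS

theorem theoremt4p4 (n : ℕ) (Ω : ℝ) (hΩ : 0 < Ω) (p q : ℝ → ℂ)
    (hp : LocallyIntegrable p volume) (hq : LocallyIntegrable q volume)
    (hpΩ : Function.Periodic p Ω) (hqΩ : Function.Periodic q Ω)
    (hq0 : ∃ x, q x ≠ 0)
    (hex : ∃ P : AKNS.DiffExpr (n + 1),
      P.HasLeadingCoeff (AKNS.J ^ (n + 2)) ∧ P.Commutes (AKNS.L p q))
    (hmin : ∀ m < n + 1, ¬ ∃ P : AKNS.DiffExpr m,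
      P.HasLeadingCoeff (AKNS.J ^ (m + 1)) ∧ P.Commutes (AKNS.L p q)) :
    (∀ x, q x ≠ 0 →
      (∀ E, AKNS.delta p q Ω E x ≠ ⊤) ∧
      HasSum (fun E : ℂ => AKNS.deltaM p q Ω E x) (n : ℕ∞)) ∧
    (∀ E, Multipliable (AKNS.factor p q Ω E)) ∧
    ∃ (d₀ : ℂ) (U : Polynomial ℂ), U.natDegree = 2 * n + 2 ∧
      ∀ (E : ℂ) (x₀ : ℝ),
        (AKNS.monodromy p q Ω E x₀).trace ^ 2 - 4 = U.eval E * AKNS.D p q Ω d₀ E ^ 2 := by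
  obtain ⟨A, hJ, hA⟩ := hex
  obtain ⟨x₁, hx₁⟩ := hq0
  obtain ⟨hpn, hqn⟩ := AKNS.contDiff_of_commutes hA
  have hpc := hpn.continuous
  have hqc := hqn.continuous
  have hQ := AKNS.contDiff_Q hpn hqn
  obtain ⟨v, hv⟩ := AKNS.exists_isZeroCurvature hJ hA
  -- Otherwise `V(E, ·)` vanishes identically and division by a linear factor produces a commuting
  -- expression of order `n`, against minimality.
  have hne : ∀ E, ∃ x, AKNS.matPoly v (n + 2) E x 0 1 ≠ 0 := fun E => by
    by_contra! hcon
    exact hmin n (Nat.lt_succ_self n)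
      (hv.exists_commutes hQ (hv.eq_zero_of_zero_one hpc hqc hx₁ hcon))
  obtain ⟨c, hc⟩ := hv.exists_multiplier hpc hqc hpΩ hqΩ (hv.periodic hQ hpΩ hqΩ hmin) hne
  have hne' : ∀ E, ∃ x, (AKNS.entryPoly v (n + 2) 0 1 x).eval E ≠ 0 := fun E => by
    simpa only [AKNS.eval_entryPoly] using hne E
  have hF : ∀ x, q x ≠ 0 → AKNS.entryPoly v (n + 2) 0 1 x ≠ 0 := fun x hx h => by
    have h1 := hv.coeff_zero_one x
    rw [h, Polynomial.coeff_zero] at h1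
    exact hx (neg_eq_zero.1 h1.symm)
  have hcd := AKNS.differentiable_multiplier hpc hqc hΩ hc hne'
  obtain ⟨z₀, hz₀⟩ := AKNS.exists_multiplier_ne_zero hpc hqc hΩ hc
  obtain ⟨C, hC⟩ := AKNS.exists_norm_multiplier_le hpc hqc hΩ hc hcd.continuous (hF x₁ hx₁)
  obtain ⟨hmul, a, d, ha, hfac⟩ := AKNS.exists_hadamard_factorization hcd hz₀ hΩ.le hC
  have hI : ∀ E, AKNS.deltaI p q Ω E = analyticOrderNatAt c E :=
    AKNS.deltaI_eq hpc hqc hΩ hcd hz₀ hc hne'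
  have hfactor : ∀ E, AKNS.factor p q Ω E = fun w : {w : ℂ // w ≠ 0} =>
      ((1 - E / w) * Complex.exp (E / w)) ^ analyticOrderNatAt c w := fun E => by
    ext1 w
    rw [AKNS.factor, hI, ENat.toNat_natCast]
  -- Since `c = a D` with the exponent `d` from Hadamard's theorem, `4 c² (-det V)` equals `4 a²
  -- (-det V) D²`.
  refine ⟨fun x hx => ⟨fun E => ?_, ?_⟩, fun E => ?_, d,
    Polynomial.C (4 * a ^ 2) * AKNS.curvePoly v (n + 2) 0, ?_, fun E x => ?_⟩
  · rw [AKNS.delta_eq_add hpc hqc hΩ hcd hz₀ hc E (hF x hx), ← Nat.cast_add]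
    exact ENat.natCast_ne_top _
  · have h1 : (fun E => AKNS.deltaM p q Ω E x) = fun E =>
        ((AKNS.entryPoly v (n + 2) 0 1 x).rootMultiplicity E : ℕ∞) := by
      ext1 E
      rw [AKNS.deltaM, hI, AKNS.delta_eq_add hpc hqc hΩ hcd hz₀ hc E (hF x hx), ← Nat.cast_add,
        ← ENat.natCast_sub, Nat.add_sub_cancel_left]
    rw [h1]
    have h2 := AKNS.hasSum_rootMultiplicity (P := AKNS.entryPoly v (n + 2) 0 1 x)
    rwa [hv.natDegree_zero_one hx] at h2
  · rw [hfactor]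
    exact hmul E
  · rw [Polynomial.natDegree_C_mul (by simpa using ha), hv.natDegree_curvePoly]
  · have hD : c E = a * AKNS.D p q Ω d E := by
      rw [hfac E, AKNS.D, hfactor, hI, ENat.toNat_natCast]
    rw [hv.trace_sq_sub_four hpc hqc hc, hD, Polynomial.eval_mul, Polynomial.eval_C]
    ring
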